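/- Let $g:[0,1]\to\mathbb R$ be a strictly increasing, strictly convex function of class $C^3[0,1]$ with $g(0)=0$, and suppose that the curvature $g''(u)/(1+g'(u)^2)^{3/2}$ of its graph $\gamma$ is bounded from below on $[0,1]$ by a positive constant. Put $c_\gamma=g(1)>0$, $t_0=\inf_{[0,1]} g'$, $t_1=\sup_{[0,1]} g'$, $u_\gamma(t)=\sup\{u\in[0,1]: g'(u)\le t\}$ (with $\sup\emptyset=0$), and, for $t_0\le t\le t_1$, $\varkappa_\gamma(t)=g''(u_\gamma(t))/(1+t^2)^{3/2}$. With $\kappa=(2\zeta(3)/\zeta(2))^{1/3}$ set $$\delta_1(t)=\kappa\,\varkappa_\gamma(t)^{1/3}\,\frac{c_\gamma\sqrt{1+t^2}}{c_\gamma+t},\qquad \delta_2(t)=\frac{\delta_1(t)}{c_\gamma}\qquad(t_0\le t\le t_1),$$ and $\delta_1(t)=\delta_2(t)=+\infty$ for all other $t\in[0,\infty]$. Let $\mathcal X$ be the set of pairs $x=(x_1,x_2)$ of coprime nonnegative integers. For $n=(n_1,n_2)$ with $n_1,n_2\ge1$ put $\rho_n=c_\gamma n_1/n_2$, $\alpha_n=(\rho_n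 n_1)^{-1/3}$, and, for $x\in\mathcal X$, with $t=\rho_n x_2/x_1\in[0,\infty]$, $$z_1(x)=e^{-\alpha_n\delta_1(t)},\qquad z_2(x)=e^{-\alpha_n\rho_n\delta_2(t)}\qquad(e^{-\infty}=0),\qquad z^x=z_1(x)^{x_1}z_2(x)^{x_2}\quad(0^0=1).$$ Let $Q_z^\gamma$ (which depends on $n$) be the measure on the set of finitely supported functions $\nu:\mathcal X\to\mathbb Z_{\ge0}$ (equivalently, on finite convex lattice polygonal lines starting at the origin, with edges $x\,\nu(x)$ arranged by increasing slope) with the point masses $$Q_z^\gamma(\nu)=\prod_{x\in\mathcal X} (z^{x})^{\nu(x)}(1-z^x),$$ and let $\xi=\sum_{x\in\mathcal X}x\,\nu(x)$ be the right endpoint of the polygonal line. Then, as $n_1,n_2\to\infty$ with $n_2/n_1\to c_\gamma$, $$Q_z^\gamma\{\xi=n\}\asymp n_1^{-4/3},$$ that is, $0<\liminf n_1^{4/3}\,Q_z^\gamma\{\xi=n\}\le\limsup n_1^{4/3}\,Q_z^\gamma\{\xi=n\}<\infty$. -/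

import Mathlib

open Set Filter Topology MeasureTheory
open scoped ENNReal

noncomputable section

namespace ConvexLattice

/-! ### The curve: the graph of a function `g` on `[0,1]` -/

/-- `g'` on `[0,1]` (one-sided at the endpoints). -/
def gDeriv (g : ℝ → ℝ) (u : ℝ) : ℝ := derivWithin g (Icc 0 1) u

/-- `g''` on `[0,1]` (one-sided at the endpoints). -/
def gDeriv2 (g : ℝ → ℝ) (u : ℝ) : ℝ := iteratedDerivWithin 2 g (Icc 0 1) u

/-- The curvature of the graph of `g` at the point with abscissa `u`. -/
def curvature (g : ℝ → ℝ) (u : ℝ) : ℝ :=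
  gDeriv2 g u / (1 + gDeriv g u ^ 2) ^ (3 / 2 : ℝ)

/-- The smallest slope `t₀ = inf g'`. -/
def slopeMin (g : ℝ → ℝ) : ℝ := sInf (gDeriv g '' Icc 0 1)

/-- The largest slope `t₁ = sup g'`. -/
def slopeMax (g : ℝ → ℝ) : ℝ := sSup (gDeriv g '' Icc 0 1)

/-- The generalized inverse of the derivative, `u(t) = sup {u ∈ [0,1] : g'(u) ≤ t}`
(with `sup ∅ = 0`). -/
def uInv (g : ℝ → ℝ) (t : ℝ) : ℝ := sSup {u ∈ Icc (0 : ℝ) 1 | gDeriv g u ≤ t}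

/-- The curvature as a function of the slope `t ∈ [t₀, t₁]`. -/
def curvatureOfSlope (g : ℝ → ℝ) (t : ℝ) : ℝ :=
  gDeriv2 g (uInv g t) / (1 + t ^ 2) ^ (3 / 2 : ℝ)

/-- The series `ζ(s) = ∑_{k ≥ 1} 1 / k ^ s` at an integer `s`. -/
def zetaSeries (s : ℕ) : ℝ := ∑' k : ℕ, 1 / ((k : ℝ) + 1) ^ s

/-- `κ = (2 ζ(3) / ζ(2)) ^ (1/3)`. -/
def kappa : ℝ := (2 * zetaSeries 3 / zetaSeries 2) ^ (1 / 3 : ℝ)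

/-! ### The functions `δ₁, δ₂ : [0, ∞] → (0, ∞]` -/

/-- `δ₁(t)`, equal to `+∞` for slopes `t` outside `[t₀, t₁]`. -/
def delta1 (g : ℝ → ℝ) (t : ℝ≥0∞) : EReal :=
  open Classical in
  if ENNReal.ofReal (slopeMin g) ≤ t ∧ t ≤ ENNReal.ofReal (slopeMax g) then
    ((kappa * curvatureOfSlope g t.toReal ^ (1 / 3 : ℝ) *
      (g 1 * √(1 + t.toReal ^ 2) / (g 1 + t.toReal)) : ℝ) : EReal)
  else ⊤

/-- `δ₂(t) = δ₁(t) / c`, where `c = g 1`. -/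
def delta2 (g : ℝ → ℝ) (t : ℝ≥0∞) : EReal := delta1 g t / ((g 1 : ℝ) : EReal)

/-! ### Coprime vectors and configurations -/

/-- The set of pairs of coprime nonnegative integers. -/
abbrev CoprimePair : Type := {x : ℕ × ℕ // Nat.gcd x.1 x.2 = 1}

/-- Finitely supported configurations `ν : CoprimePair → ℕ`. They are identified with finite
convex lattice polygonal lines starting at the origin: the edges are the vectors `ν(x) x`,
arranged in the order of increasing slope. -/
abbrev Config : Type := CoprimePair →₀ ℕ

/-- All sets of configurations are events. -/
instance : MeasurableSpace Config := ⊤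

/-- The right endpoint `ξ = ∑ x ν(x)` of the polygonal line given by `ν`. -/
def endpoint (ν : Config) : ℕ × ℕ := ν.sum fun x k => k • (x : ℕ × ℕ)

/-- The multi-index power `z(x) ^ x = z₁(x) ^ x₁ * z₂(x) ^ x₂`. -/
def multiPow (z : CoprimePair → ℝ × ℝ) (x : CoprimePair) : ℝ :=
  (z x).1 ^ x.1.1 * (z x).2 ^ x.1.2

/-- The probability of a single configuration:
the product over all coprime `x` of `z ^ (x ν(x)) * (1 - z ^ x)`. -/
def configMass (z : CoprimePair → ℝ × ℝ) (ν : Config) : ℝ :=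
  ∏' x : CoprimePair, multiPow z x ^ ν x * (1 - multiPow z x)

/-- The measure `Q_z` on configurations with the above masses. -/
def measureQ (z : CoprimePair → ℝ × ℝ) : Measure Config :=
  Measure.sum fun ν : Config => ENNReal.ofReal (configMass z ν) • Measure.dirac ν

/-! ### The choice of the parameters for a given curve and a given `n = (n₁, n₂)` -/

/-- `ρ_n = c / c_n`, with `c = g 1` and `c_n = n₂ / n₁`. -/
def rho (g : ℝ → ℝ) (n : ℕ × ℕ) : ℝ := g 1 / ((n.2 : ℝ) / (n.1 : ℝ))

/-- `α_n = (ρ_n n₁) ^ (-1/3)`. -/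
def alpha (g : ℝ → ℝ) (n : ℕ × ℕ) : ℝ := (rho g n * (n.1 : ℝ)) ^ (-(1 / 3) : ℝ)

/-- The slope `ρ_n x₂ / x₁ ∈ [0, ∞]` of the rescaled vector `(x₁, ρ_n x₂)`;
it is `∞` for `x = (0, 1)`. -/
def scaledSlope (g : ℝ → ℝ) (n : ℕ × ℕ) (x : CoprimePair) : ℝ≥0∞ :=
  ENNReal.ofReal (rho g n * (x.1.2 : ℝ)) / (x.1.1 : ℝ≥0∞)

/-- The parameters `z₁(x) = exp (-α_n δ₁)` and `z₂(x) = exp (-α_n ρ_n δ₂)`, with `δ₁, δ₂` taken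
at the slope of `(x₁, ρ_n x₂)` and `exp (-∞) = 0`; so `z ^ x = exp (-α_n (x₁ δ₁ + ρ_n x₂ δ₂))`. -/
def paramZ (g : ℝ → ℝ) (n : ℕ × ℕ) (x : CoprimePair) : ℝ × ℝ :=
  ((EReal.exp (-(((alpha g n : ℝ) : EReal) * delta1 g (scaledSlope g n x)))).toReal,
   (EReal.exp (-(((alpha g n * rho g n : ℝ) : EReal) * delta2 g (scaledSlope g n x)))).toReal)

/-! ### Asymptotics -/

/-- The regime `n = (n₁, n₂) → ∞` (both coordinates) with `n₂ / n₁ → c`. -/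
def endpointFilter (c : ℝ) : Filter (ℕ × ℕ) :=
  (atTop ×ˢ atTop) ⊓ comap (fun n : ℕ × ℕ => (n.2 : ℝ) / (n.1 : ℝ)) (𝓝 c)

/-- `a ≍ b` along `l`: `0 < liminf a / b` and `limsup a / b < ∞`. -/
def SameOrder {ι : Type*} (l : Filter ι) (a b : ι → ℝ) : Prop :=
  0 < liminf (fun i => ((a i / b i : ℝ) : EReal)) l ∧
    limsup (fun i => ((a i / b i : ℝ) : EReal)) l < ⊤

end ConvexLattice

end

/-! Under `measureQ` the multiplicities ν(x) behave as independent geometric variables with ratios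
z^x, so ξ is a sum of independent vectors and the claim is a local limit theorem in the plane. Write
α = α_n, which is of the order n₁^{-1/3}. About α⁻² primitive vectors of length about α⁻¹ matter;
the mean of ξ is of the order α⁻³ and its covariance form is of the exact order α⁻⁴ in every
direction. Fourier inversion then gives a probability of the order (det Cov)^{-1/2} ≍ α⁴ ≍
n₁^{-4/3}, provided that the mean of ξ misses n by no more than a standard deviation, that is, by
O(α⁻²).

The mean is the delicate point. The formulas for δ₁, δ₂ are such that z^x = exp(-α x₁ Φ(t)) on the
cone t₀ ≤ t ≤ t₁, with Φ(t) = κ g''(u(t))^{1/3} (`multiPow_paramZ`). The substitution t = g'(u)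
shows that the leading terms of the mean are exactly n₁ and n₂ (`exists_slope_function`). For the
error, Möbius inversion turns a sum over primitive vectors into a sum of a kernel K₀ over all
lattice points of the cone, which is compared with integrals row by row. If K₀(x) were only known to
be of size x⁻², the rows would leave an error α⁻² ∑ 1/n, too large by a logarithm. The Mellin
transform of K₀ is Γ(w) ζ(w) / ζ(w - 1). Quantitative nonvanishing of ζ on Re s = 1 bounds this
function and two derivatives up to the line Re w = 2, and two integrations by parts gain a factor 1
/ (1 + log² x) (`exists_moebiusKernel_decay`). The rows then sum to O(α⁻²) uniformly in α
(`exists_primitive_sum_error`, `exists_mean_error`).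

The characteristic function is handled on two ranges. For |θ| of the order α at most, it is compared
with a Gaussian; third moments are O(α⁻⁵), and the resulting relative error is O(√α)
(`exists_integral_sub_le`). On the rest of the torus, primitive points on a row and on a column with
a prime coordinate of the order α⁻¹ form arithmetic progressions, and the cancellation there makes
the characteristic function at most exp(-c'/α) (`exists_sum_one_sub_cos_ge`). The lower bound on the
covariance comes again from the primitive-point asymptotics, applied in two disjoint subcones
(`exists_covariance_ge`).

All estimates are made for finite sets S of directions, uniformly in S, and pass to the infinite
product at the end (`measureQ_real_endpoint_mem_Icc`). The pieces meet in
`exists_local_limit_bounds`, `exists_cone_local_limit` and `eventually_measureQ_mem_Icc`. -/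

namespace LatticeLLT

/-! ### Polynomial bounds for the Riemann zeta function near the line `Re s = 1` -/

/-- The summands of `(s - 1) ζ(s) - 1`. -/
noncomputable def zetaTerm (n : ℕ) (s : ℂ) : ℂ :=
  (s - 1) * ((n + 1 : ℝ) : ℂ) ^ (-s) + ((n + 2 : ℝ) : ℂ) ^ (1 - s) - ((n + 1 : ℝ) : ℂ) ^ (1 - s)

lemma hasDerivAt_ofReal_cpow {x : ℝ} (hx : 0 < x) (r : ℂ) :
    HasDerivAt (fun y : ℝ => (y : ℂ) ^ r) (r * (x : ℂ) ^ (r - 1)) x := by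
  have h := ((hasDerivAt_id (x : ℂ)).cpow_const (c := r) (Or.inl (by simpa using hx))).comp_ofReal
  simpa using h

lemma norm_cpow_sub_cpow_le {N x : ℝ} (hN : 0 < N) (hx : x ∈ Icc N (N + 1)) {s : ℂ}
    (hs : 0 < s.re) :
    ‖(x : ℂ) ^ (-s) - (N : ℂ) ^ (-s)‖ ≤ ‖s‖ * N ^ (-s.re - 1) := by
  have h := Convex.norm_image_sub_le_of_norm_hasDerivWithin_le (𝕜 := ℝ) (s := Icc N (N + 1))
    (f := fun y : ℝ => (y : ℂ) ^ (-s)) (f' := fun y : ℝ => -s * (y : ℂ) ^ (-s - 1))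
    (C := ‖s‖ * N ^ (-s.re - 1)) (x := N) (y := x)
    (fun y hy => (hasDerivAt_ofReal_cpow (hN.trans_le hy.1) _).hasDerivWithinAt)
    (fun y hy => by
      rw [norm_mul, norm_neg, Complex.norm_cpow_eq_rpow_re_of_pos (hN.trans_le hy.1)]
      refine mul_le_mul_of_nonneg_left ?_ (norm_nonneg _)
      simp only [Complex.sub_re, Complex.neg_re, Complex.one_re]
      exact Real.rpow_le_rpow_of_nonpos hN hy.1 (by linarith))
    (convex_Icc _ _) ⟨le_rfl, by linarith⟩ hx
  refine h.trans ?_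
  have h1 : ‖x - N‖ ≤ 1 := by
    rw [Real.norm_eq_abs, abs_le]; constructor <;> linarith [hx.1, hx.2]
  exact mul_le_of_le_one_right (by positivity) h1

/-- With N = n + 1 the term is (s - 1) times the integral of N^{-s} - x^{-s} over [N, N + 1]. The
difference gains one power of N, which makes the series converge to the left of Re s = 1. -/
lemma norm_zetaTerm_le (n : ℕ) {s : ℂ} (hs : 0 < s.re) :
    ‖zetaTerm n s‖ ≤ ‖s - 1‖ * ‖s‖ * (n + 1 : ℝ) ^ (-s.re - 1) := by
  set N : ℝ := n + 1 with hNdef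
  have hN : 0 < N := by positivity
  have h := Convex.norm_image_sub_le_of_norm_hasDerivWithin_le (𝕜 := ℝ) (s := Icc N (N + 1))
    (f := fun y : ℝ => (s - 1) * (N : ℂ) ^ (-s) * (y : ℂ) + (y : ℂ) ^ (1 - s))
    (f' := fun y : ℝ => (s - 1) * (N : ℂ) ^ (-s) + (1 - s) * (y : ℂ) ^ (1 - s - 1))
    (C := ‖s - 1‖ * ‖s‖ * N ^ (-s.re - 1)) (x := N) (y := N + 1)
    (fun y hy => by
      refine (HasDerivAt.add ?_ (hasDerivAt_ofReal_cpow (hN.trans_le hy.1) _)).hasDerivWithinAt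
      simpa using ((hasDerivAt_id y).ofReal_comp.const_mul ((s - 1) * (N : ℂ) ^ (-s))))
    (fun y hy => by
      have : (s - 1) * (N : ℂ) ^ (-s) + (1 - s) * (y : ℂ) ^ (1 - s - 1)
          = -((s - 1) * ((y : ℂ) ^ (-s) - (N : ℂ) ^ (-s))) := by
        rw [show (1 - s - 1) = -s by ring]; ring
      rw [this, norm_neg, norm_mul, mul_assoc]
      exact mul_le_mul_of_nonneg_left (norm_cpow_sub_cpow_le hN hy hs) (norm_nonneg _))
    (convex_Icc _ _) ⟨le_rfl, by linarith⟩ ⟨by linarith, le_rfl⟩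
  have h2 : zetaTerm n s = ((s - 1) * (N : ℂ) ^ (-s) * ((N + 1 : ℝ) : ℂ) +
      ((N + 1 : ℝ) : ℂ) ^ (1 - s)) - ((s - 1) * (N : ℂ) ^ (-s) * (N : ℂ) + (N : ℂ) ^ (1 - s)) := by
    rw [zetaTerm, show (n + 2 : ℝ) = N + 1 by rw [hNdef]; ring, ← hNdef]
    push_cast
    ring
  rw [h2]
  simpa using h

lemma differentiable_zetaTerm (n : ℕ) : Differentiable ℂ (zetaTerm n) := by
  intro s
  have h1 : ((n + 1 : ℝ) : ℂ) ≠ 0 := by exact_mod_cast (by positivity : (n + 1 : ℝ) ≠ 0)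
  have h2 : ((n + 2 : ℝ) : ℂ) ≠ 0 := by exact_mod_cast (by positivity : (n + 2 : ℝ) ≠ 0)
  unfold zetaTerm
  refine DifferentiableAt.sub (DifferentiableAt.add (DifferentiableAt.mul (by fun_prop)
    (DifferentiableAt.const_cpow (by fun_prop) (Or.inl h1)))
    (DifferentiableAt.const_cpow (by fun_prop) (Or.inl h2)))
    (DifferentiableAt.const_cpow (by fun_prop) (Or.inl h1))

lemma summable_rpow_shift {p : ℝ} (hp : 1 < p) : Summable fun n : ℕ => ((n : ℝ) + 1) ^ (-p) := by
  have := (summable_nat_add_iff 1).mpr (Real.summable_nat_rpow_inv.mpr hp)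
  refine this.congr fun n => ?_
  rw [Real.rpow_neg (by positivity)]
  push_cast
  rfl

lemma norm_zetaTerm_le' (n : ℕ) {s : ℂ} (hs : 1 / 4 ≤ s.re) :
    ‖zetaTerm n s‖ ≤ ‖s - 1‖ * ‖s‖ * (n + 1 : ℝ) ^ (-(5 / 4) : ℝ) := by
  refine (norm_zetaTerm_le n (by linarith)).trans ?_
  refine mul_le_mul_of_nonneg_left ?_ (by positivity)
  exact Real.rpow_le_rpow_of_exponent_le (by linarith [n.cast_nonneg (α := ℝ)]) (by linarith)

/-- The differences of the powers (n + 1)^{1-s} telescope to -1, because the boundary term tends to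
0 for Re s > 1; what remains is (s - 1) times the Dirichlet series. -/
lemma hasSum_zetaTerm {s : ℂ} (hs : 1 < s.re) :
    HasSum (fun n => zetaTerm n s) ((s - 1) * riemannZeta s - 1) := by
  have hs1 : Summable fun n : ℕ => 1 / ((n : ℂ) + 1) ^ s := by
    have := (summable_nat_add_iff 1).mpr (Complex.summable_one_div_nat_cpow.mpr hs)
    simpa using this
  have h1 : HasSum (fun n : ℕ => (s - 1) * ((n + 1 : ℝ) : ℂ) ^ (-s)) ((s - 1) * riemannZeta s) := by
    rw [zeta_eq_tsum_one_div_nat_add_one_cpow hs]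
    refine (hs1.hasSum.mul_left (s - 1)).congr_fun fun n => ?_
    rw [Complex.cpow_neg]; push_cast; simp
  have hlim : Tendsto (fun n : ℕ => ((n + 1 : ℝ) : ℂ) ^ (1 - s)) atTop (𝓝 0) := by
    rw [tendsto_zero_iff_norm_tendsto_zero]
    have : Tendsto (fun n : ℕ => ((n : ℝ) + 1) ^ (-(s.re - 1))) atTop (𝓝 0) :=
      (tendsto_rpow_neg_atTop (by linarith)).comp
        (tendsto_atTop_add_const_right _ 1 tendsto_natCast_atTop_atTop)
    refine this.congr fun n => ?_
    rw [Complex.norm_cpow_eq_rpow_re_of_pos (by positivity)]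
    simp
  have hsum : Summable fun n => zetaTerm n s := by
    refine Summable.of_norm_bounded ((summable_rpow_shift (p := 5 / 4) (by norm_num)).mul_left
      (‖s - 1‖ * ‖s‖)) fun n => norm_zetaTerm_le' n (by linarith)
  refine (hsum.hasSum_iff_tendsto_nat).mpr ?_
  have h3 := h1.tendsto_sum_nat.add (hlim.sub_const 1)
  rw [show (s - 1) * riemannZeta s + (0 - 1) = (s - 1) * riemannZeta s - 1 by ring] at h3
  refine h3.congr fun N => ?_
  have htel : ∀ M : ℕ, ∑ n ∈ Finset.range M, (((n + 2 : ℝ) : ℂ) ^ (1 - s) - ((n + 1 : ℝ) : ℂ) ^ (1 - s))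
      = ((M + 1 : ℝ) : ℂ) ^ (1 - s) - 1 := by
    intro M
    have := Finset.sum_range_sub (fun n : ℕ => ((n + 1 : ℝ) : ℂ) ^ (1 - s)) M
    simp only [Nat.cast_zero, zero_add, Complex.ofReal_one, Complex.one_cpow] at this
    rw [← this]
    refine Finset.sum_congr rfl fun n _ => ?_
    push_cast
    ring_nf
  rw [← htel N, ← Finset.sum_add_distrib]
  refine Finset.sum_congr rfl fun n _ => ?_
  rw [zetaTerm]; ring

lemma riemannZeta₁_eq_of_ne {s : ℂ} (hs : s ≠ 1) : riemannZeta₁ s = (s - 1) * riemannZeta s := by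
  rw [riemannZeta_eq_inv_sub_mul hs]
  have : s - 1 ≠ 0 := sub_ne_zero.mpr hs
  field_simp

/-- Identity theorem: both sides are analytic on a connected half-plane and agree near s = 2. -/
lemma riemannZeta₁_eq_tsum {s : ℂ} (hs : 1 / 4 < s.re) :
    riemannZeta₁ s = 1 + ∑' n, zetaTerm n s := by
  set U : Set ℂ := {s : ℂ | 1 / 4 < s.re} with hU
  have hUo : IsOpen U := isOpen_lt continuous_const Complex.continuous_re
  have hUc : IsPreconnected U := (convex_halfSpace_re_gt (1 / 4)).isPreconnected
  have hdiff : DifferentiableOn ℂ (fun s => 1 + ∑' n, zetaTerm n s) U := by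
    intro s0 hs0
    set V : Set ℂ := U ∩ Metric.ball 0 (‖s0‖ + 1)
    have hV : IsOpen V := hUo.inter Metric.isOpen_ball
    have hs0V : s0 ∈ V := ⟨hs0, by simp⟩
    have h := Complex.differentiableOn_tsum_of_summable_norm (F := zetaTerm)
      (u := fun n : ℕ => ((‖s0‖ + 2) * (‖s0‖ + 1)) * ((n : ℝ) + 1) ^ (-(5 / 4) : ℝ)) (U := V)
      ((summable_rpow_shift (p := 5 / 4) (by norm_num)).mul_left _)
      (fun n => (differentiable_zetaTerm n).differentiableOn) hV (fun n w hw => by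
        refine (norm_zetaTerm_le' n (le_of_lt hw.1)).trans ?_
        have h2 : ‖w‖ ≤ ‖s0‖ + 1 := by simpa using (Metric.mem_ball.mp hw.2).le
        have h3 : ‖w - 1‖ ≤ ‖s0‖ + 2 := (norm_sub_le _ _).trans (by simp; linarith)
        gcongr)
    exact ((h.differentiableAt (hV.mem_nhds hs0V)).const_add 1).differentiableWithinAt
  refine AnalyticOnNhd.eqOn_of_preconnected_of_eventuallyEq (𝕜 := ℂ)
    (differentiable_riemannZeta₁.differentiableOn.analyticOnNhd hUo)
    (hdiff.analyticOnNhd hUo) hUc (z₀ := 2) (by norm_num [hU]) ?_ hs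
  have hW : {s : ℂ | 1 < s.re} ∈ 𝓝 (2 : ℂ) :=
    (isOpen_lt continuous_const Complex.continuous_re).mem_nhds (by simp)
  filter_upwards [hW] with w hw
  have hw1 : w ≠ 1 := by rintro rfl; simp at hw
  rw [(hasSum_zetaTerm hw).tsum_eq, riemannZeta₁_eq_of_ne hw1]
  ring

lemma exists_norm_riemannZeta₁_le :
    ∃ C : ℝ, 1 ≤ C ∧ ∀ s : ℂ, 1 / 4 < s.re → ‖riemannZeta₁ s‖ ≤ C * (1 + ‖s‖) ^ 2 := by
  have hS := summable_rpow_shift (p := 5 / 4) (by norm_num)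
  set A : ℝ := ∑' n : ℕ, ((n : ℝ) + 1) ^ (-(5 / 4) : ℝ) with hA
  have hA0 : 0 ≤ A := tsum_nonneg fun n => by positivity
  refine ⟨1 + A, by linarith, fun s hs => ?_⟩
  rw [riemannZeta₁_eq_tsum hs]
  have h1 : ‖∑' n, zetaTerm n s‖ ≤ ‖s - 1‖ * ‖s‖ * A := by
    rw [hA, ← tsum_mul_left]
    exact tsum_of_norm_bounded (hS.mul_left _).hasSum fun n => norm_zetaTerm_le' n hs.le
  have h2 : ‖s - 1‖ ≤ 1 + ‖s‖ := (norm_sub_le _ _).trans (by simp [add_comm])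
  calc ‖1 + ∑' n, zetaTerm n s‖ ≤ 1 + ‖s - 1‖ * ‖s‖ * A := (norm_add_le _ _).trans (by simpa using h1)
    _ ≤ 1 * (1 + ‖s‖) ^ 2 + (1 + ‖s‖) * (1 + ‖s‖) * A := by
      gcongr
      · nlinarith [norm_nonneg s]
      · linarith
    _ = _ := by ring

lemma exists_norm_deriv_riemannZeta₁_le :
    ∃ C : ℝ, 1 ≤ C ∧ ∀ s : ℂ, 3 / 4 ≤ s.re → ‖deriv riemannZeta₁ s‖ ≤ C * (1 + ‖s‖) ^ 2 := by
  obtain ⟨C, hC, h⟩ := exists_norm_riemannZeta₁_le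
  refine ⟨16 * C, by linarith, fun s hs => ?_⟩
  have := Complex.norm_deriv_le_of_forall_mem_sphere_norm_le (c := s) (R := 1 / 4)
    (C := 4 * C * (1 + ‖s‖) ^ 2) (f := riemannZeta₁) (by norm_num)
    differentiable_riemannZeta₁.diffContOnCl (fun z hz => by
      have hz' : ‖z - s‖ = 1 / 4 := by simpa [dist_eq_norm] using hz
      have h1 : |(z - s).re| ≤ 1 / 4 := (Complex.abs_re_le_norm _).trans hz'.le
      have h2 : ‖z‖ ≤ ‖s‖ + 1 / 4 := by
        have := norm_add_le (z - s) s
        simp only [sub_add_cancel] at this; linarith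
      have h3 : 1 / 4 < z.re := by
        rw [Complex.sub_re, abs_le] at h1; linarith [h1.1]
      refine (h z h3).trans ?_
      have h4 : 1 + ‖z‖ ≤ 2 * (1 + ‖s‖) := by linarith [norm_nonneg s]
      calc C * (1 + ‖z‖) ^ 2 ≤ C * (2 * (1 + ‖s‖)) ^ 2 := by gcongr
        _ = _ := by ring)
  refine this.trans (le_of_eq ?_)
  ring

/-- The 3-4-1 inequality of Hadamard and de la Vallée Poussin, taken from the trivial character of
modulus 1, whose L-function is ζ. -/
lemma one_le_norm_riemannZeta_product {x : ℝ} (hx : 0 < x) (y : ℝ) :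
    1 ≤ ‖riemannZeta (1 + x)‖ ^ 3 * ‖riemannZeta (1 + x + Complex.I * y)‖ ^ 4 *
      ‖riemannZeta (1 + x + 2 * Complex.I * y)‖ := by
  have h := DirichletCharacter.norm_LFunction_product_ge_one (1 : DirichletCharacter ℂ 1) hx y
  simpa [DirichletCharacter.LFunctionTrivChar, DirichletCharacter.LFunction_modOne_eq] using h

end LatticeLLT

/-! ### Polynomial lower bounds for ζ on the line Re s = 1 and decay of Γ in vertical strips. -/

namespace LatticeLLT

lemma riemannZeta₁_ne_zero {s : ℂ} (hs : 1 ≤ s.re) : riemannZeta₁ s ≠ 0 := by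
  rcases eq_or_ne s 1 with rfl | h
  · simp
  · rw [riemannZeta₁_eq_of_ne h]
    exact mul_ne_zero (sub_ne_zero.mpr h) (riemannZeta_ne_zero_of_one_le_re hs)

lemma norm_le_of_abs_le {z : ℂ} {a b : ℝ} (h1 : |z.re| ≤ a) (h2 : |z.im| ≤ b) : ‖z‖ ≤ a + b :=
  (Complex.norm_le_abs_re_add_abs_im z).trans (by linarith)

lemma norm_riemannZeta_le_of_one_le {s : ℂ} (hs : 1 ≤ ‖s - 1‖) :
    ‖riemannZeta s‖ ≤ ‖riemannZeta₁ s‖ := by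
  have h1 : s ≠ 1 := by rintro rfl; norm_num at hs
  rw [riemannZeta₁_eq_of_ne h1, norm_mul]
  exact le_mul_of_one_le_left (norm_nonneg _) hs

/-- For bounded imaginary part this is compactness and nonvanishing. For large imaginary part the
3-4-1 inequality bounds ζ₁ from below at a point shifted to the right by η, and the derivative bound
transports this back to s. -/
lemma exists_le_norm_riemannZeta₁ :
    ∃ c : ℝ, 0 < c ∧ ∀ s : ℂ, 1 ≤ s.re → s.re ≤ 2 →
      c ≤ ‖riemannZeta₁ s‖ * (1 + |s.im|) ^ 8 := by
  obtain ⟨C, hC, hζ⟩ := exists_norm_riemannZeta₁_le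
  obtain ⟨D, hD, hζ'⟩ := exists_norm_deriv_riemannZeta₁_le
  -- the compact part
  set K : Set ℂ := Icc (1 : ℝ) 2 ×ℂ Icc (-1 : ℝ) 1
  have hK : IsCompact K := isCompact_Icc.reProdIm isCompact_Icc
  have hKne : K.Nonempty := ⟨1, by simp [K, Complex.mem_reProdIm]⟩
  obtain ⟨z0, hz0, hmin⟩ := hK.exists_isMinOn hKne
    (differentiable_riemannZeta₁.continuous.norm.continuousOn)
  have hz0re : 1 ≤ z0.re := (Complex.mem_reProdIm.mp hz0).1.1
  have hm : 0 < ‖riemannZeta₁ z0‖ := norm_pos_iff.mpr (riemannZeta₁_ne_zero hz0re)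
  -- The 3-4-1 inequality yields a lower bound ε³ / (16 C T⁸) at the shifted point; this ε makes the
  -- cost of shifting back exactly half of it.
  set ε : ℝ := 1 / (512 * C * D) with hε
  have hε0 : 0 < ε := by positivity
  have hε1 : ε ≤ 1 := by
    rw [hε, div_le_one (by positivity)]; nlinarith
  refine ⟨min ‖riemannZeta₁ z0‖ (ε ^ 3 / (32 * C)), by positivity, fun s h1 h2 => ?_⟩
  have hT1 : 1 ≤ 1 + |s.im| := by linarith [abs_nonneg s.im]
  set T : ℝ := 1 + |s.im| with hT
  have hT8 : 1 ≤ T ^ 8 := one_le_pow₀ hT1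
  rcases le_total |s.im| 1 with him | him
  · have hs : s ∈ K := Complex.mem_reProdIm.mpr ⟨⟨h1, h2⟩, abs_le.mp him⟩
    have := hmin hs
    exact (min_le_left _ _).trans ((show _ ≤ _ from this).trans
      (le_mul_of_one_le_right (norm_nonneg _) hT8))
  refine (min_le_right _ _).trans ?_
  -- The exponent 10 balances the two effects: η^{3/4} T^{-1/2} from the 3-4-1 inequality and T² η
  -- from the derivative are then both of the order T⁻⁸.
  set η : ℝ := ε ^ 4 / T ^ 10 with hη
  have hη0 : 0 < η := by positivity
  have hη1 : η ≤ 1 := by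
    rw [hη, div_le_one (by positivity)]
    exact (pow_le_one₀ hε0.le hε1).trans (one_le_pow₀ hT1)
  set s' : ℂ := s + η with hs'
  set x : ℝ := s.re + η - 1 with hx
  have hxη : η ≤ x := by linarith
  have hx0 : 0 < x := by linarith
  have hx2 : x ≤ 2 := by linarith
  have hprod := one_le_norm_riemannZeta_product hx0 s.im
  have hs'eq : (1 : ℂ) + x + Complex.I * s.im = s' := by
    apply Complex.ext <;> simp [hs', hx]
  rw [hs'eq] at hprod
  -- the three factors
  have hA : ‖riemannZeta (1 + x)‖ ≤ 16 * C / η := by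
    have hne : (1 + x : ℂ) ≠ 1 := by simpa using hx0.ne'
    have h := riemannZeta₁_eq_of_ne hne
    have h4 := hζ (1 + x) (by simp; linarith)
    have h5 : ‖(1 + x : ℂ)‖ ≤ 3 := (norm_add_le _ _).trans (by
      simp [abs_of_pos hx0]; linarith)
    rw [h, norm_mul] at h4
    simp only [add_sub_cancel_left, Complex.norm_real, Real.norm_eq_abs, abs_of_pos hx0] at h4
    rw [le_div_iff₀ hη0]
    calc ‖riemannZeta (1 + x)‖ * η ≤ ‖riemannZeta (1 + x)‖ * x := by gcongr
      _ ≤ C * (1 + ‖(1 + x : ℂ)‖) ^ 2 := by linarith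
      _ ≤ C * (1 + 3) ^ 2 := by gcongr
      _ = _ := by ring
  have hB : ‖riemannZeta s'‖ ≤ ‖riemannZeta₁ s'‖ := by
    refine norm_riemannZeta_le_of_one_le (him.trans ?_)
    have := Complex.abs_im_le_norm (s' - 1)
    simpa [hs'] using this
  have hE : ‖riemannZeta (1 + x + 2 * Complex.I * s.im)‖ ≤ 16 * C * T ^ 2 := by
    refine (norm_riemannZeta_le_of_one_le ?_).trans ((hζ _ (by simp; linarith)).trans ?_)
    · have := Complex.abs_im_le_norm (1 + x + 2 * Complex.I * s.im - 1 : ℂ)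
      refine le_trans ?_ this
      simp [abs_mul]; linarith
    · have h5 : ‖(1 + x + 2 * Complex.I * s.im : ℂ)‖ ≤ 3 + 2 * |s.im| := by
        refine norm_le_of_abs_le ?_ ?_
        · simp; rw [abs_of_pos (by linarith)]; linarith
        · simp [abs_mul]
      calc C * (1 + ‖(1 + x + 2 * Complex.I * s.im : ℂ)‖) ^ 2 ≤ C * (4 * T) ^ 2 := by
            gcongr
            rw [hT]; linarith [abs_nonneg s.im]
        _ = _ := by ring
  set m : ℝ := ‖riemannZeta₁ s'‖ with hmdef
  have hm0 : 0 ≤ m := norm_nonneg _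
  have h6 : 1 ≤ (16 * C / η) ^ 3 * m ^ 4 * (16 * C * T ^ 2) :=
    hprod.trans (by gcongr)
  have h7 : (ε ^ 3 / (16 * C * T ^ 8)) ^ 4 ≤ m ^ 4 := by
    have e1 : (16 * C / η) ^ 3 * m ^ 4 * (16 * C * T ^ 2)
        = m ^ 4 * ((16 * C) ^ 4 * T ^ 32 / ε ^ 12) := by
      rw [hη]; field_simp
    rw [e1] at h6
    have e2 : (ε ^ 3 / (16 * C * T ^ 8)) ^ 4 = 1 / ((16 * C) ^ 4 * T ^ 32 / ε ^ 12) := by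
      field_simp
    rw [e2, div_le_iff₀ (by positivity)]
    exact h6
  have h8 : ε ^ 3 / (16 * C * T ^ 8) ≤ m := le_of_pow_le_pow_left₀ (by norm_num) hm0 h7
  have h9 : ‖riemannZeta₁ s' - riemannZeta₁ s‖ ≤ D * (4 * T) ^ 2 * η := by
    have h := Convex.norm_image_sub_le_of_norm_deriv_le (𝕜 := ℂ) (f := riemannZeta₁)
      (s := segment ℝ s s') (x := s) (y := s') (C := D * (4 * T) ^ 2)
      (fun z _ => differentiable_riemannZeta₁ z) (fun z hz => by
        obtain ⟨a, b, ha, hb, hab, rfl⟩ := hz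
        have hz' : a • s + b • s' = s + ((b * η : ℝ) : ℂ) := by
          have : (a : ℂ) = 1 - b := by exact_mod_cast (by linarith : a = 1 - b)
          simp only [Complex.real_smul, hs', this]; push_cast; ring
        rw [hz']
        have hbη : b * η ≤ 1 := mul_le_one₀ (by linarith) hη0.le hη1
        have hbη0 : 0 ≤ b * η := by positivity
        refine (hζ' _ (by simp; linarith)).trans ?_
        have : ‖s + ((b * η : ℝ) : ℂ)‖ ≤ 3 + |s.im| := by
          refine norm_le_of_abs_le ?_ ?_
          · rw [Complex.add_re, Complex.ofReal_re, abs_of_nonneg (by linarith)]; linarith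
          · simp
        gcongr
        rw [hT]; linarith [abs_nonneg s.im]) (convex_segment _ _)
        (left_mem_segment _ _ _) (right_mem_segment _ _ _)
    refine h.trans (le_of_eq ?_)
    simp [hs', abs_of_pos hη0]
  have h10 : D * (4 * T) ^ 2 * η ≤ ε ^ 3 / (32 * C * T ^ 8) := by
    have : D * (4 * T) ^ 2 * η = (16 * D * ε) * (ε ^ 3 / T ^ 8) := by
      rw [hη]; field_simp; ring
    rw [this]
    have e : 16 * D * ε = 1 / (32 * C) := by rw [hε]; field_simp; norm_num
    rw [e]
    apply le_of_eq; field_simp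
  have h11 : m ≤ ‖riemannZeta₁ s‖ + D * (4 * T) ^ 2 * η := by
    have := norm_sub_norm_le (riemannZeta₁ s') (riemannZeta₁ s)
    linarith
  have h12 : ε ^ 3 / (16 * C * T ^ 8) = 2 * (ε ^ 3 / (32 * C * T ^ 8)) := by field_simp; norm_num
  have h13 : ε ^ 3 / (32 * C * T ^ 8) ≤ ‖riemannZeta₁ s‖ := by linarith
  calc ε ^ 3 / (32 * C) = ε ^ 3 / (32 * C * T ^ 8) * T ^ 8 := by field_simp
    _ ≤ _ := by gcongr

lemma norm_Gamma_le_Gamma_re {z : ℂ} (hz : 0 < z.re) : ‖Complex.Gamma z‖ ≤ Real.Gamma z.re := by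
  rw [Complex.Gamma_eq_integral hz, Real.Gamma_eq_integral hz, Complex.GammaIntegral]
  refine (norm_integral_le_integral_norm _).trans (le_of_eq ?_)
  refine setIntegral_congr_fun measurableSet_Ioi fun x hx => ?_
  simp only [norm_mul, Complex.norm_real, Real.norm_eq_abs, abs_of_pos (Real.exp_pos _)]
  rw [Complex.norm_cpow_eq_rpow_re_of_pos hx]
  simp

/-- Each use of Γ(z + 1) = z Γ(z) gains one power of 1 + |Im z| at the price of moving the strip to
the right by one; therefore b is quantified inside the induction. -/
lemma exists_norm_Gamma_le (N : ℕ) : ∀ b : ℝ, 1 ≤ b → ∃ G : ℝ, 0 < G ∧ ∀ z : ℂ, 1 ≤ z.re → z.re ≤ b →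
    ‖Complex.Gamma z‖ * (1 + |z.im|) ^ N ≤ G := by
  induction N with
  | zero =>
    intro b hb
    obtain ⟨G, hG⟩ := isCompact_Icc.exists_bound_of_continuousOn (s := Icc (1 : ℝ) b)
      (f := Real.Gamma) (fun x hx => (Real.differentiableAt_Gamma (fun m => by
        have : (0 : ℝ) ≤ m := m.cast_nonneg
        linarith [hx.1])).continuousAt.continuousWithinAt)
    refine ⟨max G 1, by positivity, fun z h1 h2 => ?_⟩
    simp only [pow_zero, mul_one]
    exact (norm_Gamma_le_Gamma_re (by linarith)).trans
      (((le_abs_self _).trans (hG z.re ⟨h1, h2⟩)).trans (le_max_left _ _))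
  | succ N ih =>
    intro b hb
    obtain ⟨G, hG0, hG⟩ := ih (b + 1) (by linarith)
    refine ⟨2 * G, by positivity, fun z h1 h2 => ?_⟩
    have hz0 : z ≠ 0 := by rintro rfl; norm_num at h1
    have h3 := hG (z + 1) (by simp; linarith) (by simpa using h2)
    rw [Complex.Gamma_add_one z hz0, norm_mul] at h3
    simp only [Complex.add_im, Complex.one_im, add_zero] at h3
    have h4 : 1 + |z.im| ≤ 2 * ‖z‖ := by
      have := Complex.abs_im_le_norm z
      have := (le_abs_self _).trans (Complex.abs_re_le_norm z)
      linarith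
    calc ‖Complex.Gamma z‖ * (1 + |z.im|) ^ (N + 1)
        = ‖Complex.Gamma z‖ * (1 + |z.im|) ^ N * (1 + |z.im|) := by ring
      _ ≤ ‖Complex.Gamma z‖ * (1 + |z.im|) ^ N * (2 * ‖z‖) := by gcongr
      _ = 2 * (‖z‖ * ‖Complex.Gamma z‖ * (1 + |z.im|) ^ N) := by ring
      _ ≤ 2 * G := by gcongr

end LatticeLLT

namespace LatticeLLT

/-! ### The Mellin symbol `Γ(w + j) ζ(w) / ζ(w - 1)` on the strip `2 ≤ Re w ≤ 3` -/

/-- `Γ(w + j) ζ(w) / ζ(w - 1)`, written so as to be regular at `w = 2`. -/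
noncomputable def mellinSymbol (j : ℕ) (w : ℂ) : ℂ :=
  Complex.Gamma (w + j) * riemannZeta₁ w * (w - 2) / ((w - 1) * riemannZeta₁ (w - 1))

lemma mellinSymbol_eq (j : ℕ) {w : ℂ} (hw : 2 < w.re) :
    mellinSymbol j w = Complex.Gamma (w + j) * (riemannZeta w / riemannZeta (w - 1)) := by
  have h1 : w ≠ 1 := by rintro rfl; norm_num at hw
  have h2 : w - 1 ≠ 1 := by
    intro h
    have := congrArg Complex.re h
    simp at this; linarith
  have h3 : riemannZeta (w - 1) ≠ 0 := riemannZeta_ne_zero_of_one_le_re (by simp; linarith)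
  have h4 : w - 1 ≠ 0 := sub_ne_zero.mpr h1
  have h5 : w - 2 ≠ 0 := fun h => h2 (by linear_combination h)
  rw [mellinSymbol, riemannZeta₁_eq_of_ne h1, riemannZeta₁_eq_of_ne h2,
    show w - 1 - 1 = w - 2 by ring]
  field_simp

lemma differentiableAt_mellinSymbol (j : ℕ) {w : ℂ} (h1 : 1 < w.re)
    (h2 : riemannZeta₁ (w - 1) ≠ 0) : DifferentiableAt ℂ (mellinSymbol j) w := by
  have h3 : w - 1 ≠ 0 := by
    intro h
    have := congrArg Complex.re h
    simp at this; linarith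
  have hΓ : DifferentiableAt ℂ (fun w : ℂ => Complex.Gamma (w + j)) w := by
    refine DifferentiableAt.comp w (Complex.differentiableAt_Gamma _ fun m h => ?_) (by fun_prop)
    have := congrArg Complex.re h
    simp at this
    have hj : (0 : ℝ) ≤ j := j.cast_nonneg
    have hm : (0 : ℝ) ≤ m := m.cast_nonneg
    linarith
  have hz : DifferentiableAt ℂ (fun w : ℂ => riemannZeta₁ (w - 1)) w :=
    (differentiable_riemannZeta₁ _).comp w (by fun_prop)
  unfold mellinSymbol
  exact ((hΓ.mul (differentiable_riemannZeta₁ w)).mul (by fun_prop)).div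
    (DifferentiableAt.mul (by fun_prop) hz) (mul_ne_zero h3 h2)

/-- A lower bound for `ζ₁` slightly to the left of `Re s = 1`. -/
lemma exists_le_norm_riemannZeta₁_ball :
    ∃ c r : ℝ, 0 < c ∧ 0 < r ∧ r ≤ 1 / 4 ∧ ∀ s z : ℂ, 1 ≤ s.re → s.re ≤ 2 →
      ‖z - s‖ ≤ r / (1 + |s.im|) ^ 10 → c ≤ ‖riemannZeta₁ z‖ * (1 + |s.im|) ^ 8 := by
  obtain ⟨c, hc, hlow⟩ := exists_le_norm_riemannZeta₁
  obtain ⟨D, hD, hζ'⟩ := exists_norm_deriv_riemannZeta₁_le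
  refine ⟨c / 2, min (1 / 4) (c / (32 * D)), by positivity, by positivity, min_le_left _ _,
    fun s z h1 h2 hz => ?_⟩
  have hT1 : 1 ≤ 1 + |s.im| := by linarith [abs_nonneg s.im]
  set T : ℝ := 1 + |s.im| with hT
  have hr1 : ‖z - s‖ ≤ 1 / 4 := hz.trans ((div_le_self (by positivity) (one_le_pow₀ hT1)).trans
    (min_le_left _ _))
  have hr2 : ‖z - s‖ ≤ c / (32 * D) / T ^ 10 := hz.trans (by gcongr; exact min_le_right _ _)
  have h9 : ‖riemannZeta₁ z - riemannZeta₁ s‖ ≤ D * (4 * T) ^ 2 * ‖z - s‖ := by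
    refine Convex.norm_image_sub_le_of_norm_deriv_le (𝕜 := ℂ) (f := riemannZeta₁)
      (s := Metric.closedBall s (1 / 4)) (x := s) (y := z) (C := D * (4 * T) ^ 2)
      (fun z _ => differentiable_riemannZeta₁ z) (fun y hy => ?_) (convex_closedBall _ _)
      (by simp) (by simpa [dist_eq_norm] using hr1)
    have hy' : ‖y - s‖ ≤ 1 / 4 := by simpa [dist_eq_norm] using hy
    have hre : |(y - s).re| ≤ 1 / 4 := (Complex.abs_re_le_norm _).trans hy'
    rw [Complex.sub_re, abs_le] at hre
    refine (hζ' y (by linarith)).trans ?_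
    have h4 : ‖y‖ ≤ ‖s‖ + 1 / 4 := by
      have := norm_add_le (y - s) s
      simp only [sub_add_cancel] at this; linarith
    have h5 : ‖s‖ ≤ 2 + |s.im| := norm_le_of_abs_le (by rw [abs_of_nonneg] <;> linarith) le_rfl
    gcongr
    rw [hT]; linarith [abs_nonneg s.im]
  have h10 : D * (4 * T) ^ 2 * ‖z - s‖ ≤ c / 2 / T ^ 8 := by
    calc D * (4 * T) ^ 2 * ‖z - s‖ ≤ D * (4 * T) ^ 2 * (c / (32 * D) / T ^ 10) := by gcongr
      _ = c / 2 / T ^ 8 := by field_simp; norm_num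
  have h11 : c / T ^ 8 ≤ ‖riemannZeta₁ s‖ := by
    rw [div_le_iff₀ (by positivity)]; exact hlow s h1 h2
  have h12 : ‖riemannZeta₁ s‖ ≤ ‖riemannZeta₁ z‖ + ‖riemannZeta₁ z - riemannZeta₁ s‖ := by
    have := norm_sub_norm_le (riemannZeta₁ s) (riemannZeta₁ z)
    rw [norm_sub_rev] at this
    linarith
  have h13 : c / T ^ 8 = 2 * (c / 2 / T ^ 8) := by ring
  have h14 : c / 2 / T ^ 8 ≤ ‖riemannZeta₁ z‖ := by linarith
  rwa [div_le_iff₀ (by positivity)] at h14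

/-- Cauchy's estimates on discs of radius R of the order (1 + |Im w|)^{-10}, on which ζ₁(w - 1)
stays away from zero. The bound holds up to the line Re w = 2, that is, up to the edge Re s = 1 for
the zeta function in the denominator. -/
lemma exists_norm_iteratedDeriv_mellinSymbol_le (j : ℕ) (hj : j ≤ 1) :
    ∃ C : ℝ, 0 < C ∧ ∀ w : ℂ, 2 ≤ w.re → w.re ≤ 3 →
      DifferentiableAt ℂ (mellinSymbol j) w ∧ ∀ i ≤ 2,
      ‖iteratedDeriv i (mellinSymbol j) w‖ ≤ C / (1 + |w.im|) ^ 2 := by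
  obtain ⟨c, r, hc, hr, hr4, hlow⟩ := exists_le_norm_riemannZeta₁_ball
  obtain ⟨D, hD, hζ⟩ := exists_norm_riemannZeta₁_le
  -- Powers of T: the factors ζ₁(z), z - 2 and 1/ζ₁(z - 1) cost 2, 1 and 8, and two derivatives on a
  -- disc of radius r / T¹⁰ cost 20. The exponent 33 leaves T⁻² in the end.
  obtain ⟨G, hG0, hG⟩ := exists_norm_Gamma_le 33 5 (by norm_num)
  have hj' : (j : ℝ) ≤ 1 := by exact_mod_cast hj
  have hj0 : (0 : ℝ) ≤ j := j.cast_nonneg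
  set B : ℝ := G * 2 ^ 33 * (D * 6 ^ 2) * 5 * 2 / c with hB
  have hB0 : 0 < B := by positivity
  refine ⟨2 * B / r ^ 2, by positivity, fun w h1 h2 => ?_⟩
  have hT1 : 1 ≤ 1 + |w.im| := by linarith [abs_nonneg w.im]
  set T : ℝ := 1 + |w.im| with hT
  set R : ℝ := r / T ^ 10 with hR
  have hR0 : 0 < R := by positivity
  have hR4 : R ≤ 1 / 4 := (div_le_self hr.le (one_le_pow₀ hT1)).trans hr4
  have hlow' : ∀ z : ℂ, ‖z - w‖ ≤ R → c ≤ ‖riemannZeta₁ (z - 1)‖ * T ^ 8 := fun z hz => by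
    have := hlow (w - 1) (z - 1) (by simp; linarith) (by simp; linarith)
    simp only [sub_sub_sub_cancel_right, Complex.sub_im, Complex.one_im, sub_zero] at this
    exact this hz
  have hne : ∀ z : ℂ, ‖z - w‖ ≤ R → riemannZeta₁ (z - 1) ≠ 0 := fun z hz h => by
    have := hlow' z hz
    rw [h, norm_zero, zero_mul] at this
    linarith
  have hre : ∀ z : ℂ, ‖z - w‖ ≤ R → w.re - 1 / 4 ≤ z.re ∧ z.re ≤ w.re + 1 / 4 := fun z hz => by
    have := (Complex.abs_re_le_norm (z - w)).trans (hz.trans hR4)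
    rw [Complex.sub_re, abs_le] at this
    constructor <;> linarith [this.1, this.2]
  have him : ∀ z : ℂ, ‖z - w‖ ≤ R → |z.im| ≤ |w.im| + 1 / 4 ∧ |w.im| ≤ |z.im| + 1 / 4 :=
    fun z hz => by
    have h3 := (Complex.abs_im_le_norm (z - w)).trans (hz.trans hR4)
    rw [Complex.sub_im] at h3
    have h4 := abs_sub_abs_le_abs_sub z.im w.im
    have h5 := abs_sub_abs_le_abs_sub w.im z.im
    rw [abs_sub_comm w.im] at h5
    constructor <;> linarith
  have hdiff : ∀ z : ℂ, ‖z - w‖ ≤ R → DifferentiableAt ℂ (mellinSymbol j) z := fun z hz =>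
    differentiableAt_mellinSymbol j (by linarith [(hre z hz).1]) (hne z hz)
  have hbound : ∀ z : ℂ, ‖z - w‖ ≤ R → ‖mellinSymbol j z‖ ≤ B / T ^ 22 := fun z hz => by
    obtain ⟨a1, a2⟩ := hre z hz
    obtain ⟨b1, b2⟩ := him z hz
    have e1 : ‖Complex.Gamma (z + j)‖ ≤ G * 2 ^ 33 / T ^ 33 := by
      have := hG (z + j) (by simp; linarith) (by simp; linarith)
      simp only [Complex.add_im, Complex.natCast_im, add_zero] at this
      rw [le_div_iff₀ (by positivity)]
      calc ‖Complex.Gamma (z + j)‖ * T ^ 33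
          ≤ ‖Complex.Gamma (z + j)‖ * (2 * (1 + |z.im|)) ^ 33 := by
            gcongr
            rw [hT]; linarith [abs_nonneg z.im]
        _ = (‖Complex.Gamma (z + j)‖ * (1 + |z.im|) ^ 33) * 2 ^ 33 := by rw [mul_pow]; ring
        _ ≤ _ := by gcongr
    have e2 : ‖riemannZeta₁ z‖ ≤ D * 6 ^ 2 * T ^ 2 := by
      refine (hζ z (by linarith)).trans ?_
      have : ‖z‖ ≤ 13 / 4 + (|w.im| + 1 / 4) :=
        norm_le_of_abs_le (by rw [abs_of_nonneg] <;> linarith) b1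
      calc D * (1 + ‖z‖) ^ 2 ≤ D * (6 * T) ^ 2 := by
            gcongr
            rw [hT]; linarith [abs_nonneg w.im]
        _ = _ := by ring
    have e3 : ‖z - 2‖ ≤ 5 * T := by
      refine (norm_le_of_abs_le (a := 5 / 4) (b := |w.im| + 1 / 4) ?_ (by simpa using b1)).trans ?_
      · simp only [Complex.sub_re, Complex.re_ofNat]; rw [abs_le]; constructor <;> linarith
      · rw [hT]; linarith [abs_nonneg w.im]
    have e4 : 1 / 2 ≤ ‖z - 1‖ := by
      refine le_trans ?_ ((le_abs_self _).trans (Complex.abs_re_le_norm _))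
      simp; linarith
    have e5 : c / T ^ 8 ≤ ‖riemannZeta₁ (z - 1)‖ := by
      rw [div_le_iff₀ (by positivity)]; exact hlow' z hz
    rw [mellinSymbol, norm_div, norm_mul, norm_mul, norm_mul]
    calc ‖Complex.Gamma (z + j)‖ * ‖riemannZeta₁ z‖ * ‖z - 2‖ / (‖z - 1‖ * ‖riemannZeta₁ (z - 1)‖)
        ≤ (G * 2 ^ 33 / T ^ 33) * (D * 6 ^ 2 * T ^ 2) * (5 * T) / (1 / 2 * (c / T ^ 8)) := by
          gcongr
      _ = B / T ^ 22 := by rw [hB]; field_simp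
  refine ⟨hdiff w (by simpa using hR0.le), fun i hi => ?_⟩
  have hcl : DiffContOnCl ℂ (mellinSymbol j) (Metric.ball w R) := by
    refine DifferentiableOn.diffContOnCl_ball (U := Metric.closedBall w R) (fun z hz => ?_) le_rfl
    exact (hdiff z (by simpa [dist_eq_norm] using hz)).differentiableWithinAt
  have h := Complex.norm_iteratedDeriv_le_of_forall_mem_sphere_norm_le i hR0 hcl
    (C := B / T ^ 22) (fun z hz => hbound z (by
      have : ‖z - w‖ = R := by simpa [dist_eq_norm] using hz
      exact this.le))
  refine h.trans ?_
  have hfac : (i.factorial : ℝ) ≤ 2 := by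
    interval_cases i <;> norm_num [Nat.factorial]
  have hR1 : R ≤ 1 := by linarith
  have hRi : R ^ 2 ≤ R ^ i := pow_le_pow_of_le_one hR0.le hR1 hi
  calc (i.factorial : ℝ) * (B / T ^ 22) / R ^ i ≤ 2 * (B / T ^ 22) / R ^ 2 := by gcongr
    _ = 2 * B / r ^ 2 / T ^ 2 := by rw [hR]; field_simp

end LatticeLLT

namespace LatticeLLT

/-! ### The Möbius kernel `∑ μ(m) m (k m)^j exp(-k m x)` and its decay -/

/-- The frequency `k m` with `k = p.1 + 1`, `m = p.2 + 1`. -/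
noncomputable def mfreq (p : ℕ × ℕ) : ℝ := ((p.1 : ℝ) + 1) * ((p.2 : ℝ) + 1)

/-- The coefficient `μ(m) m (k m)^j` with `k = p.1 + 1`, `m = p.2 + 1`. -/
noncomputable def mcoef (j : ℕ) (p : ℕ × ℕ) : ℝ :=
  (ArithmeticFunction.moebius (p.2 + 1) : ℝ) * ((p.2 : ℝ) + 1) * mfreq p ^ j

/-- The kernel `∑_{k, m ≥ 1} μ(m) m (k m)^j exp(-k m x)`. -/
noncomputable def moebiusKernel (j : ℕ) (x : ℝ) : ℝ :=
  ∑' p : ℕ × ℕ, mcoef j p * Real.exp (-mfreq p * x)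

lemma mfreq_pos (p : ℕ × ℕ) : 0 < mfreq p := by unfold mfreq; positivity

lemma abs_moebius_cast_le_one (n : ℕ) : |(ArithmeticFunction.moebius n : ℝ)| ≤ 1 := by
  exact_mod_cast ArithmeticFunction.abs_moebius_le_one (n := n)

lemma abs_mcoef_le (j : ℕ) (p : ℕ × ℕ) : |mcoef j p| ≤ ((p.2 : ℝ) + 1) * mfreq p ^ j := by
  have h := mfreq_pos p
  rw [mcoef, abs_mul, abs_mul, abs_of_pos (by positivity : (0 : ℝ) < (p.2 : ℝ) + 1),
    abs_of_pos (by positivity : 0 < mfreq p ^ j), mul_assoc]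
  exact mul_le_of_le_one_left (by positivity) (abs_moebius_cast_le_one _)

lemma exp_neg_le_rpow {γ y : ℝ} (hγ : 0 < γ) (hy : 0 < y) :
    Real.exp (-y) ≤ γ ^ γ * y ^ (-γ) := by
  have h1 : y / γ ≤ Real.exp (y / γ) := by linarith [Real.add_one_le_exp (y / γ)]
  have h2 : (y / γ) ^ γ ≤ Real.exp y := by
    calc (y / γ) ^ γ ≤ Real.exp (y / γ) ^ γ := by gcongr
      _ = Real.exp y := by rw [← Real.exp_mul]; congr 1; field_simp
  rw [Real.exp_neg, Real.rpow_neg hy.le, ← div_eq_mul_inv, inv_le_comm₀ (by positivity)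
    (by positivity), inv_div, ← Real.div_rpow hy.le hγ.le]
  exact h2

/-- The majorant of the terms of `moebiusKernel`. -/
lemma abs_mcoef_mul_exp_le (j : ℕ) {β x : ℝ} (hβ : 2 < β) (hx : 0 < x) (p : ℕ × ℕ) :
    |mcoef j p * Real.exp (-mfreq p * x)| ≤ (β + j) ^ (β + j) * x ^ (-(β + j)) *
      (((p.1 : ℝ) + 1) ^ (-β) * ((p.2 : ℝ) + 1) ^ (-(β - 1))) := by
  have hf := mfreq_pos p
  have hγ : 0 < β + j := by positivity
  rw [abs_mul, abs_of_pos (Real.exp_pos _), neg_mul]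
  have h1 := exp_neg_le_rpow hγ (mul_pos hf hx)
  calc |mcoef j p| * Real.exp (-(mfreq p * x))
      ≤ (((p.2 : ℝ) + 1) * mfreq p ^ j) * ((β + j) ^ (β + j) * (mfreq p * x) ^ (-(β + j))) := by
        gcongr
        exact abs_mcoef_le j p
    _ = (β + j) ^ (β + j) * x ^ (-(β + j)) *
          (((p.2 : ℝ) + 1) * (mfreq p ^ (j : ℝ) * mfreq p ^ (-(β + j)))) := by
        rw [Real.mul_rpow hf.le hx.le, Real.rpow_natCast]; ring
    _ = _ := by
        rw [← Real.rpow_add hf, show (j : ℝ) + -(β + j) = -β by ring, mfreq,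
          Real.mul_rpow (by positivity) (by positivity)]
        have : ((p.2 : ℝ) + 1) ^ (-(β - 1)) = ((p.2 : ℝ) + 1) * ((p.2 : ℝ) + 1) ^ (-β) := by
          rw [show -(β - 1) = 1 + -β by ring, Real.rpow_add (by positivity), Real.rpow_one]
        rw [this]; ring

lemma summable_mfreq_majorant {β : ℝ} (hβ : 2 < β) :
    Summable fun p : ℕ × ℕ => ((p.1 : ℝ) + 1) ^ (-β) * ((p.2 : ℝ) + 1) ^ (-(β - 1)) :=
  (summable_rpow_shift (p := β) (by linarith)).mul_of_nonneg
    (summable_rpow_shift (p := β - 1) (by linarith)) (fun _ => by positivity)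
    (fun _ => by positivity)

lemma summable_moebiusKernel (j : ℕ) {x : ℝ} (hx : 0 < x) :
    Summable fun p : ℕ × ℕ => mcoef j p * Real.exp (-mfreq p * x) :=
  Summable.of_norm_bounded ((summable_mfreq_majorant (β := 3) (by norm_num)).mul_left _)
    fun p => abs_mcoef_mul_exp_le j (β := 3) (by norm_num) hx p

/-- A crude bound with a free exponent: values of β close to 2 serve near the origin, larger ones at
infinity. -/
lemma exists_abs_moebiusKernel_le (j : ℕ) {β : ℝ} (hβ : 2 < β) :
    ∃ C : ℝ, 0 < C ∧ ∀ x : ℝ, 0 < x → |moebiusKernel j x| ≤ C * x ^ (-(β + j)) := by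
  set S := ∑' p : ℕ × ℕ, ((p.1 : ℝ) + 1) ^ (-β) * ((p.2 : ℝ) + 1) ^ (-(β - 1)) with hS
  have hS0 : 0 ≤ S := tsum_nonneg fun p => by positivity
  refine ⟨(β + j) ^ (β + j) * (S + 1), by positivity, fun x hx => ?_⟩
  have h := tsum_of_norm_bounded ((summable_mfreq_majorant hβ).mul_left
    ((β + j) ^ (β + j) * x ^ (-(β + j)))).hasSum (f := fun p => mcoef j p * Real.exp (-mfreq p * x)) (fun p => abs_mcoef_mul_exp_le j hβ hx p)
  rw [tsum_mul_left, ← hS, Real.norm_eq_abs] at h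
  refine h.trans ?_
  have : 0 ≤ (β + j) ^ (β + j) * x ^ (-(β + j)) := by positivity
  nlinarith

lemma continuousOn_moebiusKernel (j : ℕ) : ContinuousOn (moebiusKernel j) (Ioi 0) := by
  intro x hx
  have hx2 : (0 : ℝ) < x / 2 := half_pos hx
  have h : ContinuousOn (moebiusKernel j) (Ici (x / 2)) := by
    unfold moebiusKernel
    refine continuousOn_tsum (fun p => by fun_prop) (summable_moebiusKernel j hx2).norm
      fun p y hy => ?_
    rw [norm_mul, norm_mul, Real.norm_of_nonneg (Real.exp_pos _).le,
      Real.norm_of_nonneg (Real.exp_pos _).le]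
    refine mul_le_mul_of_nonneg_left (Real.exp_le_exp.mpr ?_) (norm_nonneg _)
    have := mul_le_mul_of_nonneg_left hy (mfreq_pos p).le
    linarith
  exact (h.continuousAt (Ici_mem_nhds (by simpa using hx))).continuousWithinAt

lemma hasDerivAt_moebiusKernel {x : ℝ} (hx : 0 < x) :
    HasDerivAt (moebiusKernel 0) (-moebiusKernel 1 x) x := by
  have hx2 : (0 : ℝ) < x / 2 := half_pos hx
  have hmem : x ∈ Ioi (x / 2) := by simpa using hx
  have h := hasDerivAt_tsum_of_isPreconnected (𝕜 := ℝ) (t := Ioi (x / 2)) (y₀ := x) (y := x)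
    (g := fun (p : ℕ × ℕ) y => mcoef 0 p * Real.exp (-mfreq p * y))
    (g' := fun (p : ℕ × ℕ) y => -(mcoef 1 p * Real.exp (-mfreq p * y)))
    (summable_moebiusKernel 1 hx2).norm isOpen_Ioi isPreconnected_Ioi
    (fun p y _ => by
      have := (((hasDerivAt_id y).const_mul (-mfreq p)).exp).const_mul (mcoef 0 p)
      refine this.congr_deriv ?_
      simp only [mcoef, pow_zero, pow_one, id, mul_one]; ring)
    (fun p y hy => by
      rw [norm_neg, norm_mul, norm_mul, Real.norm_of_nonneg (Real.exp_pos _).le,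
        Real.norm_of_nonneg (Real.exp_pos _).le]
      refine mul_le_mul_of_nonneg_left (Real.exp_le_exp.mpr ?_) (norm_nonneg _)
      have := mul_le_mul_of_nonneg_left (le_of_lt hy) (mfreq_pos p).le
      linarith)
    hmem (summable_moebiusKernel 0 hx) hmem
  rw [tsum_neg] at h
  exact h

/-- Termwise, exp(-k m x) has Mellin transform Γ(w + j) (k m)^{-w-j} at w + j. The powers with
exponent j cancel, and the double series factors into ∑ k^{-w} = ζ(w) and ∑ μ(m) m^{1-w} = 1 / ζ(w -
1). -/
lemma mellin_moebiusKernel (j : ℕ) {w : ℂ} (hw : 2 < w.re) :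
    mellin (fun x => (moebiusKernel j x : ℂ)) (w + j) = mellinSymbol j w := by
  have hj0 : (0 : ℝ) ≤ j := j.cast_nonneg
  have hsumm : Summable fun p : ℕ × ℕ => ‖(mcoef j p : ℂ)‖ / mfreq p ^ (w + j).re := by
    refine Summable.of_nonneg_of_le (fun p => by have := mfreq_pos p; positivity) (fun p => ?_)
      (summable_mfreq_majorant hw)
    have hf := mfreq_pos p
    rw [Complex.norm_real, Real.norm_eq_abs, div_le_iff₀ (by positivity)]
    refine (abs_mcoef_le j p).trans (le_of_eq ?_)
    have hk : (0 : ℝ) < (p.1 : ℝ) + 1 := by positivity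
    have hm : (0 : ℝ) < (p.2 : ℝ) + 1 := by positivity
    have e1 : mfreq p ^ (w + j).re = mfreq p ^ j * (((p.1 : ℝ) + 1) ^ w.re * ((p.2 : ℝ) + 1) ^ w.re) := by
      rw [show (w + j).re = w.re + j by simp, Real.rpow_add hf, Real.rpow_natCast, mul_comm]
      congr 1
      rw [mfreq, Real.mul_rpow hk.le hm.le]
    have e2 : ((p.1 : ℝ) + 1) ^ (-w.re) * ((p.1 : ℝ) + 1) ^ w.re = 1 := by
      rw [← Real.rpow_add hk]; simp
    have e3 : ((p.2 : ℝ) + 1) ^ (-(w.re - 1)) * ((p.2 : ℝ) + 1) ^ w.re = (p.2 : ℝ) + 1 := by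
      rw [← Real.rpow_add hm]; simp
    rw [e1]
    linear_combination -((((p.2 : ℝ) + 1) ^ (-(w.re - 1)) * ((p.2 : ℝ) + 1) ^ w.re) * mfreq p ^ j) * e2
      - mfreq p ^ j * e3
  have h := hasSum_mellin (a := fun p : ℕ × ℕ => (mcoef j p : ℂ)) (p := mfreq)
    (F := fun x => (moebiusKernel j x : ℂ)) (s := w + j) (fun p => Or.inr (mfreq_pos p))
    (by simp; linarith) (fun t ht => by
      have := (summable_moebiusKernel j (x := t) ht).hasSum
      exact_mod_cast this) hsumm
  rw [← h.tsum_eq, mellinSymbol_eq j hw]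
  set A : ℕ → ℂ := fun k => 1 / ((k : ℂ) + 1) ^ w with hA
  set B : ℕ → ℂ := fun m =>
    LSeries.term (fun n => (ArithmeticFunction.moebius n : ℂ)) (w - 1) (m + 1) with hB
  have hre : 1 < (w - 1).re := by simp; linarith
  have hμ := ArithmeticFunction.LSeriesSummable_moebius_iff.mpr hre
  have hterm : ∀ p : ℕ × ℕ, Complex.Gamma (w + j) * (mcoef j p : ℂ) / (mfreq p : ℂ) ^ (w + j)
      = Complex.Gamma (w + j) * (A p.1 * B p.2) := fun p => by
    have hk : (0 : ℝ) < (p.1 : ℝ) + 1 := by positivity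
    have hm : (0 : ℝ) < (p.2 : ℝ) + 1 := by positivity
    have hf : (mfreq p : ℂ) ≠ 0 := by exact_mod_cast (mfreq_pos p).ne'
    have hkc : ((p.1 : ℂ) + 1) ≠ 0 := by exact_mod_cast hk.ne'
    have hmc : ((p.2 : ℂ) + 1) ≠ 0 := by exact_mod_cast hm.ne'
    have e1 : (mfreq p : ℂ) ^ (w + j) =
        (((p.1 : ℂ) + 1) ^ w * ((p.2 : ℂ) + 1) ^ w) * (mfreq p : ℂ) ^ j := by
      rw [Complex.cpow_add _ _ hf, Complex.cpow_natCast]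
      congr 1
      have := Complex.mul_cpow_ofReal_nonneg hk.le hm.le w
      rw [mfreq]; push_cast at this ⊢; exact this
    have e2 : ((p.2 : ℂ) + 1) ^ w = ((p.2 : ℂ) + 1) ^ (w - 1) * ((p.2 : ℂ) + 1) := by
      rw [Complex.cpow_sub _ _ hmc, Complex.cpow_one]; field_simp
    have hfj : (mfreq p : ℂ) ^ j ≠ 0 := pow_ne_zero _ hf
    have hkw : ((p.1 : ℂ) + 1) ^ w ≠ 0 := by simp [Complex.cpow_eq_zero_iff, hkc]
    have hmw : ((p.2 : ℂ) + 1) ^ (w - 1) ≠ 0 := by simp [Complex.cpow_eq_zero_iff, hmc]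
    simp only [hA, hB]
    rw [e1, e2, LSeries.term_of_ne_zero (by omega), mcoef]
    push_cast
    field_simp
  rw [tsum_congr hterm, tsum_mul_left]
  congr 1
  have hAs : Summable A := by
    have := (summable_nat_add_iff 1).mpr (Complex.summable_one_div_nat_cpow.mpr
      (by linarith : 1 < w.re))
    simpa [hA] using this
  have hBs : Summable B := (summable_nat_add_iff 1).mpr hμ
  rw [← tsum_mul_tsum_of_summable_norm hAs.norm hBs.norm, hA,
    ← zeta_eq_tsum_one_div_nat_add_one_cpow (by linarith)]
  have hL : ∑' m, B m = LSeries (fun n => (ArithmeticFunction.moebius n : ℂ)) (w - 1) := by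
    rw [LSeries, hμ.tsum_eq_zero_add]
    simp [hB]
  have hinv := LSeries_one_mul_Lseries_moebius hre
  rw [LSeries_one_eq_riemannZeta hre] at hinv
  rw [hL, div_eq_mul_inv]
  congr 1
  exact eq_inv_of_mul_eq_one_right hinv

end LatticeLLT

/-! ### Decay of the Möbius kernel by Mellin inversion. -/

namespace LatticeLLT

lemma norm_fourier_le_integral_norm (f : ℝ → ℂ) (v : ℝ) :
    ‖FourierTransform.fourier f v‖ ≤ ∫ y, ‖f y‖ :=
  VectorFourier.norm_fourierIntegral_le_integral_norm _ _ _ _ _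

/-- The Fourier transform of a twice differentiable function decays quadratically. -/
lemma norm_fourier_mul_le {g g' g'' : ℝ → ℂ} (hg : Integrable g) (hg' : Integrable g')
    (hg'' : Integrable g'') (h1 : ∀ y, HasDerivAt g (g' y) y) (h2 : ∀ y, HasDerivAt g' (g'' y) y)
    (v : ℝ) :
    ‖FourierTransform.fourier g v‖ * (1 + v ^ 2) ≤ (∫ y, ‖g y‖) + ∫ y, ‖g'' y‖ := by
  have e1 : deriv g = g' := funext fun y => (h1 y).deriv
  have e2 : deriv g' = g'' := funext fun y => (h2 y).deriv
  have f1 := Real.fourier_deriv hg (fun y => (h1 y).differentiableAt) (by rwa [e1])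
  have f2 := Real.fourier_deriv hg' (fun y => (h2 y).differentiableAt) (by rwa [e2])
  rw [e1] at f1
  rw [e2, f1] at f2
  have f3 := congrFun f2 v
  have h3 := norm_fourier_le_integral_norm g v
  have h4 := norm_fourier_le_integral_norm g'' v
  rw [f3, norm_smul, norm_smul] at h4
  have h5 : ‖(2 * Real.pi * Complex.I * v : ℂ)‖ = 2 * Real.pi * |v| := by
    simp [abs_of_pos Real.pi_pos]
  rw [h5] at h4
  have h6 : v ^ 2 ≤ (2 * Real.pi * |v|) * (2 * Real.pi * |v|) := by
    have : (2 * Real.pi * |v|) * (2 * Real.pi * |v|) = (2 * Real.pi) ^ 2 * v ^ 2 := by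
      rw [← sq_abs v]; ring
    rw [this]
    have : (1 : ℝ) ≤ (2 * Real.pi) ^ 2 := one_le_pow₀ (by linarith [Real.pi_gt_three])
    nlinarith [sq_nonneg v]
  have h7 := mul_le_mul_of_nonneg_right h6 (norm_nonneg (FourierTransform.fourier g v))
  linarith

/-- By Mellin inversion, x^{σ+j} K_j(x) is the Fourier transform at log x of the symbol restricted
to the line Re w = σ. Two integrable derivatives of the symbol give quadratic decay in log x. The
final constant does not depend on σ. -/
lemma moebiusKernel_decay_aux (j : ℕ) {C σ : ℝ} (hσ2 : 2 < σ) (hσ3 : σ < 3)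
    (hC : ∀ w : ℂ, 2 ≤ w.re → w.re ≤ 3 →
      DifferentiableAt ℂ (mellinSymbol j) w ∧ ∀ i ≤ 2,
      ‖iteratedDeriv i (mellinSymbol j) w‖ ≤ C / (1 + |w.im|) ^ 2) {x : ℝ} (hx : 0 < x) :
    |moebiusKernel j x| * x ^ (σ + j) * (1 + Real.log x ^ 2) ≤
      (1 + (2 * Real.pi) ^ 2) * C * Real.pi := by
  set U : Set ℂ := {w : ℂ | 2 < w.re} ∩ {w : ℂ | w.re < 3} with hU
  have hUo : IsOpen U := (isOpen_lt continuous_const Complex.continuous_re).inter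
    (isOpen_lt Complex.continuous_re continuous_const)
  have hC0 : 0 ≤ C := by
    have := ((hC 2 (by simp) (by norm_num)).2 0 (by norm_num))
    simp at this
    exact (norm_nonneg _).trans this
  have hdiff : DifferentiableOn ℂ (mellinSymbol j) U := fun w hw =>
    (hC w (le_of_lt hw.1) (le_of_lt hw.2)).1.differentiableWithinAt
  have hdiff' : DifferentiableOn ℂ (deriv (mellinSymbol j)) U := hdiff.deriv hUo
  set ℓ : ℝ → ℂ := fun y => σ + 2 * Real.pi * y * Complex.I with hℓ
  have hℓU : ∀ y, ℓ y ∈ U := fun y => by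
    constructor <;> simp [hℓ, hσ2, hσ3]
  have hℓim : ∀ y, (ℓ y).im = 2 * Real.pi * y := fun y => by simp [hℓ]
  have hℓd : ∀ y, HasDerivAt ℓ (2 * Real.pi * Complex.I) y := fun y => by
    have := (((hasDerivAt_id y).ofReal_comp.const_mul (2 * Real.pi : ℂ)).mul_const
      Complex.I).const_add (σ : ℂ)
    simpa [hℓ] using this
  have hℓc : Continuous ℓ := continuous_iff_continuousAt.mpr fun y => (hℓd y).continuousAt
  set g : ℝ → ℂ := fun y => mellinSymbol j (ℓ y) with hg
  set g' : ℝ → ℂ := fun y => deriv (mellinSymbol j) (ℓ y) * (2 * Real.pi * Complex.I) with hg'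
  set g'' : ℝ → ℂ := fun y => deriv (deriv (mellinSymbol j)) (ℓ y) * (2 * Real.pi * Complex.I) *
    (2 * Real.pi * Complex.I) with hg''
  have h1 : ∀ y, HasDerivAt g (g' y) y := fun y =>
    HasDerivAt.comp y (hdiff.differentiableAt (hUo.mem_nhds (hℓU y))).hasDerivAt (hℓd y)
  have h2 : ∀ y, HasDerivAt g' (g'' y) y := fun y =>
    (HasDerivAt.comp y (hdiff'.differentiableAt (hUo.mem_nhds (hℓU y))).hasDerivAt
      (hℓd y)).mul_const _
  have hdec : ∀ y : ℝ, C / (1 + |2 * Real.pi * y|) ^ 2 ≤ C * (1 + y ^ 2)⁻¹ := fun y => by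
    rw [div_eq_mul_inv]
    gcongr
    have : |y| ≤ |2 * Real.pi * y| := by
      rw [abs_mul, abs_of_pos Real.two_pi_pos]
      exact le_mul_of_one_le_left (abs_nonneg _) (by linarith [Real.pi_gt_three])
    rw [← sq_abs y]
    nlinarith [abs_nonneg y, abs_nonneg (2 * Real.pi * y)]
  have hn : ‖(2 * Real.pi * Complex.I : ℂ)‖ = 2 * Real.pi := by simp [abs_of_pos Real.pi_pos]
  have b0 : ∀ y, ‖g y‖ ≤ C * (1 + y ^ 2)⁻¹ := fun y => by
    have := (hC (ℓ y) (hℓU y).1.le (hℓU y).2.le).2 0 (by norm_num)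
    rw [iteratedDeriv_zero, hℓim] at this
    exact this.trans (hdec y)
  have b1 : ∀ y, ‖g' y‖ ≤ (2 * Real.pi) * (C * (1 + y ^ 2)⁻¹) := fun y => by
    have := (hC (ℓ y) (hℓU y).1.le (hℓU y).2.le).2 1 (by norm_num)
    rw [iteratedDeriv_one, hℓim] at this
    rw [hg', norm_mul, hn, mul_comm]
    exact mul_le_mul_of_nonneg_left (this.trans (hdec y)) (by positivity)
  have b2 : ∀ y, ‖g'' y‖ ≤ (2 * Real.pi) ^ 2 * (C * (1 + y ^ 2)⁻¹) := fun y => by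
    have := (hC (ℓ y) (hℓU y).1.le (hℓU y).2.le).2 2 le_rfl
    rw [iteratedDeriv_succ, iteratedDeriv_one, hℓim] at this
    rw [hg'', norm_mul, norm_mul, hn, mul_assoc, mul_comm, ← sq]
    exact mul_le_mul_of_nonneg_left (this.trans (hdec y)) (by positivity)
  have hI : Integrable fun y : ℝ => C * (1 + y ^ 2)⁻¹ := integrable_inv_one_add_sq.const_mul _
  have i0 : Integrable g := hI.mono'
    (continuous_iff_continuousAt.mpr fun y => (h1 y).continuousAt).aestronglyMeasurable
    (.of_forall b0)
  have i1 : Integrable g' := (hI.const_mul _).mono'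
    (continuous_iff_continuousAt.mpr fun y => (h2 y).continuousAt).aestronglyMeasurable
    (.of_forall b1)
  have c2 : Continuous g'' := by
    have : ContinuousOn (deriv (deriv (mellinSymbol j))) U := (hdiff'.deriv hUo).continuousOn
    exact ((this.comp_continuous hℓc hℓU).mul continuous_const).mul continuous_const
  have i2 : Integrable g'' := (hI.const_mul _).mono' c2.aestronglyMeasurable (.of_forall b2)
  have key := norm_fourier_mul_le i0 i1 i2 h1 h2 (Real.log x)
  have n0 : ∫ y, ‖g y‖ ≤ C * Real.pi := by
    refine (integral_mono i0.norm hI b0).trans (le_of_eq ?_)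
    rw [integral_const_mul, integral_univ_inv_one_add_sq]
  have n2 : ∫ y, ‖g'' y‖ ≤ (2 * Real.pi) ^ 2 * (C * Real.pi) := by
    refine (integral_mono i2.norm (hI.const_mul _) b2).trans (le_of_eq ?_)
    rw [integral_const_mul, integral_const_mul, integral_univ_inv_one_add_sq]
  -- Mellin inversion
  have hmell : ∀ y : ℝ, mellin (fun x => (moebiusKernel j x : ℂ)) (((σ + j : ℝ) : ℂ) + y * Complex.I)
      = mellinSymbol j (σ + y * Complex.I) := fun y => by
    rw [← mellin_moebiusKernel j (w := σ + y * Complex.I) (by simpa using hσ2)]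
    congr 1
    push_cast; ring
  -- The crude bound is used with one exponent on each side of σ: σ + 1 at infinity and (σ + 2)/2,
  -- still above 2, at the origin.
  have hconv : MellinConvergent (fun x => (moebiusKernel j x : ℂ)) ((σ + j : ℝ) : ℂ) := by
    obtain ⟨C1, hC1, hb1⟩ := exists_abs_moebiusKernel_le j (β := σ + 1) (by linarith)
    obtain ⟨C2, hC2, hb2⟩ := exists_abs_moebiusKernel_le j (β := (σ + 2) / 2) (by linarith)
    refine mellinConvergent_of_isBigO_rpow (a := σ + 1 + j) (b := (σ + 2) / 2 + j) ?_ ?_ ?_ ?_ ?_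
    · exact (Complex.continuous_ofReal.comp_continuousOn
        (continuousOn_moebiusKernel j)).locallyIntegrableOn measurableSet_Ioi
    · refine Asymptotics.IsBigO.of_bound C1 ?_
      filter_upwards [Ioi_mem_atTop 0] with y hy
      have hy' : (0 : ℝ) < y := hy
      rw [Complex.norm_real, Real.norm_eq_abs, Real.norm_of_nonneg (by positivity)]
      exact hb1 y hy
    · simp
    · refine Asymptotics.IsBigO.of_bound C2 ?_
      filter_upwards [self_mem_nhdsWithin] with y hy
      have hy' : (0 : ℝ) < y := hy
      rw [Complex.norm_real, Real.norm_eq_abs, Real.norm_of_nonneg (by positivity)]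
      exact hb2 y hy
    · simp; linarith
  have hvert : Complex.VerticalIntegrable (mellin (fun x => (moebiusKernel j x : ℂ))) (σ + j) := by
    rw [Complex.VerticalIntegrable]
    simp_rw [hmell]
    have := i0.comp_mul_left' (R := (2 * Real.pi)⁻¹) (by positivity)
    refine this.congr (.of_forall fun y => ?_)
    simp only [hg, hℓ]
    congr 2
    push_cast
    field_simp
  have hinv := mellinInv_mellin_eq (σ + j) (fun x => (moebiusKernel j x : ℂ)) hx hconv hvert
    ((Complex.continuous_ofReal.comp_continuousOn
        (continuousOn_moebiusKernel j)).continuousAt (Ioi_mem_nhds hx))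
  rw [mellinInv_eq_fourierInv _ _ hx, Real.fourierInv_eq_fourier_neg, neg_neg] at hinv
  have hfun : (fun y : ℝ => mellin (fun x => (moebiusKernel j x : ℂ))
      (((σ + j : ℝ) : ℂ) + 2 * Real.pi * y * Complex.I)) = g := by
    funext y
    have := hmell (2 * Real.pi * y)
    push_cast at this ⊢
    rw [this]
  rw [hfun] at hinv
  have hnorm := congrArg norm hinv
  rw [norm_smul, ← Complex.ofReal_neg, Complex.norm_cpow_eq_rpow_re_of_pos hx,
    Complex.norm_real, Real.norm_eq_abs, Complex.ofReal_re] at hnorm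
  rw [← hnorm]
  have hxx : x ^ (-(σ + j)) * x ^ (σ + j) = 1 := by rw [← Real.rpow_add hx]; simp
  calc x ^ (-(σ + j)) * ‖FourierTransform.fourier g (Real.log x)‖ * x ^ (σ + j) *
        (1 + Real.log x ^ 2)
      = ‖FourierTransform.fourier g (Real.log x)‖ * (1 + Real.log x ^ 2) *
        (x ^ (-(σ + j)) * x ^ (σ + j)) := by ring
    _ ≤ _ := by rw [hxx]; linarith

/-- The crucial decay: the Möbius kernel beats its trivial size `x^(-2-j)` by a squared logarithm. -/
lemma exists_moebiusKernel_decay (j : ℕ) (hj : j ≤ 1) :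
    ∃ C : ℝ, 0 < C ∧ ∀ x : ℝ, 0 < x →
      |moebiusKernel j x| ≤ C / (x ^ (2 + j) * (1 + Real.log x ^ 2)) := by
  obtain ⟨C, hC0, hC⟩ := exists_norm_iteratedDeriv_mellinSymbol_le j hj
  refine ⟨(1 + (2 * Real.pi) ^ 2) * C * Real.pi, by positivity, fun x hx => ?_⟩
  rw [le_div_iff₀ (by positivity), ← mul_assoc]
  -- Since the bound is uniform in σ, one may let σ decrease to 2 for fixed x; no inversion on the
  -- line Re w = 2 itself is needed.
  have hlim : Tendsto (fun σ : ℝ => |moebiusKernel j x| * x ^ (σ + j) * (1 + Real.log x ^ 2))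
      (𝓝[>] 2) (𝓝 (|moebiusKernel j x| * x ^ ((2 : ℝ) + j) * (1 + Real.log x ^ 2))) := by
    refine Tendsto.mono_left ?_ nhdsWithin_le_nhds
    refine Tendsto.mul_const _ (Tendsto.const_mul _ ?_)
    exact ((Real.continuous_const_rpow hx.ne').comp (continuous_id.add continuous_const)).tendsto 2
  have := le_of_tendsto hlim (by
    filter_upwards [Ioo_mem_nhdsGT (show (2 : ℝ) < 3 by norm_num)] with σ hσ
    exact moebiusKernel_decay_aux j hσ.1 hσ.2 hC hx)
  have e : x ^ ((2 : ℝ) + j) = x ^ (2 + j) := by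
    rw [← Real.rpow_natCast]; push_cast; rfl
  rwa [e] at this

end LatticeLLT

namespace LatticeLLT

/-! ### Möbius inversion for the kernel, and its second moment -/

lemma sum_divisorsAntidiagonal_moebius (n : ℕ) :
    ∑ x ∈ n.divisorsAntidiagonal, ArithmeticFunction.moebius x.2 = if n = 1 then 1 else 0 := by
  have h := congrArg (fun f => f n) ArithmeticFunction.coe_zeta_mul_moebius
  simp only [ArithmeticFunction.mul_apply, ArithmeticFunction.one_apply] at h
  rw [← h]
  refine Finset.sum_congr rfl fun x hx => ?_
  have := (Nat.mem_divisorsAntidiagonal.mp hx)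
  have h1 : x.1 ≠ 0 := by rintro h0; apply this.2; rw [← this.1, h0, zero_mul]
  simp [ArithmeticFunction.natCoe_apply, ArithmeticFunction.zeta_apply, h1]

/-- Grouping the pairs by the product n of the shifted indices gives n r^n ∑_{m ∣ n} μ(m), and only
n = 1 survives. -/
lemma hasSum_moebius_lambert {r : ℝ}
    (hs : Summable fun p : ℕ × ℕ => ((p.1 : ℝ) + 1) * ((p.2 : ℝ) + 1) *
      (ArithmeticFunction.moebius (p.2 + 1) : ℝ) * r ^ ((p.1 + 1) * (p.2 + 1))) :
    HasSum (fun p : ℕ × ℕ => ((p.1 : ℝ) + 1) * ((p.2 : ℝ) + 1) *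
      (ArithmeticFunction.moebius (p.2 + 1) : ℝ) * r ^ ((p.1 + 1) * (p.2 + 1))) r := by
  set f : ℕ × ℕ → ℝ := fun p => ((p.1 : ℝ) + 1) * ((p.2 : ℝ) + 1) *
      (ArithmeticFunction.moebius (p.2 + 1) : ℝ) * r ^ ((p.1 + 1) * (p.2 + 1)) with hf
  set e : (Σ n : ℕ+, Nat.divisorsAntidiagonal n) ≃ ℕ × ℕ :=
    sigmaAntidiagonalEquivProd.trans (Equiv.pnatEquivNat.prodCongr Equiv.pnatEquivNat) with he
  rw [← e.hasSum_iff]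
  have hs' : Summable (f ∘ e) := e.summable_iff.mpr hs
  have hfe : ∀ n : ℕ+, ∀ x : Nat.divisorsAntidiagonal n, (f ∘ e) ⟨n, x⟩ =
      (n : ℝ) * r ^ (n : ℕ) * (ArithmeticFunction.moebius x.1.2 : ℝ) := fun n x => by
    obtain ⟨⟨a, b⟩, hx⟩ := x
    have h := (Nat.mem_divisorsAntidiagonal.mp hx)
    have ha : a ≠ 0 := by rintro h0; apply h.2; rw [← h.1]; simp [h0]
    have hb : b ≠ 0 := by rintro h0; apply h.2; rw [← h.1]; simp [h0]
    obtain ⟨a, rfl⟩ := Nat.exists_eq_succ_of_ne_zero ha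
    obtain ⟨b, rfl⟩ := Nat.exists_eq_succ_of_ne_zero hb
    have hn : (n : ℝ) = ((a : ℝ) + 1) * ((b : ℝ) + 1) := by rw [← h.1]; push_cast; ring
    have e1 : e ⟨n, ⟨(a.succ, b.succ), hx⟩⟩ = (a, b) := by
      rfl
    simp only [Function.comp, e1, hf, hn]
    rw [← h.1]
    simp only [Nat.succ_eq_add_one]
    ring
  have h1 := hs'.hasSum.sigma (g := fun n : ℕ+ => if n = 1 then r else 0) (fun n => by
    have := hasSum_fintype (fun x : Nat.divisorsAntidiagonal n => (f ∘ e) ⟨n, x⟩)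
    convert! this using 1
    simp only [hfe]
    rw [← Finset.mul_sum, Finset.sum_coe_sort (Nat.divisorsAntidiagonal n)
      (fun x => (ArithmeticFunction.moebius x.2 : ℝ))]
    have h2 := sum_divisorsAntidiagonal_moebius n
    have h3 : ∑ x ∈ (n : ℕ).divisorsAntidiagonal, (ArithmeticFunction.moebius x.2 : ℝ)
        = if (n : ℕ) = 1 then 1 else 0 := by exact_mod_cast h2
    rw [h3]
    by_cases hn : n = 1
    · simp [hn]
    · have : (n : ℕ) ≠ 1 := fun h => hn (PNat.coe_eq_one_iff.mp h)
      simp [hn])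
  have h2 : HasSum (fun n : ℕ+ => if n = 1 then r else 0) r := by
    simpa using hasSum_ite_eq (1 : ℕ+) r
  rw [← h1.unique h2]
  exact hs'.hasSum

lemma hasSum_exp_neg_geometric {s : ℝ} (hs : 0 < s) :
    HasSum (fun k : ℕ => Real.exp (-(((k : ℝ) + 1) * s))) (1 / (Real.exp s - 1)) := by
  have h1 : Real.exp (-s) < 1 := by simpa using hs
  have h := (hasSum_geometric_of_lt_one (Real.exp_pos (-s)).le h1).mul_left (Real.exp (-s))
  have hE : 1 < Real.exp s := by simpa using hs
  have e : Real.exp (-s) * (1 - Real.exp (-s))⁻¹ = 1 / (Real.exp s - 1) := by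
    rw [Real.exp_neg]
    have : Real.exp s - 1 ≠ 0 := by linarith
    have h0 := (Real.exp_pos s).ne'
    have : 1 - (Real.exp s)⁻¹ ≠ 0 := by
      have := inv_lt_one_of_one_lt₀ hE
      linarith
    field_simp
  rw [e] at h
  refine h.congr_fun fun k => ?_
  rw [← Real.exp_nat_mul, ← Real.exp_add]
  congr 1; ring

/-- `∑_{d ≥ 1} d K₀(d s) = 1 / (e^s - 1)`. -/
lemma hasSum_mul_moebiusKernel {s : ℝ} (hs : 0 < s) :
    HasSum (fun d : ℕ => ((d : ℝ) + 1) * moebiusKernel 0 (((d : ℝ) + 1) * s))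
      (1 / (Real.exp s - 1)) := by
  set f : ℕ × (ℕ × ℕ) → ℝ := fun q => ((q.1 : ℝ) + 1) *
    (mcoef 0 q.2 * Real.exp (-mfreq q.2 * (((q.1 : ℝ) + 1) * s))) with hf
  have hsum : Summable f := by
    have h1 := ((summable_rpow_shift (p := 2) (by norm_num)).mul_of_nonneg
      (summable_mfreq_majorant (β := 3) (by norm_num)) (fun _ => by positivity)
      (fun _ => by positivity)).mul_left ((3 + (0 : ℕ) : ℝ) ^ (3 + (0 : ℕ) : ℝ) * s ^ (-(3 + (0 : ℕ)) : ℝ))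
    refine Summable.of_norm_bounded h1 fun q => ?_
    have hd : (0 : ℝ) < (q.1 : ℝ) + 1 := by positivity
    have h2 := abs_mcoef_mul_exp_le 0 (β := 3) (by norm_num) (mul_pos hd hs) q.2
    simp only [hf]
    rw [norm_mul, Real.norm_of_nonneg hd.le]
    refine (mul_le_mul_of_nonneg_left h2 hd.le).trans (le_of_eq ?_)
    rw [Real.mul_rpow hd.le hs.le]
    have : ((q.1 : ℝ) + 1) ^ (-(3 + (0 : ℕ)) : ℝ) * ((q.1 : ℝ) + 1) = ((q.1 : ℝ) + 1) ^ (-2 : ℝ) := by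
      nth_rewrite 2 [← Real.rpow_one ((q.1 : ℝ) + 1)]
      rw [← Real.rpow_add hd]; norm_num
    rw [← this]; ring
  have h1 := hsum.hasSum.prod_fiberwise (fun d =>
    (summable_moebiusKernel 0 (x := ((d : ℝ) + 1) * s) (by positivity)).hasSum.mul_left ((d : ℝ) + 1))
  -- reorder the triple sum: the outer variable is now `k`
  set e : ℕ × (ℕ × ℕ) ≃ ℕ × (ℕ × ℕ) :=
    ⟨fun q => (q.2.1, (q.1, q.2.2)), fun q => (q.2.1, (q.1, q.2.2)), fun _ => rfl, fun _ => rfl⟩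
    with he
  have hsum' : Summable (f ∘ e) := e.summable_iff.mpr hsum
  have hfe : ∀ (k : ℕ) (p : ℕ × ℕ), (f ∘ e) (k, p) = ((p.1 : ℝ) + 1) * ((p.2 : ℝ) + 1) *
      (ArithmeticFunction.moebius (p.2 + 1) : ℝ) *
      Real.exp (-(((k : ℝ) + 1) * s)) ^ ((p.1 + 1) * (p.2 + 1)) := fun k p => by
    simp only [hf, he, Function.comp, Equiv.coe_fn_mk, mcoef, mfreq, pow_zero]
    rw [← Real.exp_nat_mul]
    have : -(((k : ℝ) + 1) * ((p.2 : ℝ) + 1)) * (((p.1 : ℝ) + 1) * s)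
        = (((p.1 + 1) * (p.2 + 1) : ℕ) : ℝ) * -(((k : ℝ) + 1) * s) := by push_cast; ring
    rw [this]; ring
  have h2 := hsum'.hasSum.prod_fiberwise (g := fun k : ℕ => Real.exp (-(((k : ℝ) + 1) * s)))
    (fun k => by
      have hk := hsum'.prod_factor k
      simp only [hfe] at hk ⊢
      exact hasSum_moebius_lambert hk)
  have h3 : ∑' q, f q = 1 / (Real.exp s - 1) := by
    rw [← h2.unique (hasSum_exp_neg_geometric hs)]
    exact (e.tsum_eq f).symm
  rw [h3] at h1
  exact h1

lemma zetaSeries_eq {s : ℕ} (hs : 1 < s) :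
    (ConvexLattice.zetaSeries s : ℂ) = riemannZeta s := by
  rw [zeta_eq_tsum_one_div_nat_add_one_cpow (by simpa using hs), ConvexLattice.zetaSeries]
  push_cast
  simp

lemma zetaSeries_pos {s : ℕ} (hs : 1 < s) : 0 < ConvexLattice.zetaSeries s := by
  have h : Summable fun k : ℕ => 1 / ((k : ℝ) + 1) ^ s := by
    have := (summable_nat_add_iff 1).mpr (Real.summable_one_div_nat_pow.mpr hs)
    simpa using this
  exact h.tsum_pos (fun k => by positivity) 0 (by norm_num)

lemma kappa_cube : ConvexLattice.kappa ^ 3 =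
    2 * ConvexLattice.zetaSeries 3 / ConvexLattice.zetaSeries 2 := by
  have h3 := zetaSeries_pos (s := 3) (by norm_num)
  have h2 := zetaSeries_pos (s := 2) (by norm_num)
  rw [ConvexLattice.kappa, ← Real.rpow_natCast, ← Real.rpow_mul (by positivity)]
  norm_num

lemma kappa_pos : 0 < ConvexLattice.kappa := by
  have h3 := zetaSeries_pos (s := 3) (by norm_num)
  have h2 := zetaSeries_pos (s := 2) (by norm_num)
  unfold ConvexLattice.kappa
  positivity

/-- This is the Mellin transform at w = 3, namely Γ(3) ζ(3) / ζ(2). It is the source of the constant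
κ in the asymptotics. -/
lemma integral_sq_mul_moebiusKernel :
    ∫ x in Ioi (0 : ℝ), x ^ 2 * moebiusKernel 0 x = ConvexLattice.kappa ^ 3 := by
  have h := mellin_moebiusKernel 0 (w := 3) (by norm_num)
  rw [mellinSymbol_eq 0 (by norm_num), mellin] at h
  have e1 : ∫ t in Ioi (0 : ℝ), (t : ℂ) ^ ((3 : ℂ) + (0 : ℕ) - 1) • (moebiusKernel 0 t : ℂ)
      = ((∫ x in Ioi (0 : ℝ), x ^ 2 * moebiusKernel 0 x : ℝ) : ℂ) := by
    rw [← integral_complex_ofReal]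
    refine setIntegral_congr_fun measurableSet_Ioi fun t _ => ?_
    simp only [smul_eq_mul]
    push_cast
    congr 1
    rw [show (3 : ℂ) + 0 - 1 = ((2 : ℕ) : ℂ) by norm_num, Complex.cpow_natCast]
  rw [e1] at h
  have hΓ : Complex.Gamma 3 = 2 := by
    rw [show (3 : ℂ) = ((2 : ℕ) : ℂ) + 1 by norm_num, Complex.Gamma_nat_eq_factorial]
    norm_num
  have h3 := zetaSeries_eq (s := 3) (by norm_num)
  have h2 := zetaSeries_eq (s := 2) (by norm_num)
  push_cast at h h3 h2
  rw [add_zero, hΓ, show (3 : ℂ) - 1 = 2 by norm_num, ← h3, ← h2] at h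
  rw [kappa_cube]
  have : ((∫ x in Ioi (0 : ℝ), x ^ 2 * moebiusKernel 0 x : ℝ) : ℂ) =
      ((2 * ConvexLattice.zetaSeries 3 / ConvexLattice.zetaSeries 2 : ℝ) : ℂ) := by
    rw [h]; push_cast; ring
  exact_mod_cast this

end LatticeLLT

namespace LatticeLLT

/-! ### Comparison of sums and integrals -/

/-- Riemann sums of a bounded Lipschitz function over the points `j η` of `[a, b]`. -/
lemma abs_sum_sub_integral_le {G : ℝ → ℝ} {a b η B L : ℝ} (ha : 0 ≤ a) (hab : a ≤ b) (hη : 0 < η)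
    (hB : ∀ t, |G t| ≤ B) (hL : ∀ s t, |G s - G t| ≤ L * |s - t|) :
    |∑ j ∈ Finset.Icc ⌈a / η⌉₊ ⌊b / η⌋₊, G (j * η) - η⁻¹ * ∫ t in a..b, G t| ≤
      3 * B + L * (b - a) := by
  have hB0 : 0 ≤ B := (abs_nonneg _).trans (hB 0)
  have hL0 : 0 ≤ L := by
    have := (abs_nonneg _).trans (hL 0 1)
    simpa using this
  have hcont : Continuous G := by
    have : LipschitzWith ⟨L, hL0⟩ G := LipschitzWith.of_dist_le_mul fun s t => by
      rw [Real.dist_eq, Real.dist_eq]; exact hL s t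
    exact this.continuous
  have hint : ∀ u v, IntervalIntegrable G volume u v := fun u v => hcont.intervalIntegrable _ _
  have hsmall : ∀ u v : ℝ, |∫ t in u..v, G t| ≤ B * |v - u| := fun u v => by
    rw [← Real.norm_eq_abs]
    exact intervalIntegral.norm_integral_le_of_norm_le_const fun t _ => hB t
  have hb : 0 ≤ b := ha.trans hab
  set p := ⌈a / η⌉₊ with hp
  set q := ⌊b / η⌋₊ with hq
  have hp1 : a ≤ p * η := by rw [← div_le_iff₀ hη]; exact Nat.le_ceil _
  have hq1 : q * η ≤ b := by rw [← le_div_iff₀ hη]; exact Nat.floor_le (by positivity)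
  have hp2 : p * η ≤ a + η := by
    have : (p : ℝ) < a / η + 1 := Nat.ceil_lt_add_one (by positivity)
    have := mul_le_mul_of_nonneg_right this.le hη.le
    rw [add_mul, div_mul_cancel₀ _ hη.ne'] at this; linarith
  have hq2 : b ≤ q * η + η := by
    have : b / η < (q : ℝ) + 1 := Nat.lt_floor_add_one _
    have := mul_le_mul_of_nonneg_right this.le hη.le
    rw [add_mul, div_mul_cancel₀ _ hη.ne'] at this; linarith
  -- If q < p, there are no grid points in [a, b]; the interval then has length at most 2η, and the
  -- integral term alone is at most 2B.
  rcases lt_or_ge q p with hqp | hpq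
  · rw [Finset.Icc_eq_empty (by omega), Finset.sum_empty, zero_sub, abs_neg, abs_mul,
      abs_of_pos (inv_pos.mpr hη)]
    have h1 : (q : ℝ) + 1 ≤ p := by exact_mod_cast hqp
    have h2 : b - a ≤ 2 * η := by nlinarith
    have h3 := hsmall a b
    rw [abs_of_nonneg (sub_nonneg.mpr hab)] at h3
    have h4 : η⁻¹ * |∫ t in a..b, G t| ≤ η⁻¹ * (B * (2 * η)) := by gcongr; exact h3.trans (by gcongr)
    have h5 : η⁻¹ * (B * (2 * η)) = 2 * B := by field_simp
    have : 0 ≤ L * (b - a) := mul_nonneg hL0 (sub_nonneg.mpr hab)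
    linarith
  · have hsplit : ∫ t in a..b, G t = (∫ t in a..(p * η), G t) + (∫ t in (p * η)..(q * η), G t)
        + ∫ t in (q * η)..b, G t := by
      rw [intervalIntegral.integral_add_adjacent_intervals (hint _ _) (hint _ _),
        intervalIntegral.integral_add_adjacent_intervals (hint _ _) (hint _ _)]
    have hmid : ∫ t in (p * η)..(q * η), G t =
        ∑ j ∈ Finset.Ico p q, ∫ t in (j * η)..((j + 1 : ℕ) * η), G t :=
      (intervalIntegral.sum_integral_adjacent_intervals_Ico (a := fun j : ℕ => (j : ℝ) * η) hpq
        (fun k _ => hint _ _)).symm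
    have hcell : ∀ j : ℕ, |G (j * η) - η⁻¹ * ∫ t in (j * η)..((j + 1 : ℕ) * η), G t| ≤ L * η := by
      intro j
      have e1 : G (j * η) - η⁻¹ * ∫ t in (j * η)..((j + 1 : ℕ) * η), G t =
          η⁻¹ * ∫ t in (j * η)..((j + 1 : ℕ) * η), (G (j * η) - G t) := by
        rw [intervalIntegral.integral_sub (by simp) (hint _ _), intervalIntegral.integral_const]
        push_cast
        rw [smul_eq_mul]
        field_simp
        ring
      have e2 : |∫ t in (j * η)..((j + 1 : ℕ) * η), (G (j * η) - G t)| ≤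
          (L * η) * |((j + 1 : ℕ) : ℝ) * η - j * η| := by
        rw [← Real.norm_eq_abs]
        refine intervalIntegral.norm_integral_le_of_norm_le_const fun t ht => ?_
        rw [uIoc_of_le (by push_cast; nlinarith)] at ht
        refine (hL _ _).trans ?_
        gcongr
        have h2 := ht.2
        push_cast at h2
        rw [abs_sub_comm, abs_of_nonneg (by linarith [ht.1])]
        linarith
      have e3 : |((j + 1 : ℕ) : ℝ) * η - j * η| = η := by
        push_cast
        rw [show ((j : ℝ) + 1) * η - j * η = η by ring, abs_of_pos hη]
      rw [e3] at e2
      rw [e1, abs_mul, abs_of_pos (inv_pos.mpr hη)]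
      calc η⁻¹ * _ ≤ η⁻¹ * (L * η * η) := by gcongr
        _ = L * η := by field_simp
    have hsum : ∑ j ∈ Finset.Icc p q, G (j * η) = ∑ j ∈ Finset.Ico p q, G (j * η) + G (q * η) := by
      rw [← Finset.Ico_insert_right hpq, Finset.sum_insert (by simp)]; ring
    have h1 : |∑ j ∈ Finset.Ico p q, (G (j * η) - η⁻¹ * ∫ t in (j * η)..((j + 1 : ℕ) * η), G t)|
        ≤ L * (b - a) := by
      refine (Finset.abs_sum_le_sum_abs _ _).trans ((Finset.sum_le_sum fun j _ => hcell j).trans ?_)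
      rw [Finset.sum_const, Nat.card_Ico, nsmul_eq_mul, Nat.cast_sub hpq]
      have : ((q : ℝ) - p) * η ≤ b - a := by linarith
      calc ((q : ℝ) - p) * (L * η) = L * (((q : ℝ) - p) * η) := by ring
        _ ≤ _ := by gcongr
    have h2 : |η⁻¹ * ∫ t in a..(p * η), G t| ≤ B := by
      rw [abs_mul, abs_of_pos (inv_pos.mpr hη)]
      calc η⁻¹ * _ ≤ η⁻¹ * (B * η) := by
            gcongr
            refine (hsmall _ _).trans ?_
            gcongr
            rw [abs_of_nonneg (by linarith)]; linarith
        _ = B := by field_simp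
    have h3 : |η⁻¹ * ∫ t in (q * η)..b, G t| ≤ B := by
      rw [abs_mul, abs_of_pos (inv_pos.mpr hη)]
      calc η⁻¹ * _ ≤ η⁻¹ * (B * η) := by
            gcongr
            refine (hsmall _ _).trans ?_
            gcongr
            rw [abs_of_nonneg (by linarith)]; linarith
        _ = B := by field_simp
    have h4 := hB (q * η)
    rw [hsum, hsplit, hmid]
    rw [Finset.sum_sub_distrib, ← Finset.mul_sum] at h1
    rw [abs_le] at h1 h2 h3 h4 ⊢
    constructor <;> linarith [h1.1, h1.2, h2.1, h2.2, h3.1, h3.2, h4.1, h4.2]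

/-- Stability of the logarithmic weight under bounded multiplicative perturbations. -/
lemma inv_one_add_sq_add_le (u v : ℝ) :
    (1 + (u + v) ^ 2)⁻¹ ≤ 2 * (1 + v ^ 2) * (1 + u ^ 2)⁻¹ := by
  rw [inv_eq_one_div, div_le_iff₀ (by positivity), mul_assoc, inv_mul_eq_div, mul_div_assoc',
    le_div_iff₀ (by positivity)]
  nlinarith [sq_nonneg (u + 2 * v), sq_nonneg (u * v + v ^ 2), sq_nonneg (v * (u + v)),
    sq_nonneg (u + v)]

/-- A bounded primitive of the weight 1 / (x (1 + log² x)). Its total variation π makes the later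
sums bounded uniformly in the scale. -/
lemma hasDerivAt_arctan_log {x : ℝ} (hx : 0 < x) :
    HasDerivAt (fun y => Real.arctan (Real.log y)) ((x * (1 + Real.log x ^ 2))⁻¹) x := by
  have := (Real.hasDerivAt_log hx.ne').arctan
  refine this.congr_deriv ?_
  field_simp

/-- The uniform bound `∑ 1 / (y (1 + log² (c y))) ≪ 1`. -/
lemma inv_mul_one_add_log_sq_le {c : ℝ} (hc : 0 < c) (n : ℕ) :
    (((n : ℝ) + 1) * (1 + Real.log (c * (n + 1)) ^ 2))⁻¹ ≤
      8 * (Real.arctan (Real.log (c * (n + 2))) - Real.arctan (Real.log (c * (n + 1)))) := by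
  have hn : (0 : ℝ) < (n : ℝ) + 1 := by positivity
  obtain ⟨ξ, hξ, h⟩ := exists_hasDerivAt_eq_slope (fun y => Real.arctan (Real.log (c * y)))
    (fun y => (c * y * (1 + Real.log (c * y) ^ 2))⁻¹ * (c * 1)) (a := (n : ℝ) + 1) (b := (n : ℝ) + 2)
    (by linarith)
    (fun y hy => by
      have hy0 : 0 < y := hn.trans_le hy.1
      exact ((hasDerivAt_arctan_log (mul_pos hc hy0)).comp y
        ((hasDerivAt_id y).const_mul c)).continuousAt.continuousWithinAt)
    (fun y hy => by
      have hy0 : 0 < y := hn.trans hy.1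
      exact (hasDerivAt_arctan_log (mul_pos hc hy0)).comp y ((hasDerivAt_id y).const_mul c))
  have hξ0 : 0 < ξ := hn.trans hξ.1
  rw [show (n : ℝ) + 2 - (n + 1) = 1 by ring, div_one] at h
  rw [← h]
  have e1 : (c * ξ * (1 + Real.log (c * ξ) ^ 2))⁻¹ * (c * 1) = ξ⁻¹ * (1 + Real.log (c * ξ) ^ 2)⁻¹ := by
    field_simp
  rw [e1, mul_inv]
  -- Passing from the mean value point ξ to n + 1 costs a factor 2 in the reciprocal, as ξ ≤ 2(n +
  -- 1), and a factor 2(1 + v²) ≤ 4 in the logarithmic weight; hence the constant 8.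
  set v := Real.log ((n + 1) / ξ) with hv
  have hlog : Real.log (c * (n + 1)) = Real.log (c * ξ) + v := by
    rw [hv, Real.log_div hn.ne' hξ0.ne', Real.log_mul hc.ne' hn.ne', Real.log_mul hc.ne' hξ0.ne']
    ring
  have hξ2 : ξ ≤ 2 * (n + 1) := by linarith [hξ.2, n.cast_nonneg (α := ℝ)]
  have hv1 : v ^ 2 ≤ 1 := by
    have h1 : v ≤ 0 := Real.log_nonpos (by positivity) (by rw [div_le_one hξ0]; exact hξ.1.le)
    have h2 : -v ≤ 1 := by
      rw [hv, ← Real.log_inv, inv_div]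
      refine (Real.log_le_sub_one_of_pos (by positivity)).trans ?_
      rw [sub_le_iff_le_add, div_le_iff₀ hn]; linarith
    nlinarith
  rw [hlog]
  have h3 := inv_one_add_sq_add_le (Real.log (c * ξ)) v
  have h4 : ((n : ℝ) + 1)⁻¹ ≤ 2 * ξ⁻¹ := by
    rw [← div_eq_mul_inv, inv_eq_one_div, div_le_div_iff₀ hn hξ0]; linarith
  calc ((n : ℝ) + 1)⁻¹ * (1 + (Real.log (c * ξ) + v) ^ 2)⁻¹
      ≤ (2 * ξ⁻¹) * (2 * (1 + 1) * (1 + Real.log (c * ξ) ^ 2)⁻¹) := by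
        refine mul_le_mul h4 (h3.trans ?_) (by positivity) (by positivity)
        gcongr
    _ = _ := by ring

/-- The increments of arctan ∘ log telescope to at most π. The point is the uniformity in both N and
c. -/
lemma sum_inv_mul_one_add_log_sq_le {c : ℝ} (hc : 0 < c) (N : ℕ) :
    ∑ n ∈ Finset.range N, (((n : ℝ) + 1) * (1 + Real.log (c * (n + 1)) ^ 2))⁻¹ ≤ 8 * Real.pi := by
  refine (Finset.sum_le_sum fun n _ => inv_mul_one_add_log_sq_le hc n).trans ?_
  rw [← Finset.mul_sum]
  have h := Finset.sum_range_sub (fun n : ℕ => Real.arctan (Real.log (c * ((n : ℝ) + 1)))) N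
  have e : ∀ n : ℕ, Real.arctan (Real.log (c * (n + 2))) - Real.arctan (Real.log (c * (n + 1)))
      = Real.arctan (Real.log (c * (((n + 1 : ℕ) : ℝ) + 1))) -
        Real.arctan (Real.log (c * ((n : ℝ) + 1))) := fun n => by
    push_cast; rw [show (n : ℝ) + 1 + 1 = n + 2 by ring]
  rw [Finset.sum_congr rfl fun n _ => e n, h]
  refine mul_le_mul_of_nonneg_left ?_ (by norm_num)
  have h1 := Real.arctan_lt_pi_div_two (Real.log (c * ((N : ℝ) + 1)))
  have h2 := Real.neg_pi_div_two_lt_arctan (Real.log (c * (((0 : ℕ) : ℝ) + 1)))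
  exact (sub_lt_sub h1 h2).le.trans_eq (by ring)

lemma summable_inv_mul_one_add_log_sq {c : ℝ} (hc : 0 < c) :
    Summable fun n : ℕ => (((n : ℝ) + 1) * (1 + Real.log (c * (n + 1)) ^ 2))⁻¹ :=
  summable_of_sum_range_le (fun n => by positivity) (sum_inv_mul_one_add_log_sq_le hc)

lemma tsum_inv_mul_one_add_log_sq_le {c : ℝ} (hc : 0 < c) :
    ∑' n : ℕ, (((n : ℝ) + 1) * (1 + Real.log (c * (n + 1)) ^ 2))⁻¹ ≤ 8 * Real.pi :=
  Real.tsum_le_of_sum_range_le (fun n => by positivity) (sum_inv_mul_one_add_log_sq_le hc)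

/-- The weighted kernel `x² K₀(x)` has bounded variation. -/
lemma exists_abs_sq_mul_kernel_sub_le :
    ∃ C : ℝ, 0 < C ∧ (∀ x : ℝ, 0 < x → |x ^ 2 * moebiusKernel 0 x| ≤ C) ∧
      ∀ x y : ℝ, 0 < x → x ≤ y → |y ^ 2 * moebiusKernel 0 y - x ^ 2 * moebiusKernel 0 x| ≤
        C * (Real.arctan (Real.log y) - Real.arctan (Real.log x)) := by
  obtain ⟨C0, hC0, h0⟩ := exists_moebiusKernel_decay 0 (by norm_num)
  obtain ⟨C1, hC1, h1⟩ := exists_moebiusKernel_decay 1 le_rfl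
  have hlog : ∀ x : ℝ, 1 ≤ 1 + Real.log x ^ 2 := fun x => by nlinarith [sq_nonneg (Real.log x)]
  refine ⟨2 * C0 + C1, by positivity, fun x hx => ?_, fun x y hx hxy => ?_⟩
  · rw [abs_mul, abs_of_pos (by positivity : 0 < x ^ 2)]
    have h2 := h0 x hx
    rw [add_zero] at h2
    have h3 : C0 / (x ^ 2 * (1 + Real.log x ^ 2)) ≤ C0 / (x ^ 2 * 1) := by
      gcongr; exact hlog x
    calc x ^ 2 * |moebiusKernel 0 x| ≤ x ^ 2 * (C0 / (x ^ 2 * 1)) := by gcongr; exact h2.trans h3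
      _ = C0 := by field_simp
      _ ≤ _ := by linarith
  · set C := 2 * C0 + C1 with hC
    have hder : ∀ z : ℝ, 0 < z → HasDerivAt (fun z => z ^ 2 * moebiusKernel 0 z)
        (2 * z * moebiusKernel 0 z + z ^ 2 * -moebiusKernel 1 z) z := fun z hz => by
      have := (hasDerivAt_pow 2 z).mul (hasDerivAt_moebiusKernel hz)
      refine this.congr_deriv ?_
      push_cast; ring
    have hbd : ∀ z : ℝ, 0 < z → |2 * z * moebiusKernel 0 z + z ^ 2 * -moebiusKernel 1 z| ≤
        C * (z * (1 + Real.log z ^ 2))⁻¹ := fun z hz => by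
      have a0 := h0 z hz
      have a1 := h1 z hz
      have hl := (lt_of_lt_of_le one_pos (hlog z))
      calc |2 * z * moebiusKernel 0 z + z ^ 2 * -moebiusKernel 1 z|
          ≤ |2 * z * moebiusKernel 0 z| + |z ^ 2 * -moebiusKernel 1 z| := abs_add_le _ _
        _ = 2 * z * |moebiusKernel 0 z| + z ^ 2 * |moebiusKernel 1 z| := by
            rw [abs_mul, abs_mul (z ^ 2), abs_neg, abs_of_pos (by positivity : 0 < 2 * z),
              abs_of_pos (by positivity : 0 < z ^ 2)]
        _ ≤ 2 * z * (C0 / (z ^ (2 + 0) * (1 + Real.log z ^ 2))) +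
            z ^ 2 * (C1 / (z ^ (2 + 1) * (1 + Real.log z ^ 2))) := by gcongr
        _ = _ := by rw [hC]; field_simp; ring
    have hθ : ∀ z : ℝ, 0 < z → HasDerivAt (fun z => C * Real.arctan (Real.log z))
        (C * (z * (1 + Real.log z ^ 2))⁻¹) z := fun z hz => (hasDerivAt_arctan_log hz).const_mul C
    -- The derivative of x² K₀(x) is dominated by that of C arctan(log x); monotonicity with e = 1
    -- and e = -1 yields the two halves of the absolute value bound.
    have key : ∀ e : ℝ, |e| ≤ 1 → MonotoneOn
        (fun z => C * Real.arctan (Real.log z) + e * (z ^ 2 * moebiusKernel 0 z)) (Icc x y) := by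
      intro e he
      have hd : ∀ z ∈ Icc x y, HasDerivAt
          (fun z => C * Real.arctan (Real.log z) + e * (z ^ 2 * moebiusKernel 0 z))
          (C * (z * (1 + Real.log z ^ 2))⁻¹ +
            e * (2 * z * moebiusKernel 0 z + z ^ 2 * -moebiusKernel 1 z)) z := fun z hz =>
        (hθ z (hx.trans_le hz.1)).add ((hder z (hx.trans_le hz.1)).const_mul e)
      refine monotoneOn_of_deriv_nonneg (convex_Icc x y)
        (fun z hz => (hd z hz).continuousAt.continuousWithinAt)
        (fun z hz => (hd z (interior_subset hz)).differentiableAt.differentiableWithinAt)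
        fun z hz => ?_
      have hz' := interior_subset hz
      rw [(hd z hz').deriv]
      have a := hbd z (hx.trans_le hz'.1)
      have b : |e * (2 * z * moebiusKernel 0 z + z ^ 2 * -moebiusKernel 1 z)| ≤
          C * (z * (1 + Real.log z ^ 2))⁻¹ := by
        rw [abs_mul]; exact (mul_le_of_le_one_left (abs_nonneg _) he).trans a
      linarith [(abs_le.mp b).1]
    have k1 := key 1 (by simp) (left_mem_Icc.mpr hxy) (right_mem_Icc.mpr hxy) hxy
    have k2 := key (-1) (by simp) (left_mem_Icc.mpr hxy) (right_mem_Icc.mpr hxy) hxy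
    simp only [one_mul, neg_mul] at k1 k2
    rw [abs_le]
    constructor <;> linarith

end LatticeLLT

/-! ### Summation of the weighted kernel over the positive integers. -/

namespace LatticeLLT

lemma integrableOn_sq_mul_moebiusKernel :
    IntegrableOn (fun x : ℝ => x ^ 2 * moebiusKernel 0 x) (Ioi 0) := by
  have hcont : ContinuousOn (fun x : ℝ => x ^ 2 * moebiusKernel 0 x) (Ioi 0) :=
    (continuousOn_id.pow 2).mul (continuousOn_moebiusKernel 0)
  obtain ⟨C, hC, hb, -⟩ := exists_abs_sq_mul_kernel_sub_le
  obtain ⟨D, hD, hd⟩ := exists_abs_moebiusKernel_le 0 (β := 4) (by norm_num)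
  rw [← Ioc_union_Ioi_eq_Ioi zero_le_one]
  refine IntegrableOn.union ?_ ?_
  · refine Integrable.mono' (continuous_const (y := C)).integrableOn_Ioc
      ((hcont.mono Ioc_subset_Ioi_self).aestronglyMeasurable measurableSet_Ioc) ?_
    filter_upwards [ae_restrict_mem measurableSet_Ioc] with x hx
    exact hb x hx.1
  · refine Integrable.mono' ((integrableOn_Ioi_rpow_of_lt (a := -2) (by norm_num)
      zero_lt_one).const_mul D) ((hcont.mono (Ioi_subset_Ioi zero_le_one)).aestronglyMeasurable
        measurableSet_Ioi) ?_
    filter_upwards [ae_restrict_mem measurableSet_Ioi] with x hx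
    have hx0 : (0 : ℝ) < x := lt_trans one_pos hx
    rw [norm_mul, Real.norm_of_nonneg (by positivity : 0 ≤ x ^ 2), Real.norm_eq_abs]
    calc x ^ 2 * |moebiusKernel 0 x| ≤ x ^ 2 * (D * x ^ (-(4 + (0 : ℕ)) : ℝ)) := by
          gcongr; exact hd x hx0
      _ = D * (x ^ (2 : ℝ) * x ^ (-4 : ℝ)) := by
          rw [← Real.rpow_natCast]; push_cast; ring_nf
      _ = D * x ^ (-2 : ℝ) := by rw [← Real.rpow_add hx0]; norm_num

lemma summable_sq_mul_moebiusKernel {c : ℝ} (hc : 0 < c) :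
    Summable fun n : ℕ => ((n : ℝ) + 1) ^ 2 * moebiusKernel 0 (c * (n + 1)) := by
  obtain ⟨D, hD, hd⟩ := exists_abs_moebiusKernel_le 0 (β := 4) (by norm_num)
  refine Summable.of_norm_bounded ((summable_rpow_shift (p := 2) (by norm_num)).mul_left
    (D * c ^ (-4 : ℝ))) fun n => ?_
  have hn : (0 : ℝ) < (n : ℝ) + 1 := by positivity
  rw [norm_mul, Real.norm_of_nonneg (by positivity : 0 ≤ ((n : ℝ) + 1) ^ 2), Real.norm_eq_abs]
  calc ((n : ℝ) + 1) ^ 2 * |moebiusKernel 0 (c * (n + 1))|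
      ≤ ((n : ℝ) + 1) ^ 2 * (D * (c * (n + 1)) ^ (-(4 + (0 : ℕ)) : ℝ)) := by
        gcongr; exact hd _ (by positivity)
    _ = D * c ^ (-4 : ℝ) * (((n : ℝ) + 1) ^ (2 : ℝ) * ((n : ℝ) + 1) ^ (-4 : ℝ)) := by
        rw [← Real.rpow_natCast, Real.mul_rpow hc.le hn.le]; push_cast; ring_nf
    _ = _ := by rw [← Real.rpow_add hn]; norm_num

/-- Euler–Maclaurin comparison for the weighted kernel. -/
lemma exists_tsum_sq_mul_kernel_sub_le :
    ∃ C : ℝ, 0 < C ∧ ∀ c : ℝ, 0 < c →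
      |∑' n : ℕ, ((n : ℝ) + 1) ^ 2 * moebiusKernel 0 (c * (n + 1)) -
        ConvexLattice.kappa ^ 3 / c ^ 3| ≤ C / c ^ 2 := by
  obtain ⟨C, hC, hb, hv⟩ := exists_abs_sq_mul_kernel_sub_le
  set H : ℝ → ℝ := fun x => x ^ 2 * moebiusKernel 0 x with hH
  refine ⟨2 * C + C * Real.pi, by positivity, fun c hc => ?_⟩
  have hint : IntegrableOn (fun y => H (c * y)) (Ioi 0) := by
    have := (integrableOn_Ioi_comp_mul_left_iff H 0 hc).mpr (by
      simpa using integrableOn_sq_mul_moebiusKernel)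
    exact this
  have hI : ∫ y in Ioi (0 : ℝ), H (c * y) = c⁻¹ * ConvexLattice.kappa ^ 3 := by
    have := integral_comp_mul_left_Ioi H 0 hc
    rw [this, mul_zero, integral_sq_mul_moebiusKernel, smul_eq_mul]
  have hii : ∀ n : ℕ, IntervalIntegrable (fun y => H (c * y)) volume n (n + 1 : ℕ) := fun n => by
    rw [intervalIntegrable_iff_integrableOn_Ioc_of_le (by push_cast; linarith)]
    exact hint.mono_set fun y hy => lt_of_le_of_lt n.cast_nonneg hy.1
  set S : ℕ → ℝ := fun N => ∑ n ∈ Finset.range N, H (c * (n + 1)) with hS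
  have hcell : ∀ n : ℕ, ∀ E : ℝ, (∀ y ∈ Ioc (n : ℝ) (n + 1), |H (c * (n + 1)) - H (c * y)| ≤ E) →
      |H (c * (n + 1)) - ∫ y in (n : ℝ)..(n + 1 : ℕ), H (c * y)| ≤ E := fun n E hE => by
    have e1 : H (c * (n + 1)) - ∫ y in (n : ℝ)..(n + 1 : ℕ), H (c * y) =
        ∫ y in (n : ℝ)..(n + 1 : ℕ), (H (c * (n + 1)) - H (c * y)) := by
      rw [intervalIntegral.integral_sub (by simp) (hii n), intervalIntegral.integral_const]
      push_cast; simp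
    rw [e1, ← Real.norm_eq_abs]
    have := intervalIntegral.norm_integral_le_of_norm_le_const (a := (n : ℝ)) (b := (n + 1 : ℕ))
      (C := E) (f := fun y => H (c * (n + 1)) - H (c * y)) fun t ht => by
        rw [uIoc_of_le (by push_cast; linarith)] at ht
        exact hE t (by push_cast at ht; exact ht)
    simpa using this
  -- The first cell touches the origin, so only the supremum of H is used there. On the other cells
  -- the variation of H is bounded by increments of θ, which add up to at most C π.
  have hc0 : |H (c * ((0 : ℕ) + 1)) - ∫ y in ((0 : ℕ) : ℝ)..(0 + 1 : ℕ), H (c * y)| ≤ 2 * C := by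
    refine hcell 0 _ fun y hy => ?_
    have hy0 : 0 < y := by simpa using hy.1
    have h1 := hb (c * ((0 : ℕ) + 1)) (by simpa using hc)
    have h2 := hb (c * y) (by positivity)
    exact (abs_sub _ _).trans (by simp only [hH]; linarith)
  set θ : ℕ → ℝ := fun n => Real.arctan (Real.log (c * (n + 1))) with hθ
  have hc1 : ∀ n : ℕ, |H (c * ((n + 1 : ℕ) + 1)) - ∫ y in ((n + 1 : ℕ) : ℝ)..(n + 1 + 1 : ℕ), H (c * y)|
      ≤ C * (θ (n + 1) - θ n) := fun n => by
    refine hcell (n + 1) _ fun y hy => ?_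
    have hn : (0 : ℝ) < (n : ℝ) + 1 := by positivity
    have hy1 : (n : ℝ) + 1 ≤ y := by have := hy.1.le; push_cast at this; exact this
    have hy0 : 0 < y := hn.trans_le hy1
    refine (hv (c * y) _ (by positivity) (by gcongr; exact hy.2)).trans ?_
    have : Real.arctan (Real.log (c * (n + 1))) ≤ Real.arctan (Real.log (c * y)) :=
      Real.arctan_mono (Real.log_le_log (by positivity) (by gcongr))
    simp only [hθ]
    gcongr
  have hpart : ∀ N : ℕ, |S (N + 1) - ∫ y in (0 : ℝ)..(N + 1 : ℕ), H (c * y)| ≤ 2 * C + C * Real.pi := by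
    intro N
    have h1 : ∫ y in (0 : ℝ)..(N + 1 : ℕ), H (c * y) =
        ∑ n ∈ Finset.range (N + 1), ∫ y in (n : ℝ)..(n + 1 : ℕ), H (c * y) := by
      have := intervalIntegral.sum_integral_adjacent_intervals (a := fun k : ℕ => (k : ℝ))
        (n := N + 1) (f := fun y => H (c * y)) (μ := volume) (fun k _ => hii k)
      rw [this]; simp
    rw [h1, hS, ← Finset.sum_sub_distrib, Finset.sum_range_succ']
    refine (abs_add_le _ _).trans ?_
    have h2 := (Finset.abs_sum_le_sum_abs _ _).trans (Finset.sum_le_sum fun n (_ : n ∈ Finset.range N) => hc1 n)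
    rw [← Finset.mul_sum, Finset.sum_range_sub] at h2
    have h3 : θ N - θ 0 ≤ Real.pi := by
      have h1 := Real.arctan_lt_pi_div_two (Real.log (c * ((N : ℝ) + 1)))
      have h2 := Real.neg_pi_div_two_lt_arctan (Real.log (c * (((0 : ℕ) : ℝ) + 1)))
      exact (sub_lt_sub h1 h2).le.trans_eq (by ring)
    have h4 : C * (θ N - θ 0) ≤ C * Real.pi := by gcongr
    linarith
  have hsummH : Summable fun n : ℕ => H (c * (n + 1)) := by
    refine ((summable_sq_mul_moebiusKernel hc).mul_left (c ^ 2)).congr fun n => ?_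
    simp only [hH]; ring
  have hlim1 : Tendsto (fun N => S (N + 1)) atTop (𝓝 (∑' n : ℕ, H (c * (n + 1)))) :=
    (tendsto_add_atTop_iff_nat 1).mpr hsummH.hasSum.tendsto_sum_nat
  have hlim2 : Tendsto (fun N : ℕ => ∫ y in (0 : ℝ)..(N + 1 : ℕ), H (c * y)) atTop
      (𝓝 (c⁻¹ * ConvexLattice.kappa ^ 3)) := by
    rw [← hI]
    exact intervalIntegral_tendsto_integral_Ioi 0 hint
      (tendsto_natCast_atTop_atTop.comp (tendsto_add_atTop_nat 1))
  have hfin := le_of_tendsto (hlim1.sub hlim2).abs (.of_forall hpart)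
  have e1 : ∑' n : ℕ, ((n : ℝ) + 1) ^ 2 * moebiusKernel 0 (c * (n + 1)) =
      (c ^ 2)⁻¹ * ∑' n : ℕ, H (c * (n + 1)) := by
    rw [← tsum_mul_left]
    refine tsum_congr fun n => ?_
    simp only [hH]; field_simp
  have e2 : (c ^ 2)⁻¹ * ∑' n : ℕ, H (c * (n + 1)) - ConvexLattice.kappa ^ 3 / c ^ 3 =
      (c ^ 2)⁻¹ * (∑' n : ℕ, H (c * (n + 1)) - c⁻¹ * ConvexLattice.kappa ^ 3) := by
    field_simp
  rw [e1, e2, abs_mul, abs_of_pos (by positivity : 0 < (c ^ 2)⁻¹), div_eq_inv_mul]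
  gcongr

/-- Uniform decay of the kernels at comparable arguments. -/
lemma exists_kernel_le_of_mem_Icc (j : ℕ) (hj : j ≤ 1) {m M : ℝ} (hm : 0 < m) :
    ∃ C : ℝ, 0 < C ∧ ∀ x φ : ℝ, 0 < x → φ ∈ Icc m M →
      |moebiusKernel j (x * φ)| ≤ C / (x ^ (2 + j) * (1 + Real.log x ^ 2)) := by
  obtain ⟨C, hC, h⟩ := exists_moebiusKernel_decay j hj
  set V : ℝ := Real.log m ^ 2 + Real.log M ^ 2 with hV
  refine ⟨C * (m ^ (2 + j))⁻¹ * (2 * (1 + V)), by positivity, fun x φ hx hφ => ?_⟩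
  have hφ0 : 0 < φ := hm.trans_le hφ.1
  have hlogφ : Real.log φ ^ 2 ≤ V := by
    have h1 := Real.log_le_log hm hφ.1
    have h2 := Real.log_le_log hφ0 hφ.2
    rcases le_total 0 (Real.log φ) with h3 | h3
    · nlinarith [sq_nonneg (Real.log m)]
    · nlinarith [sq_nonneg (Real.log M)]
  refine (h (x * φ) (by positivity)).trans ?_
  rw [Real.log_mul hx.ne' hφ0.ne', mul_pow, div_eq_mul_inv, mul_inv, mul_inv]
  have h3 := inv_one_add_sq_add_le (Real.log x) (Real.log φ)
  have h4 : (φ ^ (2 + j))⁻¹ ≤ (m ^ (2 + j))⁻¹ := by gcongr; exact hφ.1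
  calc C * ((x ^ (2 + j))⁻¹ * (φ ^ (2 + j))⁻¹ * (1 + (Real.log x + Real.log φ) ^ 2)⁻¹)
      ≤ C * ((x ^ (2 + j))⁻¹ * (m ^ (2 + j))⁻¹ * (2 * (1 + V) * (1 + Real.log x ^ 2)⁻¹)) := by
        gcongr
        exact h3.trans (by gcongr)
    _ = _ := by field_simp

end LatticeLLT

namespace LatticeLLT
open ConvexLattice (CoprimePair)

/-! ### Weighted sums over primitive lattice points in a cone -/

/-- The lattice point `y` lies in the cone `a ≤ ρ y₂ / y₁ ≤ b`. -/
def InCone (ρ a b : ℝ) (y : ℕ × ℕ) : Prop :=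
  1 ≤ y.1 ∧ a ≤ ρ * y.2 / y.1 ∧ ρ * y.2 / y.1 ≤ b

open Classical in
/-- The summand of the kernel sum over all lattice points of the cone. -/
noncomputable def coneTerm (Φ ψ : ℝ → ℝ) (ρ α a b : ℝ) (y : ℕ × ℕ) : ℝ :=
  if InCone ρ a b y then
    y.1 * ψ (ρ * y.2 / y.1) * moebiusKernel 0 (α * y.1 * Φ (ρ * y.2 / y.1)) else 0

lemma coneTerm_of_mem {Φ ψ : ℝ → ℝ} {ρ α a b : ℝ} {y : ℕ × ℕ} (h : InCone ρ a b y) :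
    coneTerm Φ ψ ρ α a b y =
      y.1 * ψ (ρ * y.2 / y.1) * moebiusKernel 0 (α * y.1 * Φ (ρ * y.2 / y.1)) := if_pos h

lemma coneTerm_of_not_mem {Φ ψ : ℝ → ℝ} {ρ α a b : ℝ} {y : ℕ × ℕ} (h : ¬ InCone ρ a b y) :
    coneTerm Φ ψ ρ α a b y = 0 := if_neg h

lemma inCone_smul {ρ a b : ℝ} (d : ℕ) (y : ℕ × ℕ) :
    InCone ρ a b ((d + 1) • y) ↔ InCone ρ a b y := by
  have hd : ((d : ℝ) + 1) ≠ 0 := by positivity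
  have e : ρ * (((d + 1) * y.2 : ℕ) : ℝ) / (((d + 1) * y.1 : ℕ) : ℝ) = ρ * y.2 / y.1 := by
    push_cast
    rw [show ρ * (((d : ℝ) + 1) * y.2) = ((d : ℝ) + 1) * (ρ * y.2) by ring,
      mul_div_mul_left _ _ hd]
  have e1 : 1 ≤ (d + 1) * y.1 ↔ 1 ≤ y.1 := by
    constructor
    · intro h
      by_contra h0
      rw [show y.1 = 0 by omega] at h; simp at h
    · intro h; exact Nat.mul_pos (by omega) h
  simp only [InCone, Prod.smul_fst, Prod.smul_snd, smul_eq_mul, e, e1]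

/-- The multiplication map from pairs (primitive vector, multiplier) to lattice points. -/
def primMul (p : CoprimePair × ℕ) : ℕ × ℕ := (p.2 + 1) • (p.1 : ℕ × ℕ)

lemma primMul_injective : Function.Injective primMul := by
  rintro ⟨⟨⟨x1, x2⟩, hx⟩, d⟩ ⟨⟨⟨y1, y2⟩, hy⟩, e⟩ h
  simp only [primMul, Prod.smul_mk, smul_eq_mul, Prod.mk.injEq] at h
  have h1 : Nat.gcd ((d + 1) * x1) ((d + 1) * x2) = d + 1 := by
    rw [Nat.gcd_mul_left, hx, mul_one]
  have h2 : Nat.gcd ((e + 1) * y1) ((e + 1) * y2) = e + 1 := by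
    rw [Nat.gcd_mul_left, hy, mul_one]
  rw [h.1, h.2, h2] at h1
  have hde : d = e := by omega
  subst hde
  have e1 := Nat.eq_of_mul_eq_mul_left (by omega) h.1
  have e2 := Nat.eq_of_mul_eq_mul_left (by omega) h.2
  subst e1; subst e2
  rfl

lemma mem_range_primMul {y : ℕ × ℕ} (hy : y.1 ≠ 0) : y ∈ Set.range primMul := by
  have hg : 0 < Nat.gcd y.1 y.2 := Nat.gcd_pos_of_pos_left _ (Nat.pos_of_ne_zero hy)
  refine ⟨⟨⟨(y.1 / Nat.gcd y.1 y.2, y.2 / Nat.gcd y.1 y.2), Nat.coprime_div_gcd_div_gcd hg⟩,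
    Nat.gcd y.1 y.2 - 1⟩, ?_⟩
  simp only [primMul, Nat.sub_add_cancel hg]
  ext
  · exact Nat.mul_div_cancel' (Nat.gcd_dvd_left _ _)
  · exact Nat.mul_div_cancel' (Nat.gcd_dvd_right _ _)

section
variable {Φ ψ : ℝ → ℝ} {a b m M L : ℝ}

-- Every lattice point of the cone is a multiple d x of a unique primitive x, with the same slope.
-- Along the ray of x, with s = α x₁ Φ, the terms are proportional to d K₀(d s), and
-- `hasSum_mul_moebiusKernel` sums them to 1 / (e^s - 1), the mean of a geometric variable.
open Classical in
lemma hasSum_coprime_of_hasSum_coneTerm {ρ α S : ℝ} (hα : 0 < α) (hm : 0 < m)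
    (hΦ : ∀ t, m ≤ Φ t) (h : HasSum (coneTerm Φ ψ ρ α a b) S) :
    HasSum (fun x : CoprimePair => if InCone ρ a b x.1 then
      x.1.1 * ψ (ρ * x.1.2 / x.1.1) / (Real.exp (α * x.1.1 * Φ (ρ * x.1.2 / x.1.1)) - 1) else 0) S := by
  have h1 : HasSum (coneTerm Φ ψ ρ α a b ∘ primMul) S := by
    refine (Function.Injective.hasSum_iff primMul_injective fun y hy => ?_).mpr h
    refine coneTerm_of_not_mem ?_
    rintro ⟨h1, -⟩
    exact hy (mem_range_primMul (by omega))
  refine h1.prod_fiberwise fun x => ?_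
  by_cases hx : InCone ρ a b x.1
  · rw [if_pos hx]
    have hx1 : (0 : ℝ) < x.1.1 := by exact_mod_cast hx.1
    have hs : 0 < α * x.1.1 * Φ (ρ * x.1.2 / x.1.1) := by
      have := hm.trans_le (hΦ (ρ * x.1.2 / x.1.1)); positivity
    have h2 := (hasSum_mul_moebiusKernel hs).mul_left (x.1.1 * ψ (ρ * x.1.2 / x.1.1))
    rw [mul_one_div] at h2
    refine h2.congr_fun fun d => ?_
    change coneTerm Φ ψ ρ α a b ((d + 1) • (x : ℕ × ℕ)) = _
    rw [coneTerm_of_mem ((inCone_smul d x.1).mpr hx)]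
    have hd : ((d : ℝ) + 1) ≠ 0 := by positivity
    have e : ρ * (((d + 1) * x.1.2 : ℕ) : ℝ) / (((d + 1) * x.1.1 : ℕ) : ℝ) = ρ * x.1.2 / x.1.1 := by
      push_cast
      rw [show ρ * (((d : ℝ) + 1) * x.1.2) = ((d : ℝ) + 1) * (ρ * x.1.2) by ring,
        mul_div_mul_left _ _ hd]
    simp only [Prod.smul_fst, Prod.smul_snd, smul_eq_mul, e]
    push_cast
    rw [show α * (((d : ℝ) + 1) * x.1.1) * Φ (ρ * x.1.2 / x.1.1) =
      ((d : ℝ) + 1) * (α * x.1.1 * Φ (ρ * x.1.2 / x.1.1)) by ring]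
    ring
  · rw [if_neg hx]
    refine hasSum_zero.congr_fun fun d => ?_
    exact coneTerm_of_not_mem fun h => hx ((inCone_smul d x.1).mp h)

/-- The crude kernel bound with β = 4 makes the term O(y₁⁻³). In the cone y₂ is O(y₁), so the power
is split evenly into exponents -3/2 in each coordinate, both of which are summable. -/
lemma summable_coneTerm {ρ α : ℝ} (hρ : 0 < ρ) (hα : 0 < α) (hm : 0 < m) (hb : 0 ≤ b)
    (hΦ : ∀ t, m ≤ Φ t) (hψ : ∀ t, |ψ t| ≤ M) : Summable (coneTerm Φ ψ ρ α a b) := by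
  obtain ⟨D, hD, hd⟩ := exists_abs_moebiusKernel_le 0 (β := 4) (by norm_num)
  have hM : 0 ≤ M := (abs_nonneg _).trans (hψ 0)
  set E : ℝ := M * (D * (α * m) ^ (-4 : ℝ)) * ((2 : ℝ) ^ (3 / 2 : ℝ) * (b / ρ + 1) ^ (3 / 2 : ℝ)) with hE
  refine Summable.of_norm_bounded (((summable_rpow_shift (p := 3 / 2) (by norm_num)).mul_of_nonneg
    (summable_rpow_shift (p := 3 / 2) (by norm_num)) (fun _ => by positivity)
      (fun _ => by positivity)).mul_left E) fun y => ?_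
  rw [coneTerm]
  split_ifs with hy
  swap
  · rw [norm_zero]; positivity
  set t := ρ * y.2 / y.1 with ht
  have hy1 : (1 : ℝ) ≤ y.1 := by exact_mod_cast hy.1
  have hy0 : (0 : ℝ) < y.1 := by linarith
  have hK : |moebiusKernel 0 (α * y.1 * Φ t)| ≤ D * (α * m) ^ (-4 : ℝ) * (y.1 : ℝ) ^ (-4 : ℝ) := by
    have hφ := hΦ t
    refine (hd _ (by have := hm.trans_le hφ; positivity)).trans ?_
    rw [mul_assoc D, ← Real.mul_rpow (by positivity) hy0.le]
    push_cast
    rw [add_zero]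
    refine mul_le_mul_of_nonneg_left ?_ hD.le
    refine Real.rpow_le_rpow_of_nonpos (by positivity) ?_ (by norm_num)
    calc α * m * y.1 = α * y.1 * m := by ring
      _ ≤ _ := by gcongr
  have hy2 : (y.2 : ℝ) + 1 ≤ (b / ρ + 1) * y.1 := by
    have := hy.2.2
    rw [div_le_iff₀ hy0] at this
    have : (y.2 : ℝ) ≤ b / ρ * y.1 := by
      rw [div_mul_eq_mul_div, le_div_iff₀ hρ]; linarith
    linarith
  have hy11 : (y.1 : ℝ) + 1 ≤ 2 * y.1 := by linarith
  have k1 : (y.1 : ℝ) ^ (-(3 / 2) : ℝ) ≤ (2 : ℝ) ^ (3 / 2 : ℝ) * ((y.1 : ℝ) + 1) ^ (-(3 / 2) : ℝ) := by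
    rw [Real.rpow_neg (by positivity), Real.rpow_neg (by positivity), ← div_eq_mul_inv,
      ← Real.div_rpow (by positivity) (by positivity), ← Real.inv_rpow (by positivity)]
    refine Real.rpow_le_rpow (by positivity) ?_ (by norm_num)
    rw [inv_eq_one_div, div_le_div_iff₀ (by positivity) (by positivity)]; linarith
  have k2 : (y.1 : ℝ) ^ (-(3 / 2) : ℝ) ≤ (b / ρ + 1) ^ (3 / 2 : ℝ) * ((y.2 : ℝ) + 1) ^ (-(3 / 2) : ℝ) := by
    rw [Real.rpow_neg (by positivity), Real.rpow_neg (by positivity), ← div_eq_mul_inv,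
      ← Real.div_rpow (by positivity) (by positivity), ← Real.inv_rpow (by positivity)]
    refine Real.rpow_le_rpow (by positivity) ?_ (by norm_num)
    rw [inv_eq_one_div, div_le_div_iff₀ (by positivity) (by positivity)]; linarith
  rw [norm_mul, norm_mul, Real.norm_of_nonneg hy0.le, Real.norm_eq_abs, Real.norm_eq_abs]
  calc (y.1 : ℝ) * |ψ t| * |moebiusKernel 0 (α * y.1 * Φ t)|
      ≤ y.1 * M * (D * (α * m) ^ (-4 : ℝ) * (y.1 : ℝ) ^ (-4 : ℝ)) := by
        gcongr
        exact hψ t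
    _ = M * (D * (α * m) ^ (-4 : ℝ)) * ((y.1 : ℝ) ^ (-(3 / 2) : ℝ) * (y.1 : ℝ) ^ (-(3 / 2) : ℝ)) := by
        rw [← Real.rpow_add hy0]
        have : (y.1 : ℝ) ^ (-(3 / 2) + -(3 / 2) : ℝ) = y.1 * (y.1 : ℝ) ^ (-4 : ℝ) := by
          nth_rewrite 2 [← Real.rpow_one (y.1 : ℝ)]
          rw [← Real.rpow_add hy0]; norm_num
        rw [this]; ring
    _ ≤ M * (D * (α * m) ^ (-4 : ℝ)) * (((2 : ℝ) ^ (3 / 2 : ℝ) * ((y.1 : ℝ) + 1) ^ (-(3 / 2) : ℝ)) *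
          ((b / ρ + 1) ^ (3 / 2 : ℝ) * ((y.2 : ℝ) + 1) ^ (-(3 / 2) : ℝ))) := by
        gcongr
    _ = _ := by rw [hE]; ring

/-- At abscissa n + 1 the slopes of lattice points are the multiples of η = ρ / (n + 1), so the row
is a Riemann sum over [a, b] with mesh η. -/
lemma hasSum_coneTerm_fiber {ρ α : ℝ} (hρ : 0 < ρ) (hb : 0 ≤ b) (n : ℕ) :
    HasSum (fun j : ℕ => coneTerm Φ ψ ρ α a b (n + 1, j))
      ((n + 1) * ∑ j ∈ Finset.Icc ⌈a / (ρ / (n + 1))⌉₊ ⌊b / (ρ / (n + 1))⌋₊,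
        ψ (j * (ρ / (n + 1))) * moebiusKernel 0 (α * (n + 1) * Φ (j * (ρ / (n + 1))))) := by
  have hn : (0 : ℝ) < (n : ℝ) + 1 := by positivity
  have hη : 0 < ρ / ((n : ℝ) + 1) := by positivity
  have hiff : ∀ j : ℕ, InCone ρ a b (n + 1, j) ↔
      j ∈ Finset.Icc ⌈a / (ρ / (n + 1))⌉₊ ⌊b / (ρ / (n + 1))⌋₊ := fun j => by
    rw [Finset.mem_Icc, Nat.ceil_le, Nat.le_floor_iff (by positivity), div_le_iff₀ hη,
      le_div_iff₀ hη]
    simp only [InCone]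
    push_cast
    rw [show ρ * (j : ℝ) / (n + 1) = j * (ρ / (n + 1)) by ring]
    simp
  rw [Finset.mul_sum]
  have : HasSum (fun j : ℕ => coneTerm Φ ψ ρ α a b (n + 1, j))
      (∑ j ∈ Finset.Icc ⌈a / (ρ / (n + 1))⌉₊ ⌊b / (ρ / (n + 1))⌋₊,
        coneTerm Φ ψ ρ α a b (n + 1, j)) :=
    hasSum_sum_of_ne_finset_zero fun j hj => coneTerm_of_not_mem fun h => hj ((hiff j).mp h)
  convert! this using 1
  refine Finset.sum_congr rfl fun j hj => ?_
  rw [coneTerm_of_mem ((hiff j).mpr hj)]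
  push_cast
  rw [show ρ * (j : ℝ) / (n + 1) = j * (ρ / (n + 1)) by ring]
  ring

end

end LatticeLLT

/-! ### Error terms for kernel sums over a cone: rows, main term, and total. -/

namespace LatticeLLT
open ConvexLattice (CoprimePair)

section
variable {Φ ψ : ℝ → ℝ} {a b m M L : ℝ}

lemma abs_moebiusKernel_sub_le {C x u v : ℝ} (hm : 0 < m) (hx : 0 < x) (hu : u ∈ Icc m M)
    (hv : v ∈ Icc m M)
    (hC : ∀ φ ∈ Icc m M, |moebiusKernel 1 (x * φ)| ≤ C) :
    |moebiusKernel 0 (x * u) - moebiusKernel 0 (x * v)| ≤ x * C * |u - v| := by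
  have h := Convex.norm_image_sub_le_of_norm_hasDerivWithin_le (𝕜 := ℝ) (s := Icc m M)
    (f := fun y => moebiusKernel 0 (x * y)) (f' := fun y => -moebiusKernel 1 (x * y) * (x * 1))
    (C := x * C) (x := v) (y := u)
    (fun y hy => ((hasDerivAt_moebiusKernel (mul_pos hx (hm.trans_le hy.1))).comp y
      ((hasDerivAt_id y).const_mul x)).hasDerivWithinAt)
    (fun y hy => by
      rw [norm_mul, norm_neg, mul_one, Real.norm_eq_abs, Real.norm_of_nonneg hx.le, mul_comm]
      exact mul_le_mul_of_nonneg_left (hC y hy) hx.le)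
    (convex_Icc _ _) hv hu
  simpa [Real.norm_eq_abs] using h

lemma continuous_of_abs_sub_le {f : ℝ → ℝ} (hf : ∀ s t, |f s - f t| ≤ L * |s - t|) :
    Continuous f := by
  have hL0 : 0 ≤ L := by simpa using (abs_nonneg _).trans (hf 0 1)
  have : LipschitzWith ⟨L, hL0⟩ f := LipschitzWith.of_dist_le_mul fun s t => by
    rw [Real.dist_eq, Real.dist_eq]; exact hf s t
  exact this.continuous

/-- The asymptotics of the kernel sum over a row of the cone. -/
lemma exists_row_error (hm : 0 < m) (ha : 0 ≤ a) (hab : a ≤ b) (hΦm : ∀ t, m ≤ Φ t)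
    (hΦM : ∀ t, Φ t ≤ M) (hΦL : ∀ s t, |Φ s - Φ t| ≤ L * |s - t|) (hψM : ∀ t, |ψ t| ≤ M)
    (hψL : ∀ s t, |ψ s - ψ t| ≤ L * |s - t|) :
    ∃ C : ℝ, 0 < C ∧ ∀ x η : ℝ, 0 < x → 0 < η →
      |∑ j ∈ Finset.Icc ⌈a / η⌉₊ ⌊b / η⌋₊, ψ (j * η) * moebiusKernel 0 (x * Φ (j * η)) -
        η⁻¹ * ∫ t in a..b, ψ t * moebiusKernel 0 (x * Φ t)| ≤ C / (x ^ 2 * (1 + Real.log x ^ 2)) := by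
  obtain ⟨C0, hC0, h0⟩ := exists_kernel_le_of_mem_Icc 0 (by norm_num) (M := M) hm
  obtain ⟨C1, hC1, h1⟩ := exists_kernel_le_of_mem_Icc 1 le_rfl (M := M) hm
  have hM : 0 ≤ M := (abs_nonneg _).trans (hψM 0)
  have hL : 0 ≤ L := by simpa using (abs_nonneg _).trans (hψL 0 1)
  have hba : 0 ≤ b - a := sub_nonneg.mpr hab
  refine ⟨3 * (M * C0) + (L * C0 + M * (L * C1)) * (b - a) + 1, by positivity,
    fun x η hx hη => ?_⟩
  have hΦI : ∀ t, Φ t ∈ Icc m M := fun t => ⟨hΦm t, hΦM t⟩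
  set W : ℝ := x ^ 2 * (1 + Real.log x ^ 2) with hW
  have hW0 : 0 < W := by positivity
  have k0 : ∀ t, |moebiusKernel 0 (x * Φ t)| ≤ C0 / W := fun t => by
    simpa using h0 x (Φ t) hx (hΦI t)
  -- The kernel K₁ decays by one power faster than K₀. This absorbs the factor x from
  -- differentiating K₀(x Φ), so the Lipschitz constant of the row function has the same order 1/W
  -- as its supremum.
  have k1 : ∀ φ ∈ Icc m M, |moebiusKernel 1 (x * φ)| ≤ C1 / (x * W) := fun φ hφ => by
    refine (h1 x φ hx hφ).trans (le_of_eq ?_)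
    rw [hW]; ring
  have h := abs_sum_sub_integral_le (G := fun t => ψ t * moebiusKernel 0 (x * Φ t))
    (B := M * (C0 / W)) (L := (L * C0 + M * (L * C1)) / W) ha hab hη
    (fun t => by
      rw [abs_mul]
      exact mul_le_mul (hψM t) (k0 t) (abs_nonneg _) hM)
    (fun s t => by
      have e : ψ s * moebiusKernel 0 (x * Φ s) - ψ t * moebiusKernel 0 (x * Φ t) =
          (ψ s - ψ t) * moebiusKernel 0 (x * Φ s) +
            ψ t * (moebiusKernel 0 (x * Φ s) - moebiusKernel 0 (x * Φ t)) := by ring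
      have e2 := abs_moebiusKernel_sub_le hm hx (hΦI s) (hΦI t) k1
      rw [e]
      refine (abs_add_le _ _).trans ?_
      rw [abs_mul, abs_mul]
      calc |ψ s - ψ t| * |moebiusKernel 0 (x * Φ s)| +
            |ψ t| * |moebiusKernel 0 (x * Φ s) - moebiusKernel 0 (x * Φ t)|
          ≤ (L * |s - t|) * (C0 / W) + M * (x * (C1 / (x * W)) * (L * |s - t|)) := by
            gcongr
            · exact hψL s t
            · exact k0 s
            · exact hψM t
            · exact e2.trans (by gcongr; exact hΦL s t)
        _ = _ := by field_simp)
  refine h.trans ?_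
  have : 3 * (M * (C0 / W)) + (L * C0 + M * (L * C1)) / W * (b - a) =
      (3 * (M * C0) + (L * C0 + M * (L * C1)) * (b - a)) / W := by ring
  rw [this]
  exact div_le_div_of_nonneg_right (by linarith) hW0.le

/-- The main term: integration of the one-dimensional asymptotics over the slopes. -/
lemma exists_main_error (hm : 0 < m) (hab : a ≤ b) (hΦm : ∀ t, m ≤ Φ t)
    (hΦL : ∀ s t, |Φ s - Φ t| ≤ L * |s - t|) (hψM : ∀ t, |ψ t| ≤ M)
    (hψL : ∀ s t, |ψ s - ψ t| ≤ L * |s - t|) :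
    ∃ C : ℝ, 0 < C ∧ ∀ α : ℝ, 0 < α → ∃ S : ℝ,
      HasSum (fun n : ℕ => ((n : ℝ) + 1) ^ 2 *
        ∫ t in a..b, ψ t * moebiusKernel 0 (α * (n + 1) * Φ t)) S ∧
      |S - ConvexLattice.kappa ^ 3 / α ^ 3 * ∫ t in a..b, ψ t / Φ t ^ 3| ≤ C / α ^ 2 := by
  obtain ⟨C0, hC0, h0⟩ := exists_tsum_sq_mul_kernel_sub_le
  obtain ⟨D, hD, hd⟩ := exists_abs_moebiusKernel_le 0 (β := 4) (by norm_num)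
  have hM : 0 ≤ M := (abs_nonneg _).trans (hψM 0)
  have hba : 0 ≤ b - a := sub_nonneg.mpr hab
  have hΦc := continuous_of_abs_sub_le hΦL
  have hψc := continuous_of_abs_sub_le hψL
  have hΦ0 : ∀ t, 0 < Φ t := fun t => hm.trans_le (hΦm t)
  refine ⟨M * (C0 / m ^ 2) * (b - a) + 1, by positivity, fun α hα => ?_⟩
  have hKc : ∀ n : ℕ, Continuous fun t => moebiusKernel 0 (α * (n + 1) * Φ t) := fun n =>
    (continuousOn_moebiusKernel 0).comp_continuous (continuous_const.mul hΦc) fun t => by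
      have := hΦ0 t
      have : 0 < α * ((n : ℝ) + 1) * Φ t := by positivity
      exact this
  set F : ℕ → ℝ → ℝ := fun n t => ψ t * (((n : ℝ) + 1) ^ 2 * moebiusKernel 0 (α * (n + 1) * Φ t))
    with hF
  -- For each slope t this is the one-dimensional sum at scale c = α Φ(t), equal to κ³/c³ up to
  -- O(c⁻²) uniformly in t.
  set G : ℝ → ℝ := fun t => ψ t * ∑' n : ℕ, ((n : ℝ) + 1) ^ 2 * moebiusKernel 0 (α * Φ t * (n + 1))
    with hG
  have hFG : ∀ t, HasSum (fun n => F n t) (G t) := fun t => by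
    have := (summable_sq_mul_moebiusKernel (mul_pos hα (hΦ0 t))).hasSum.mul_left (ψ t)
    refine this.congr_fun fun n => ?_
    simp only [hF]
    rw [show α * ((n : ℝ) + 1) * Φ t = α * Φ t * (n + 1) by ring]
  have hFb : ∀ n t, |F n t| ≤ M * (D * (α * m) ^ (-4 : ℝ)) * ((n : ℝ) + 1) ^ (-2 : ℝ) := fun n t => by
    have hn : (0 : ℝ) < (n : ℝ) + 1 := by positivity
    have hφ := hΦ0 t
    simp only [hF]
    rw [abs_mul, abs_mul, abs_of_pos (by positivity : 0 < ((n : ℝ) + 1) ^ 2)]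
    calc |ψ t| * (((n : ℝ) + 1) ^ 2 * |moebiusKernel 0 (α * (n + 1) * Φ t)|)
        ≤ M * (((n : ℝ) + 1) ^ 2 * (D * ((α * m) * (n + 1)) ^ (-4 : ℝ))) := by
          gcongr
          · exact hψM t
          · refine (hd _ (by positivity)).trans ?_
            push_cast
            rw [add_zero]
            refine mul_le_mul_of_nonneg_left ?_ hD.le
            refine Real.rpow_le_rpow_of_nonpos (by positivity) ?_ (by norm_num)
            calc α * m * ((n : ℝ) + 1) = α * (n + 1) * m := by ring
              _ ≤ _ := by gcongr; exact hΦm t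
      _ = M * (D * (α * m) ^ (-4 : ℝ)) * (((n : ℝ) + 1) ^ (2 : ℝ) * ((n : ℝ) + 1) ^ (-4 : ℝ)) := by
          rw [Real.mul_rpow (by positivity) hn.le]
          norm_cast
          ring
      _ = _ := by rw [← Real.rpow_add hn]; norm_num
  have hFc : ∀ n, Continuous (F n) := fun n => hψc.mul (continuous_const.mul (hKc n))
  have hbs : Summable fun n : ℕ => M * (D * (α * m) ^ (-4 : ℝ)) * ((n : ℝ) + 1) ^ (-2 : ℝ) :=
    (summable_rpow_shift (p := 2) (by norm_num)).mul_left _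
  have hGc : Continuous G := by
    have : Continuous fun t => ∑' n, F n t :=
      continuous_tsum hFc hbs fun n t => by rw [Real.norm_eq_abs]; exact hFb n t
    exact this.congr fun t => (hFG t).tsum_eq
  have hsum : HasSum (fun n : ℕ => ∫ t in a..b, F n t) (∫ t in a..b, G t) := by
    refine intervalIntegral.hasSum_integral_of_dominated_convergence
      (bound := fun n _ => M * (D * (α * m) ^ (-4 : ℝ)) * ((n : ℝ) + 1) ^ (-2 : ℝ))
      (fun n => (hFc n).aestronglyMeasurable) (fun n => .of_forall fun t _ => hFb n t)
      (.of_forall fun t _ => hbs) (by simp) (.of_forall fun t _ => hFG t)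
  refine ⟨∫ t in a..b, G t, ?_, ?_⟩
  · refine hsum.congr_fun fun n => ?_
    rw [← intervalIntegral.integral_const_mul]
    refine intervalIntegral.integral_congr fun t _ => ?_
    simp only [hF]; ring
  · have hRc : Continuous fun t => ψ t / Φ t ^ 3 :=
      hψc.div (hΦc.pow 3) fun t => (pow_pos (hΦ0 t) 3).ne'
    have hRc' : Continuous fun t => ConvexLattice.kappa ^ 3 / α ^ 3 * (ψ t / Φ t ^ 3) :=
      continuous_const.mul hRc
    rw [← intervalIntegral.integral_const_mul, ← intervalIntegral.integral_sub
      (hGc.intervalIntegrable _ _) (hRc'.intervalIntegrable _ _),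
      ← Real.norm_eq_abs]
    refine (intervalIntegral.norm_integral_le_of_norm_le_const (C := M * (C0 / m ^ 2) / α ^ 2)
      fun t _ => ?_).trans ?_
    · have hφ := hΦ0 t
      have h1 := h0 (α * Φ t) (by positivity)
      have e : G t - ConvexLattice.kappa ^ 3 / α ^ 3 * (ψ t / Φ t ^ 3) =
          ψ t * (∑' n : ℕ, ((n : ℝ) + 1) ^ 2 * moebiusKernel 0 (α * Φ t * (n + 1)) -
            ConvexLattice.kappa ^ 3 / (α * Φ t) ^ 3) := by
        simp only [hG]
        rw [mul_sub, mul_pow]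
        congr 1
        field_simp
      rw [e, norm_mul, Real.norm_eq_abs, Real.norm_eq_abs]
      calc |ψ t| * _ ≤ M * (C0 / (α * m) ^ 2) := by
            gcongr
            · exact hψM t
            · exact h1.trans (by gcongr; exact hΦm t)
        _ = _ := by field_simp
    · rw [abs_of_nonneg hba]
      have : M * (C0 / m ^ 2) / α ^ 2 * (b - a) = M * (C0 / m ^ 2) * (b - a) / α ^ 2 := by ring
      rw [this]
      exact div_le_div_of_nonneg_right (by linarith) (by positivity)

open Classical in
/-- Asymptotics of weighted sums over primitive vectors of a cone, with the error `O(α⁻²)`. -/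
theorem exists_primitive_sum_error (hm : 0 < m) (ha : 0 ≤ a) (hab : a ≤ b) (hΦm : ∀ t, m ≤ Φ t)
    (hΦM : ∀ t, Φ t ≤ M) (hΦL : ∀ s t, |Φ s - Φ t| ≤ L * |s - t|) (hψM : ∀ t, |ψ t| ≤ M)
    (hψL : ∀ s t, |ψ s - ψ t| ≤ L * |s - t|) :
    ∃ C : ℝ, 0 < C ∧ ∀ ρ α : ℝ, 1 / 2 ≤ ρ → 0 < α → ∃ S : ℝ,
      HasSum (fun x : CoprimePair => if InCone ρ a b x.1 then x.1.1 * ψ (ρ * x.1.2 / x.1.1) /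
        (Real.exp (α * x.1.1 * Φ (ρ * x.1.2 / x.1.1)) - 1) else 0) S ∧
      |S - ConvexLattice.kappa ^ 3 / (ρ * α ^ 3) * ∫ t in a..b, ψ t / Φ t ^ 3| ≤ C / α ^ 2 := by
  obtain ⟨C1, hC1, h1⟩ := exists_row_error hm ha hab hΦm hΦM hΦL hψM hψL
  obtain ⟨C2, hC2, h2⟩ := exists_main_error hm hab hΦm hΦL hψM hψL
  refine ⟨C1 * (8 * Real.pi) + 2 * C2, by positivity, fun ρ α hρ hα => ?_⟩
  have hρ0 : 0 < ρ := by linarith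
  have hb : 0 ≤ b := ha.trans hab
  have hT := (summable_coneTerm (a := a) (M := M) hρ0 hα hm hb hΦm hψM).hasSum
  set S := ∑' y, coneTerm Φ ψ ρ α a b y with hS
  refine ⟨S, hasSum_coprime_of_hasSum_coneTerm hα hm hΦm hT, ?_⟩
  obtain ⟨S2, hS2, hE2⟩ := h2 α hα
  set R : ℕ → ℝ := fun n => ((n : ℝ) + 1) * ∑ j ∈ Finset.Icc ⌈a / (ρ / (n + 1))⌉₊ ⌊b / (ρ / (n + 1))⌋₊,
        ψ (j * (ρ / (n + 1))) * moebiusKernel 0 (α * (n + 1) * Φ (j * (ρ / (n + 1)))) with hR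
  have hrow0 : HasSum (fun j : ℕ => coneTerm Φ ψ ρ α a b (0, j)) 0 :=
    hasSum_zero.congr_fun fun j => coneTerm_of_not_mem fun h => by simpa using h.1
  -- The row of abscissa 0 lies outside the cone; R n stands for the row of abscissa n + 1.
  have hrows : HasSum (fun n : ℕ => if n = 0 then (0 : ℝ) else R (n - 1)) S := by
    refine hT.prod_fiberwise fun n => ?_
    rcases n with _ | n
    · exact hrow0
    · simpa using hasSum_coneTerm_fiber hρ0 hb n
  have hRsum : HasSum R S := by
    have := (hasSum_nat_add_iff' 1).mpr hrows
    simpa using this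
  set I : ℕ → ℝ := fun n => ((n : ℝ) + 1) ^ 2 *
        ∫ t in a..b, ψ t * moebiusKernel 0 (α * (n + 1) * Φ t) with hI
  -- Here the logarithmic gain is spent: without it the right side would be a multiple of 1/(n + 1),
  -- and the sum over n would diverge.
  have hterm : ∀ n, |R n - ρ⁻¹ * I n| ≤
      C1 / α ^ 2 * (((n : ℝ) + 1) * (1 + Real.log (α * (n + 1)) ^ 2))⁻¹ := fun n => by
    have hn : (0 : ℝ) < (n : ℝ) + 1 := by positivity
    have h3 := h1 (α * (n + 1)) (ρ / (n + 1)) (by positivity) (by positivity)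
    have e : R n - ρ⁻¹ * I n = ((n : ℝ) + 1) *
        (∑ j ∈ Finset.Icc ⌈a / (ρ / (n + 1))⌉₊ ⌊b / (ρ / (n + 1))⌋₊,
          ψ (j * (ρ / (n + 1))) * moebiusKernel 0 (α * (n + 1) * Φ (j * (ρ / (n + 1)))) -
        (ρ / (n + 1))⁻¹ * ∫ t in a..b, ψ t * moebiusKernel 0 (α * (n + 1) * Φ t)) := by
      simp only [hR, hI, inv_div]; field_simp
    rw [e, abs_mul, abs_of_pos hn]
    calc ((n : ℝ) + 1) * _ ≤ ((n : ℝ) + 1) *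
          (C1 / ((α * (n + 1)) ^ 2 * (1 + Real.log (α * (n + 1)) ^ 2))) := by gcongr
      _ = _ := by field_simp
  have hdiff := hRsum.sub (hS2.mul_left ρ⁻¹)
  have hbnd : |S - ρ⁻¹ * S2| ≤ C1 / α ^ 2 * (8 * Real.pi) := by
    rw [← hdiff.tsum_eq, ← Real.norm_eq_abs]
    refine (tsum_of_norm_bounded ((summable_inv_mul_one_add_log_sq hα).mul_left
      (C1 / α ^ 2)).hasSum fun n => hterm n).trans ?_
    rw [tsum_mul_left]
    gcongr
    exact tsum_inv_mul_one_add_log_sq_le hα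
  have e : S - ConvexLattice.kappa ^ 3 / (ρ * α ^ 3) * ∫ t in a..b, ψ t / Φ t ^ 3 =
      (S - ρ⁻¹ * S2) + ρ⁻¹ * (S2 - ConvexLattice.kappa ^ 3 / α ^ 3 * ∫ t in a..b, ψ t / Φ t ^ 3) := by
    field_simp; ring
  rw [e]
  refine (abs_add_le _ _).trans ?_
  rw [abs_mul, abs_of_pos (inv_pos.mpr hρ0)]
  have hρ2 : ρ⁻¹ ≤ 2 := by rw [inv_le_comm₀ hρ0 (by norm_num)]; linarith
  calc _ ≤ C1 / α ^ 2 * (8 * Real.pi) + 2 * (C2 / α ^ 2) := by gcongr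
    _ = _ := by ring

end

end LatticeLLT

namespace LatticeLLT

/-! ### Characteristic functions of geometric random variables -/

/-- The characteristic function of a geometric variable with ratio `z`. -/
noncomputable def geomChar (z θ : ℝ) : ℂ := (1 - z) / (1 - z * Complex.exp (θ * Complex.I))

/-- The mean of a geometric variable with ratio `z`. -/
noncomputable def geomMean (z : ℝ) : ℝ := z / (1 - z)

lemma geomMean_nonneg {z : ℝ} (h0 : 0 ≤ z) (h1 : z < 1) : 0 ≤ geomMean z :=
  div_nonneg h0 (by linarith)

lemma geomChar_eq {z : ℝ} (h1 : z < 1) (θ : ℝ) :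
    geomChar z θ = 1 / (1 - geomMean z * (Complex.exp (θ * Complex.I) - 1)) := by
  have h : (1 - z : ℂ) ≠ 0 := by
    have : (1 - z : ℝ) ≠ 0 := by linarith
    exact_mod_cast this
  rw [geomChar, geomMean]
  push_cast
  have : (1 - (z : ℂ) / (1 - z) * (Complex.exp (θ * Complex.I) - 1)) =
      (1 - z * Complex.exp (θ * Complex.I)) / (1 - z) := by
    field_simp; ring
  rw [this, one_div_div]

/-- In terms of the mean q, the variance q (1 + q) appears as the coefficient of 1 - cos θ. -/
lemma normSq_one_sub_geomMean_mul (q θ : ℝ) :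
    ‖(1 - q * (Complex.exp (θ * Complex.I) - 1) : ℂ)‖ ^ 2 =
      1 + 2 * (q * (1 + q)) * (1 - Real.cos θ) := by
  have h : (1 - q * (Complex.exp (θ * Complex.I) - 1) : ℂ) =
      ((1 + q * (1 - Real.cos θ) : ℝ) : ℂ) + ((-(q * Real.sin θ) : ℝ) : ℂ) * Complex.I := by
    rw [Complex.exp_mul_I, ← Complex.ofReal_cos, ← Complex.ofReal_sin]
    push_cast; ring
  rw [h, Complex.sq_norm, Complex.normSq_add_mul_I]
  linear_combination q ^ 2 * Real.sin_sq_add_cos_sq θ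

lemma le_geomMean {z : ℝ} (h0 : 0 ≤ z) (h1 : z < 1) : z ≤ geomMean z := by
  rw [geomMean, le_div_iff₀ (by linarith)]; nlinarith

lemma norm_geomChar_sq {z : ℝ} (h1 : z < 1) (θ : ℝ) :
    ‖geomChar z θ‖ ^ 2 = (1 + 2 * (geomMean z * (1 + geomMean z)) * (1 - Real.cos θ))⁻¹ := by
  rw [geomChar_eq h1, norm_div, norm_one, div_pow, normSq_one_sub_geomMean_mul, one_pow, one_div]

lemma norm_geomChar_le {z : ℝ} (h0 : 0 ≤ z) (h1 : z < 1) (θ : ℝ) :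
    ‖geomChar z θ‖ ≤ Real.exp (-(z * (1 - Real.cos θ) / 5)) := by
  refine le_of_pow_le_pow_left₀ two_ne_zero (Real.exp_pos _).le ?_
  have hc0 : 0 ≤ 1 - Real.cos θ := by linarith [Real.cos_le_one θ]
  have hc2 : 1 - Real.cos θ ≤ 2 := by linarith [Real.neg_one_le_cos θ]
  have hq := le_geomMean h0 h1
  have hq2 : z ≤ geomMean z * (1 + geomMean z) := by nlinarith
  set c := 1 - Real.cos θ
  have hzc : 0 ≤ z * c := mul_nonneg h0 hc0
  have hzc2 : z * c ≤ 2 := by nlinarith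
  rw [norm_geomChar_sq h1, ← Real.exp_nat_mul]
  calc (1 + 2 * (geomMean z * (1 + geomMean z)) * c)⁻¹ ≤ (1 + 2 * z * c)⁻¹ := by
        gcongr
    -- For 0 ≤ y ≤ 2 one has (1 + 2y)(1 - 2y/5) = 1 + (4y/5)(2 - y) ≥ 1; the range of y = z c
    -- dictates the constant 5.
    _ ≤ 1 - 2 * (z * c) / 5 := by
        rw [inv_le_iff_one_le_mul₀ (by nlinarith)]
        nlinarith
    _ ≤ Real.exp (-(2 * (z * c) / 5)) := by linarith [Real.add_one_le_exp (-(2 * (z * c) / 5))]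
    _ = _ := by congr 1; push_cast; ring

lemma norm_geomChar_le_one {z : ℝ} (h0 : 0 ≤ z) (h1 : z < 1) (θ : ℝ) : ‖geomChar z θ‖ ≤ 1 := by
  refine (norm_geomChar_le h0 h1 θ).trans (Real.exp_le_one_iff.mpr ?_)
  have := Real.cos_le_one θ
  have : 0 ≤ z * (1 - Real.cos θ) := mul_nonneg h0 (by linarith)
  linarith

lemma norm_exp_mul_I_sub_one_le (θ : ℝ) : ‖Complex.exp (θ * Complex.I) - 1‖ ≤ |θ| := by
  have := Real.norm_exp_I_mul_ofReal_sub_one_le (x := θ)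
  rwa [mul_comm, Real.norm_eq_abs] at this

/-- Taylor expansion of -log(1 - q(e^{iθ} - 1)): after centring, the quadratic part is -q(1 +
q)θ²/2, and the remainder r is at most q(1 + q)²|θ|³. Smallness of |θ|(1 + q) keeps the logarithm in
its disc of convergence and r at most 1. -/
lemma norm_geomChar_sub_gaussian_le_of_small {z : ℝ} (h0 : 0 ≤ z) (h1 : z < 1) {θ : ℝ}
    (hθ : |θ| * (1 + geomMean z) ≤ 1 / 4) :
    ‖geomChar z θ * Complex.exp (-(geomMean z * θ : ℝ) * Complex.I) -
      (Real.exp (-(geomMean z * (1 + geomMean z) * θ ^ 2 / 2)) : ℝ)‖ ≤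
      2 * (geomMean z * (1 + geomMean z) ^ 2 * |θ| ^ 3) := by
  set q := geomMean z with hq
  have hq0 : 0 ≤ q := geomMean_nonneg h0 h1
  have hθ0 := abs_nonneg θ
  have hθ1 : |θ| ≤ 1 / 4 := by nlinarith
  have hqθ : q * |θ| ≤ 1 / 4 := by nlinarith
  set e : ℂ := Complex.exp (θ * Complex.I) - 1 with he
  set w : ℂ := q * e with hw
  set x : ℂ := θ * Complex.I with hx
  have hxn : ‖x‖ = |θ| := by simp [hx]
  have he1 : ‖e‖ ≤ |θ| := norm_exp_mul_I_sub_one_le θ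
  have hwn : ‖w‖ ≤ q * |θ| := by
    rw [hw, norm_mul, Complex.norm_real, Real.norm_of_nonneg hq0]; gcongr
  have hwlt : ‖-w‖ < 1 := by rw [norm_neg]; linarith
  have b3 : ‖e - x - x ^ 2 / 2‖ ≤ |θ| ^ 3 * (2 / 9) := by
    have := Complex.exp_bound (x := x) (by rw [hxn]; linarith) (n := 3) (by norm_num)
    rw [hxn] at this
    simp only [Finset.sum_range_succ, Finset.sum_range_zero] at this
    norm_num [Nat.factorial] at this
    convert this using 2
    rw [he]; ring
  have b2 : ‖e - x‖ ≤ |θ| ^ 2 * (3 / 4) := by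
    have := Complex.exp_bound (x := x) (by rw [hxn]; linarith) (n := 2) (by norm_num)
    rw [hxn] at this
    simp only [Finset.sum_range_succ, Finset.sum_range_zero] at this
    norm_num [Nat.factorial] at this
    rw [← sq_abs] at this
    convert this using 2
    rw [he]; ring
  have hlog : ‖Complex.log (1 + -w) - (-w - w ^ 2 / 2)‖ ≤ ‖w‖ ^ 3 := by
    have := Complex.norm_log_sub_logTaylor_le 2 hwlt
    have e1 : Complex.logTaylor 3 (-w) = -w - w ^ 2 / 2 := by
      simp [Complex.logTaylor, Finset.sum_range_succ]; ring
    rw [e1, norm_neg] at this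
    refine this.trans ?_
    have h4 : (1 - ‖w‖)⁻¹ ≤ 3 := by
      rw [inv_le_comm₀ (by linarith) (by norm_num)]; linarith
    push_cast
    have h5 : 0 ≤ ‖w‖ ^ (2 + 1) := by positivity
    rw [div_le_iff₀ (by norm_num)]
    refine (mul_le_mul_of_nonneg_left h4 h5).trans (le_of_eq ?_)
    norm_num
  have hne : (1 - w : ℂ) ≠ 0 := by
    intro h
    have : w = 1 := by linear_combination -h
    rw [this, norm_neg, norm_one] at hwlt
    linarith
  set v : ℝ := q * (1 + q) * θ ^ 2 / 2 with hv
  set r : ℂ := -Complex.log (1 + -w) - q * x + v with hr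
  set Δ : ℝ := q * (1 + q) ^ 2 * |θ| ^ 3 with hΔ
  have hrn : ‖r‖ ≤ Δ := by
    have hx2 : x ^ 2 = -(θ : ℂ) ^ 2 := by rw [hx, mul_pow, Complex.I_sq]; ring
    have hvx : (v : ℂ) = -(q * (1 + q) * x ^ 2 / 2) := by
      rw [hx2, hv]; push_cast; ring
    have e1 : r = -(Complex.log (1 + -w) - (-w - w ^ 2 / 2)) + q * (e - x - x ^ 2 / 2) +
        q ^ 2 / 2 * ((e - x) * (e + x)) := by
      rw [hr, hvx, hw]; ring
    rw [e1]
    have n1 : ‖(q : ℂ)‖ = q := by rw [Complex.norm_real, Real.norm_of_nonneg hq0]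
    calc _ ≤ ‖w‖ ^ 3 + q * (|θ| ^ 3 * (2 / 9)) + q ^ 2 / 2 * ((|θ| ^ 2 * (3 / 4)) * (|θ| + |θ|)) := by
          refine (norm_add_le _ _).trans (add_le_add ((norm_add_le _ _).trans (add_le_add ?_ ?_)) ?_)
          · rw [norm_neg]; exact hlog
          · rw [norm_mul, n1]; gcongr
          · have n2 : ‖(q : ℂ) ^ 2 / 2‖ = q ^ 2 / 2 := by
              rw [norm_div, norm_pow, n1, Complex.norm_ofNat]
            rw [norm_mul, norm_mul, n2]
            gcongr
            exact (norm_add_le _ _).trans (by rw [hxn]; gcongr)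
      _ ≤ (q * |θ|) ^ 3 + q * (|θ| ^ 3 * (2 / 9)) + q ^ 2 / 2 * ((|θ| ^ 2 * (3 / 4)) * (|θ| + |θ|)) := by
          gcongr
      _ = |θ| ^ 3 * (q ^ 3 + q * (2 / 9) + q ^ 2 * (3 / 4)) := by ring
      _ ≤ |θ| ^ 3 * (q * (1 + q) ^ 2) := by
          gcongr
          nlinarith [sq_nonneg q]
      _ = Δ := by rw [hΔ]; ring
  have hΔ1 : Δ ≤ 1 := by
    have : Δ = (q * |θ|) * (|θ| * (1 + q)) ^ 2 := by rw [hΔ]; ring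
    rw [this]
    have h3 : (|θ| * (1 + q)) ^ 2 ≤ 1 := by
      apply pow_le_one₀ (by positivity); linarith
    nlinarith [mul_nonneg hq0 hθ0]
  have hexp : geomChar z θ * Complex.exp (-(q * θ : ℝ) * Complex.I) =
      Complex.exp (-(v : ℂ)) * Complex.exp r := by
    rw [geomChar_eq h1, ← Complex.exp_add, hr]
    rw [show -(v : ℂ) + (-Complex.log (1 + -w) - q * x + v) = -Complex.log (1 + -w) + -(q * x) by ring,
      Complex.exp_add, Complex.exp_neg (Complex.log _), Complex.exp_log (by
        rw [← sub_eq_add_neg]; exact hne)]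
    rw [one_div, ← hq, ← he, ← hw, ← sub_eq_add_neg]
    congr 2
    rw [hx]; push_cast; ring
  have hev : ((Real.exp (-v) : ℝ) : ℂ) = Complex.exp (-(v : ℂ)) := by push_cast; rfl
  rw [hexp, hev]
  have : Complex.exp (-(v : ℂ)) * Complex.exp r - Complex.exp (-(v : ℂ)) =
      Complex.exp (-(v : ℂ)) * (Complex.exp r - 1) := by ring
  rw [this, norm_mul]
  have hv0 : 0 ≤ v := by positivity
  have n1 : ‖Complex.exp (-(v : ℂ))‖ ≤ 1 := by
    rw [← hev, Complex.norm_real, Real.norm_of_nonneg (Real.exp_pos _).le]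
    exact Real.exp_le_one_iff.mpr (by linarith)
  have n2 : ‖Complex.exp r - 1‖ ≤ 2 * ‖r‖ := Complex.norm_exp_sub_one_le (hrn.trans hΔ1)
  calc _ ≤ 1 * (2 * Δ) := by gcongr; exact n2.trans (by gcongr)
    _ = _ := one_mul _

/-- Outside the range of the Taylor expansion, |θ|(1 + q) is at least 1/4, and first-order bounds on
the three factors are already dominated by the cubic term. -/
lemma norm_geomChar_sub_gaussian_le {z : ℝ} (h0 : 0 ≤ z) (h1 : z < 1) (θ : ℝ) :
    ‖geomChar z θ * Complex.exp (-(geomMean z * θ : ℝ) * Complex.I) -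
      (Real.exp (-(geomMean z * (1 + geomMean z) * θ ^ 2 / 2)) : ℝ)‖ ≤
      34 * (geomMean z * (1 + geomMean z) ^ 2 * |θ| ^ 3) := by
  set q := geomMean z with hq
  have hq0 : 0 ≤ q := geomMean_nonneg h0 h1
  have hθ0 := abs_nonneg θ
  rcases le_total (|θ| * (1 + q)) (1 / 4) with h | h
  · refine (norm_geomChar_sub_gaussian_le_of_small h0 h1 h).trans ?_
    gcongr
    norm_num
  set v : ℝ := q * (1 + q) * θ ^ 2 / 2 with hv
  have hv0 : 0 ≤ v := by positivity
  set E : ℂ := Complex.exp (-(q * θ : ℝ) * Complex.I) with hE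
  have hEn : ‖E‖ = 1 := by
    rw [hE, show (-((q * θ : ℝ) : ℂ)) = ((-(q * θ) : ℝ) : ℂ) by push_cast; ring,
      Complex.norm_exp_ofReal_mul_I]
  have hφ1 := norm_geomChar_le_one h0 h1 θ
  have hφ : ‖geomChar z θ - 1‖ ≤ q * |θ| := by
    have hne : (1 - q * (Complex.exp (θ * Complex.I) - 1) : ℂ) ≠ 0 := by
      intro h
      have h2 := normSq_one_sub_geomMean_mul q θ
      rw [h, norm_zero] at h2
      have := Real.cos_le_one θ
      have : 0 ≤ 2 * (q * (1 + q)) * (1 - Real.cos θ) := mul_nonneg (by positivity) (by linarith)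
      norm_num at h2; linarith
    have : geomChar z θ - 1 = geomChar z θ * (q * (Complex.exp (θ * Complex.I) - 1)) := by
      rw [geomChar_eq h1, ← hq]; field_simp; ring
    rw [this, norm_mul, norm_mul, Complex.norm_real, Real.norm_of_nonneg hq0]
    calc _ ≤ 1 * (q * |θ|) := by gcongr; exact norm_exp_mul_I_sub_one_le θ
      _ = _ := one_mul _
  have hE1 : ‖E - 1‖ ≤ q * |θ| := by
    have := norm_exp_mul_I_sub_one_le (-(q * θ))
    rw [abs_neg, abs_mul, abs_of_nonneg hq0] at this
    simpa [hE] using this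
  have hexp : ‖(1 : ℂ) - (Real.exp (-v) : ℝ)‖ ≤ v := by
    rw [← Complex.ofReal_one, ← Complex.ofReal_sub, Complex.norm_real, Real.norm_eq_abs,
      abs_of_nonneg (by linarith [Real.exp_le_one_iff.mpr (by linarith : -v ≤ 0)])]
    linarith [Real.add_one_le_exp (-v)]
  have e1 : geomChar z θ * E - (Real.exp (-v) : ℝ) =
      (geomChar z θ - 1) * E + (E - 1) + (1 - (Real.exp (-v) : ℝ)) := by ring
  rw [e1]
  calc _ ≤ q * |θ| * 1 + q * |θ| + v := by
        refine (norm_add_le _ _).trans (add_le_add ((norm_add_le _ _).trans (add_le_add ?_ hE1)) hexp)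
        rw [norm_mul, hEn]; gcongr
    _ = q * |θ| * (2 + (1 + q) * |θ| / 2) := by rw [hv, ← sq_abs θ]; ring
    -- With y = (1 + q)|θ| this is 2 + y/2 ≤ 34 y² for y ≥ 1/4, an equality at y = 1/4.
    _ ≤ q * |θ| * (34 * ((1 + q) ^ 2 * |θ| ^ 2)) := by
        gcongr
        nlinarith
    _ = _ := by ring

lemma norm_prod_sub_prod_le {ι : Type*} (s : Finset ι) (f g : ι → ℂ) (hf : ∀ i ∈ s, ‖f i‖ ≤ 1)
    (hg : ∀ i ∈ s, ‖g i‖ ≤ 1) :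
    ‖∏ i ∈ s, f i - ∏ i ∈ s, g i‖ ≤ ∑ i ∈ s, ‖f i - g i‖ := by
  classical
  induction s using Finset.induction_on with
  | empty => simp
  | insert i s hi ih =>
    rw [Finset.prod_insert hi, Finset.prod_insert hi, Finset.sum_insert hi]
    have h1 := ih (fun j hj => hf j (Finset.mem_insert_of_mem hj))
      (fun j hj => hg j (Finset.mem_insert_of_mem hj))
    have h2 : ‖∏ j ∈ s, g j‖ ≤ 1 := by
      rw [norm_prod]
      exact Finset.prod_le_one (fun _ _ => norm_nonneg _)
        fun j hj => hg j (Finset.mem_insert_of_mem hj)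
    have e : f i * ∏ j ∈ s, f j - g i * ∏ j ∈ s, g j =
        f i * (∏ j ∈ s, f j - ∏ j ∈ s, g j) + (f i - g i) * ∏ j ∈ s, g j := by ring
    rw [e]
    refine (norm_add_le _ _).trans ?_
    rw [norm_mul, norm_mul, add_comm]
    gcongr
    · exact mul_le_of_le_one_right (norm_nonneg _) h2
    · exact (mul_le_of_le_one_left (norm_nonneg _) (hf i (Finset.mem_insert_self i s))).trans h1

end LatticeLLT

namespace LatticeLLT
open ConvexLattice (CoprimePair Config endpoint)

/-! ### Fourier inversion for the endpoint of a random polygonal line -/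

/-- The torus `[-π, π]²`. -/
def torus : Set (ℝ × ℝ) := Icc (-Real.pi) Real.pi ×ˢ Icc (-Real.pi) Real.pi

/-- The scalar product of `θ ∈ ℝ²` with an integer vector. -/
def pairing (θ : ℝ × ℝ) (x : ℕ × ℕ) : ℝ := θ.1 * x.1 + θ.2 * x.2

lemma endpoint_fst {S : Finset CoprimePair} {ν : Config} (h : ν.support ⊆ S) :
    (endpoint ν).1 = ∑ x ∈ S, ν x * x.1.1 := by
  rw [endpoint, Finsupp.sum_of_support_subset ν h _ (by simp), Prod.fst_sum]
  simp

lemma endpoint_snd {S : Finset CoprimePair} {ν : Config} (h : ν.support ⊆ S) :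
    (endpoint ν).2 = ∑ x ∈ S, ν x * x.1.2 := by
  rw [endpoint, Finsupp.sum_of_support_subset ν h _ (by simp), Prod.snd_sum]
  simp

lemma mul_le_endpoint (ν : Config) (x : CoprimePair) :
    ν x * x.1.1 ≤ (endpoint ν).1 ∧ ν x * x.1.2 ≤ (endpoint ν).2 := by
  classical
  have hs : ν.support ⊆ insert x ν.support := Finset.subset_insert _ _
  rw [endpoint_fst hs, endpoint_snd hs]
  exact ⟨Finset.single_le_sum (f := fun y : CoprimePair => ν y * y.1.1) (fun _ _ => Nat.zero_le _)
      (Finset.mem_insert_self _ _),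
    Finset.single_le_sum (f := fun y : CoprimePair => ν y * y.1.2) (fun _ _ => Nat.zero_le _)
      (Finset.mem_insert_self _ _)⟩

lemma coprimePair_pos (x : CoprimePair) : 1 ≤ x.1.1 ∨ 1 ≤ x.1.2 := by
  by_contra! h
  have := x.2
  rw [show x.1.1 = 0 by omega, show x.1.2 = 0 by omega] at this
  simp at this

lemma apply_le_endpoint (ν : Config) (x : CoprimePair) :
    ν x ≤ (endpoint ν).1 + (endpoint ν).2 := by
  obtain ⟨h1, h2⟩ := mul_le_endpoint ν x
  rcases coprimePair_pos x with h | h <;> nlinarith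

lemma le_endpoint_of_mem_support {ν : Config} {x : CoprimePair} (hx : x ∈ ν.support) :
    x.1.1 ≤ (endpoint ν).1 ∧ x.1.2 ≤ (endpoint ν).2 := by
  obtain ⟨h1, h2⟩ := mul_le_endpoint ν x
  have : 1 ≤ ν x := Nat.one_le_iff_ne_zero.mpr (Finsupp.mem_support_iff.mp hx)
  constructor <;> nlinarith

open Classical in
/-- Configurations with support in `S`, multiplicities below `K` and endpoint `n`. -/
noncomputable def configsIn (S : Finset CoprimePair) (K : ℕ) (n : ℕ × ℕ) : Finset Config :=
  (S.finsupp fun _ => Finset.range K).filter fun ν => endpoint ν = n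

/-- Edges do not exceed the endpoint and multiplicities are at most n₁ + n₂. Truncating supports to
S and multiplicities below K therefore loses no configuration with endpoint n. -/
lemma mem_configsIn {S : Finset CoprimePair} {K : ℕ} {n : ℕ × ℕ}
    (hS : ∀ x : CoprimePair, x.1.1 ≤ n.1 → x.1.2 ≤ n.2 → x ∈ S) (hK : n.1 + n.2 < K) (ν : Config) :
    ν ∈ configsIn S K n ↔ endpoint ν = n := by
  classical
  rw [configsIn, Finset.mem_filter, Finset.mem_finsupp_iff, and_iff_right_iff_imp]
  rintro rfl
  refine ⟨fun x hx => ?_, fun x _ => ?_⟩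
  · obtain ⟨h1, h2⟩ := le_endpoint_of_mem_support hx
    exact hS x h1 h2
  · exact Finset.mem_range.mpr ((apply_le_endpoint ν x).trans_lt hK)

lemma finite_endpoint_eq (n : ℕ × ℕ) : {ν : Config | endpoint ν = n}.Finite := by
  have hf : {x : CoprimePair | x.1.1 ≤ n.1 ∧ x.1.2 ≤ n.2}.Finite := by
    refine Set.Finite.of_finite_image (f := Subtype.val) ?_ Subtype.val_injective.injOn
    refine (Set.finite_Iic n).subset ?_
    rintro _ ⟨x, hx, rfl⟩
    exact hx
  refine (configsIn hf.toFinset (n.1 + n.2 + 1) n).finite_toSet.subset fun ν hν => ?_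
  rw [Finset.mem_coe, mem_configsIn _ (Nat.lt_succ_self _)]
  · exact hν
  · intro x h1 h2; simp [h1, h2]

lemma setIntegral_exp_int (a : ℤ) :
    ∫ x in Icc (-Real.pi) Real.pi, Complex.exp ((a : ℂ) * Complex.I * x) =
      if a = 0 then ((2 * Real.pi : ℝ) : ℂ) else 0 := by
  rw [integral_Icc_eq_integral_Ioc, ← intervalIntegral.integral_of_le (by linarith [Real.pi_pos])]
  split_ifs with h
  · subst h; simp; ring
  · have hc : (a : ℂ) * Complex.I ≠ 0 := mul_ne_zero (by exact_mod_cast h) Complex.I_ne_zero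
    rw [integral_exp_mul_complex hc, div_eq_zero_iff]
    left
    rw [sub_eq_zero, Complex.exp_eq_exp_iff_exists_int]
    exact ⟨a, by push_cast; ring⟩

lemma setIntegral_torus_exp (m n : ℕ × ℕ) :
    ∫ θ in torus, Complex.exp ((pairing θ m : ℝ) * Complex.I) *
        Complex.exp (-(pairing θ n : ℝ) * Complex.I) =
      if m = n then (((2 * Real.pi) ^ 2 : ℝ) : ℂ) else 0 := by
  have e : ∀ θ : ℝ × ℝ, Complex.exp ((pairing θ m : ℝ) * Complex.I) *
        Complex.exp (-(pairing θ n : ℝ) * Complex.I) =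
      Complex.exp ((((m.1 : ℤ) - n.1 : ℤ) : ℂ) * Complex.I * (θ.1 : ℝ)) *
        Complex.exp ((((m.2 : ℤ) - n.2 : ℤ) : ℂ) * Complex.I * (θ.2 : ℝ)) := by
    intro θ
    rw [← Complex.exp_add, ← Complex.exp_add, pairing, pairing]
    congr 1; push_cast; ring
  simp_rw [e]
  rw [torus, Measure.volume_eq_prod,
    setIntegral_prod_mul (μ := (volume : Measure ℝ)) (ν := (volume : Measure ℝ))
      (fun x : ℝ => Complex.exp ((((m.1 : ℤ) - n.1 : ℤ) : ℂ) * Complex.I * (x : ℝ)))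
      (fun x : ℝ => Complex.exp ((((m.2 : ℤ) - n.2 : ℤ) : ℂ) * Complex.I * (x : ℝ))),
    setIntegral_exp_int, setIntegral_exp_int]
  have h : m = n ↔ ((m.1 : ℤ) - n.1 = 0 ∧ (m.2 : ℤ) - n.2 = 0) := by
    rw [Prod.ext_iff]; omega
  by_cases h1 : (m.1 : ℤ) - n.1 = 0 <;> by_cases h2 : (m.2 : ℤ) - n.2 = 0 <;>
    simp [h, h1, h2]
  ring

lemma isCompact_torus : IsCompact torus := isCompact_Icc.prod isCompact_Icc

lemma measurableSet_torus : MeasurableSet torus := measurableSet_Icc.prod measurableSet_Icc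

/-- The truncated characteristic function. -/
noncomputable def truncGeomChar (K : ℕ) (z θ : ℝ) : ℂ :=
  ∑ k ∈ Finset.range K, ((z ^ k * (1 - z) : ℝ) : ℂ) * Complex.exp ((k * θ : ℝ) * Complex.I)

lemma norm_truncGeomChar_le_one {z : ℝ} (h0 : 0 ≤ z) (h1 : z < 1) (K : ℕ) (θ : ℝ) :
    ‖truncGeomChar K z θ‖ ≤ 1 := by
  calc _ ≤ ∑ k ∈ Finset.range K, z ^ k * (1 - z) := by
        refine norm_sum_le_of_le _ fun k _ => ?_
        rw [norm_mul, Complex.norm_exp_ofReal_mul_I, mul_one, Complex.norm_real,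
          Real.norm_of_nonneg (mul_nonneg (pow_nonneg h0 _) (by linarith))]
    _ = 1 - z ^ K := by rw [← Finset.sum_mul, geom_sum_mul_neg]
    _ ≤ 1 := by linarith [pow_nonneg h0 K]

lemma tendsto_truncGeomChar {z : ℝ} (h0 : 0 ≤ z) (h1 : z < 1) (θ : ℝ) :
    Tendsto (fun K => truncGeomChar K z θ) atTop (𝓝 (geomChar z θ)) := by
  have hn : ‖(z : ℂ) * Complex.exp (θ * Complex.I)‖ < 1 := by
    rw [norm_mul, Complex.norm_exp_ofReal_mul_I, mul_one, Complex.norm_real, Real.norm_of_nonneg h0]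
    exact h1
  have h := ((hasSum_geometric_of_norm_lt_one hn).mul_left (1 - (z : ℂ))).tendsto_sum_nat
  rw [← div_eq_mul_inv] at h
  refine h.congr fun K => Finset.sum_congr rfl fun k _ => ?_
  rw [mul_pow, ← Complex.exp_nat_mul]
  push_cast
  rw [← mul_assoc (k : ℂ)]
  ring

/-- Expanding a finite product of finite sums. The truncation in K makes orthogonality of characters
applicable term by term. -/
lemma prod_truncGeomChar (S : Finset CoprimePair) (z : CoprimePair → ℝ) (K : ℕ) (θ : ℝ × ℝ) :
    ∏ x ∈ S, truncGeomChar K (z x) (pairing θ x.1) =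
      ∑ ν ∈ S.finsupp fun _ => Finset.range K,
        ((∏ x ∈ S, z x ^ ν x * (1 - z x) : ℝ) : ℂ) *
          Complex.exp ((pairing θ (endpoint ν) : ℝ) * Complex.I) := by
  classical
  have key : ∀ ν ∈ S.finsupp fun _ => Finset.range K,
      ((∏ x ∈ S, z x ^ ν x * (1 - z x) : ℝ) : ℂ) *
          Complex.exp ((pairing θ (endpoint ν) : ℝ) * Complex.I) =
      ∏ x ∈ S, ((z x ^ ν x * (1 - z x) : ℝ) : ℂ) *
        Complex.exp ((ν x * pairing θ x.1 : ℝ) * Complex.I) := by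
    intro ν hν
    have hs := (Finset.mem_finsupp_iff.mp hν).1
    symm
    rw [Finset.prod_mul_distrib, ← Complex.exp_sum, Complex.ofReal_prod, ← Finset.sum_mul,
      ← Complex.ofReal_sum]
    congr 4
    rw [pairing, endpoint_fst hs, endpoint_snd hs]
    push_cast
    rw [Finset.mul_sum, Finset.mul_sum, ← Finset.sum_add_distrib]
    refine Finset.sum_congr rfl fun x _ => ?_
    rw [pairing]; ring
  rw [Finset.sum_congr rfl key]
  simp only [truncGeomChar, Finset.finsupp]
  rw [Finset.prod_sum, Finset.sum_map]
  refine Finset.sum_congr (by congr!) fun p _ => ?_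
  rw [← Finset.prod_attach S]
  refine Finset.prod_congr rfl fun x _ => ?_
  simp [Finsupp.indicator_of_mem x.2]

lemma continuous_truncGeomChar (K : ℕ) (z : ℝ) : Continuous (truncGeomChar K z) := by
  unfold truncGeomChar; fun_prop

lemma continuous_pairing (x : ℕ × ℕ) : Continuous fun θ : ℝ × ℝ => pairing θ x := by
  unfold pairing; fun_prop

lemma setIntegral_truncGeomChar (S : Finset CoprimePair) (z : CoprimePair → ℝ) (K : ℕ)
    (n : ℕ × ℕ) :
    ∫ θ in torus, (∏ x ∈ S, truncGeomChar K (z x) (pairing θ x.1)) *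
        Complex.exp (-(pairing θ n : ℝ) * Complex.I) =
      ((∑ ν ∈ configsIn S K n, ∏ x ∈ S, z x ^ ν x * (1 - z x) : ℝ) : ℂ) *
        (((2 * Real.pi) ^ 2 : ℝ) : ℂ) := by
  classical
  simp_rw [prod_truncGeomChar, Finset.sum_mul, mul_assoc]
  rw [integral_finsetSum]
  · simp_rw [integral_const_mul, setIntegral_torus_exp, mul_ite, mul_zero]
    rw [← Finset.sum_filter, configsIn, Complex.ofReal_sum, Finset.sum_mul]
  · intro ν _
    refine Integrable.const_mul ?_ _
    refine ContinuousOn.integrableOn_compact isCompact_torus (Continuous.continuousOn ?_)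
    have := continuous_pairing n
    have := continuous_pairing (endpoint ν)
    fun_prop

/-- Fourier inversion for the endpoint. -/
lemma setIntegral_prod_geomChar {S : Finset CoprimePair} {z : CoprimePair → ℝ} {n : ℕ × ℕ}
    (h0 : ∀ x, 0 ≤ z x) (h1 : ∀ x, z x < 1)
    (hS : ∀ x : CoprimePair, x.1.1 ≤ n.1 → x.1.2 ≤ n.2 → x ∈ S) :
    ∫ θ in torus, (∏ x ∈ S, geomChar (z x) (pairing θ x.1)) *
        Complex.exp (-(pairing θ n : ℝ) * Complex.I) =
      ((∑ ν ∈ (finite_endpoint_eq n).toFinset, ∏ x ∈ S, z x ^ ν x * (1 - z x) : ℝ) : ℂ) *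
        (((2 * Real.pi) ^ 2 : ℝ) : ℂ) := by
  have ht : Tendsto (fun K : ℕ => ∫ θ in torus,
      (∏ x ∈ S, truncGeomChar K (z x) (pairing θ x.1)) *
        Complex.exp (-(pairing θ n : ℝ) * Complex.I)) atTop
      (𝓝 (∫ θ in torus, (∏ x ∈ S, geomChar (z x) (pairing θ x.1)) *
        Complex.exp (-(pairing θ n : ℝ) * Complex.I))) := by
    refine tendsto_integral_of_dominated_convergence (fun _ => 1) ?_ ?_ ?_ ?_
    · intro K
      refine Continuous.aestronglyMeasurable ?_
      have := continuous_pairing n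
      have h2 : ∀ x ∈ S, Continuous fun θ : ℝ × ℝ => truncGeomChar K (z x) (pairing θ x.1) :=
        fun x _ => (continuous_truncGeomChar K (z x)).comp (continuous_pairing x.1)
      exact (continuous_finsetProd S h2).mul (by fun_prop)
    · have : IsFiniteMeasure ((volume : Measure (ℝ × ℝ)).restrict torus) :=
        ⟨by rw [Measure.restrict_apply_univ]; exact isCompact_torus.measure_lt_top⟩
      exact integrable_const 1
    · intro K
      refine Eventually.of_forall fun θ => ?_
      rw [norm_mul, ← Complex.ofReal_neg, Complex.norm_exp_ofReal_mul_I, mul_one, norm_prod]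
      exact Finset.prod_le_one (fun _ _ => norm_nonneg _)
        fun x _ => norm_truncGeomChar_le_one (h0 x) (h1 x) K _
    · refine Eventually.of_forall fun θ => ?_
      exact (tendsto_finsetProd S fun x _ => tendsto_truncGeomChar (h0 x) (h1 x) _).mul_const _
  refine tendsto_nhds_unique ht (tendsto_const_nhds.congr' ?_)
  -- The truncated integral is constant once K > n₁ + n₂, so its limit is this constant.
  filter_upwards [eventually_gt_atTop (n.1 + n.2)] with K hK
  rw [setIntegral_truncGeomChar]
  congr 3
  ext ν
  rw [mem_configsIn hS hK]
  simp

end LatticeLLT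

namespace LatticeLLT
open ConvexLattice (CoprimePair Config endpoint multiPow configMass measureQ)

/-! ### The endpoint distribution as a limit over finite sets of edge directions -/

/-- Off the finite support of ν the factor is 1 - z^x, so summability of z^x suffices. -/
lemma multipliable_mass {z : CoprimePair → ℝ × ℝ} (hs : Summable (multiPow z)) (ν : Config) :
    Multipliable fun x => multiPow z x ^ ν x * (1 - multiPow z x) := by
  have h : Summable fun x => multiPow z x ^ ν x * (1 - multiPow z x) - 1 := by
    refine (summable_congr_cofinite ?_).mpr hs.neg
    have : ∀ᶠ x in cofinite, x ∉ ν.support :=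
      ν.support.finite_toSet.compl_mem_cofinite
    filter_upwards [this] with x hx
    rw [Finsupp.notMem_support_iff.mp hx]
    simp
  have := Real.multipliable_one_add_of_summable h
  simpa using this

lemma tendsto_mass {z : CoprimePair → ℝ × ℝ} (hs : Summable (multiPow z)) (ν : Config) :
    Tendsto (fun S : Finset CoprimePair => ∏ x ∈ S, multiPow z x ^ ν x * (1 - multiPow z x)) atTop
      (𝓝 (configMass z ν)) := by
  have := (multipliable_mass hs ν).hasProd
  simpa [HasProd, configMass] using this

lemma configMass_nonneg {z : CoprimePair → ℝ × ℝ} (h0 : ∀ x, 0 ≤ multiPow z x)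
    (h1 : ∀ x, multiPow z x < 1) (hs : Summable (multiPow z)) (ν : Config) : 0 ≤ configMass z ν :=
  ge_of_tendsto' (tendsto_mass hs ν) fun S => Finset.prod_nonneg fun x _ =>
    mul_nonneg (pow_nonneg (h0 x) _) (by linarith [h1 x])

lemma measureQ_real_endpoint {z : CoprimePair → ℝ × ℝ} (h0 : ∀ x, 0 ≤ multiPow z x)
    (h1 : ∀ x, multiPow z x < 1) (hs : Summable (multiPow z)) (n : ℕ × ℕ) :
    (measureQ z).real {ν | endpoint ν = n} =
      ∑ ν ∈ (finite_endpoint_eq n).toFinset, configMass z ν := by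
  have hm : MeasurableSet {ν : Config | endpoint ν = n} := trivial
  rw [Measure.real, measureQ, Measure.sum_apply _ hm, tsum_eq_sum
    (s := (finite_endpoint_eq n).toFinset)]
  · rw [ENNReal.toReal_sum]
    · refine Finset.sum_congr rfl fun ν hν => ?_
      have : ν ∈ {ν : Config | endpoint ν = n} := by simpa using hν
      rw [Measure.smul_apply, Measure.dirac_apply_of_mem this, smul_eq_mul, mul_one,
        ENNReal.toReal_ofReal (configMass_nonneg h0 h1 hs ν)]
    · intro ν _
      rw [Measure.smul_apply, smul_eq_mul]
      exact ENNReal.mul_ne_top ENNReal.ofReal_ne_top (measure_ne_top _ _)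
  · intro ν hν
    have : ν ∉ {ν : Config | endpoint ν = n} := by simpa using hν
    rw [Measure.smul_apply, Measure.dirac_apply' _ hm, Set.indicator_of_notMem this, smul_zero]

/-- The event is a finite sum of masses, each a limit of finite products; closed bounds valid for
all large S pass to the limit. No normalisation of `measureQ` is needed. -/
lemma measureQ_real_endpoint_mem_Icc {z : CoprimePair → ℝ × ℝ} (h0 : ∀ x, 0 ≤ multiPow z x)
    (h1 : ∀ x, multiPow z x < 1) (hs : Summable (multiPow z)) {n : ℕ × ℕ} {a b : ℝ}
    (h : ∀ᶠ S : Finset CoprimePair in atTop, ∑ ν ∈ (finite_endpoint_eq n).toFinset,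
      ∏ x ∈ S, multiPow z x ^ ν x * (1 - multiPow z x) ∈ Icc a b) :
    (measureQ z).real {ν | endpoint ν = n} ∈ Icc a b := by
  rw [measureQ_real_endpoint h0 h1 hs]
  exact isClosed_Icc.mem_of_tendsto (tendsto_finsetSum _ fun ν _ => tendsto_mass hs ν) h

end LatticeLLT

namespace LatticeLLT

/-! ### Gaussian integrals in the plane -/

lemma integrable_exp_neg_sq_add_sq {c : ℝ} (hc : 0 < c) :
    Integrable fun θ : ℝ × ℝ => Real.exp (-c * (θ.1 ^ 2 + θ.2 ^ 2)) := by
  have h := (integrable_exp_neg_mul_sq hc).mul_prod (integrable_exp_neg_mul_sq hc)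
  rw [← Measure.volume_eq_prod] at h
  refine h.congr (Eventually.of_forall fun θ => ?_)
  simp only
  rw [← Real.exp_add]; congr 1; ring

lemma integral_exp_neg_sq_add_sq {c : ℝ} (hc : 0 < c) :
    ∫ θ : ℝ × ℝ, Real.exp (-c * (θ.1 ^ 2 + θ.2 ^ 2)) = Real.pi / c := by
  have h : ∀ θ : ℝ × ℝ, Real.exp (-c * (θ.1 ^ 2 + θ.2 ^ 2)) =
      Real.exp (-c * θ.1 ^ 2) * Real.exp (-c * θ.2 ^ 2) := by
    intro θ; rw [← Real.exp_add]; congr 1; ring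
  simp_rw [h]
  rw [Measure.volume_eq_prod, integral_prod_mul (fun x : ℝ => Real.exp (-c * x ^ 2))
    (fun x : ℝ => Real.exp (-c * x ^ 2)), integral_gaussian, Real.mul_self_sqrt (by positivity)]

/-- The binary quadratic form with coefficients `k₁₁, k₁₂, k₂₂`. -/
def quadForm (k₁₁ k₁₂ k₂₂ : ℝ) (θ : ℝ × ℝ) : ℝ :=
  k₁₁ * θ.1 ^ 2 + 2 * k₁₂ * (θ.1 * θ.2) + k₂₂ * θ.2 ^ 2

lemma integrable_gaussian_char {k₁₁ k₁₂ k₂₂ c : ℝ} (hc : 0 < c)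
    (h : ∀ θ : ℝ × ℝ, c * (θ.1 ^ 2 + θ.2 ^ 2) ≤ quadForm k₁₁ k₁₂ k₂₂ θ) (b : ℝ × ℝ) :
    Integrable fun θ : ℝ × ℝ => ((Real.exp (-(quadForm k₁₁ k₁₂ k₂₂ θ / 2)) : ℝ) : ℂ) *
      Complex.exp ((θ.1 * b.1 + θ.2 * b.2 : ℝ) * Complex.I) := by
  refine (integrable_exp_neg_sq_add_sq (half_pos hc)).mono' ?_ (Eventually.of_forall fun θ => ?_)
  · refine Continuous.aestronglyMeasurable ?_
    unfold quadForm; fun_prop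
  · rw [norm_mul, Complex.norm_exp_ofReal_mul_I, mul_one, Complex.norm_real,
      Real.norm_of_nonneg (Real.exp_pos _).le]
    gcongr
    have := h θ
    linarith

lemma integral_real_gaussian_char {k : ℝ} (hk : 0 < k) (w d : ℂ) :
    ∫ x : ℝ, Complex.exp (-(k / 2 : ℝ) * x ^ 2 + w * x + d) =
      ((√(2 * Real.pi / k) : ℝ) : ℂ) * Complex.exp (d + w ^ 2 / (2 * k)) := by
  have h := integral_cexp_quadratic (b := (-(k / 2 : ℝ) : ℂ))
    (by rw [← Complex.ofReal_neg, Complex.ofReal_re]; linarith) w d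
  rw [h]
  have hk' : (k : ℂ) ≠ 0 := by exact_mod_cast hk.ne'
  congr 1
  · rw [Real.sqrt_eq_rpow, Complex.ofReal_cpow (by positivity)]
    push_cast
    congr 1
    field_simp
  · congr 1
    push_cast
    field_simp
    ring

/-- Integrating out the second variable by completing the square leaves a one-dimensional Gaussian
whose coefficient is the Schur complement k₁₁ - k₁₂²/k₂₂. -/
lemma integral_gaussian_char {k₁₁ k₁₂ k₂₂ c : ℝ} (hc : 0 < c)
    (h : ∀ θ : ℝ × ℝ, c * (θ.1 ^ 2 + θ.2 ^ 2) ≤ quadForm k₁₁ k₁₂ k₂₂ θ) (b : ℝ × ℝ) :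
    ∫ θ : ℝ × ℝ, ((Real.exp (-(quadForm k₁₁ k₁₂ k₂₂ θ / 2)) : ℝ) : ℂ) *
      Complex.exp ((θ.1 * b.1 + θ.2 * b.2 : ℝ) * Complex.I) =
    ((√(2 * Real.pi / k₂₂) * √(2 * Real.pi / (k₁₁ - k₁₂ ^ 2 / k₂₂)) *
      Real.exp (-(b.2 ^ 2 / (2 * k₂₂)) -
        (b.1 - b.2 * (k₁₂ / k₂₂)) ^ 2 / (2 * (k₁₁ - k₁₂ ^ 2 / k₂₂))) : ℝ) : ℂ) := by
  have hk : 0 < k₂₂ := by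
    have := h (0, 1)
    simp [quadForm] at this
    linarith
  have hs : 0 < k₁₁ - k₁₂ ^ 2 / k₂₂ := by
    have := h (1, -(k₁₂ / k₂₂))
    have e : quadForm k₁₁ k₁₂ k₂₂ (1, -(k₁₂ / k₂₂)) = k₁₁ - k₁₂ ^ 2 / k₂₂ := by
      simp only [quadForm]; field_simp; ring
    rw [e] at this
    refine lt_of_lt_of_le ?_ this
    positivity
  set s := k₁₁ - k₁₂ ^ 2 / k₂₂ with hsdef
  have hint := integrable_gaussian_char hc h b
  rw [Measure.volume_eq_prod] at hint ⊢
  rw [integral_prod _ hint]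
  have hkc : (k₂₂ : ℂ) ≠ 0 := by exact_mod_cast hk.ne'
  have hsc : (s : ℂ) ≠ 0 := by exact_mod_cast hs.ne'
  have inner : ∀ x : ℝ, ∫ y : ℝ, ((Real.exp (-(quadForm k₁₁ k₁₂ k₂₂ (x, y) / 2)) : ℝ) : ℂ) *
      Complex.exp ((x * b.1 + y * b.2 : ℝ) * Complex.I) =
      ((√(2 * Real.pi / k₂₂) : ℝ) : ℂ) * Complex.exp (-(s / 2 : ℝ) * x ^ 2 +
        ((b.1 - b.2 * (k₁₂ / k₂₂) : ℝ) * Complex.I) * x + (-(b.2 ^ 2 / (2 * k₂₂)) : ℝ)) := by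
    intro x
    have e : ∀ y : ℝ, ((Real.exp (-(quadForm k₁₁ k₁₂ k₂₂ (x, y) / 2)) : ℝ) : ℂ) *
        Complex.exp ((x * b.1 + y * b.2 : ℝ) * Complex.I) =
        Complex.exp (-(k₂₂ / 2 : ℝ) * y ^ 2 + (b.2 * Complex.I - k₁₂ * x) * y +
          (-(k₁₁ / 2) * x ^ 2 + x * b.1 * Complex.I)) := by
      intro y
      rw [Complex.ofReal_exp, ← Complex.exp_add, quadForm]
      congr 1
      push_cast; ring
    simp_rw [e]
    rw [integral_real_gaussian_char hk]
    congr 2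
    rw [hsdef]
    push_cast
    field_simp
    ring_nf
    simp only [Complex.I_sq]
    ring
  simp only
  simp_rw [inner]
  rw [integral_const_mul, integral_real_gaussian_char hs, Complex.ofReal_mul, Complex.ofReal_mul,
    Complex.ofReal_exp, mul_assoc]
  congr 3
  push_cast
  rw [mul_pow, Complex.I_sq]
  ring

/-- Two-sided bounds for the Fourier transform of a Gaussian density of the scale `R^{-1/2}` at
frequencies of the order `R^{1/2}`. -/
lemma gaussian_char_bounds {k₁₁ k₁₂ k₂₂ c C D R : ℝ} (hc : 0 < c) (hR : 0 < R)
    (h : ∀ θ : ℝ × ℝ, c * R * (θ.1 ^ 2 + θ.2 ^ 2) ≤ quadForm k₁₁ k₁₂ k₂₂ θ)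
    (h11 : k₁₁ ≤ C * R) (h22 : k₂₂ ≤ C * R) {b : ℝ × ℝ} (hb : b.1 ^ 2 + b.2 ^ 2 ≤ D * R) :
    ∃ M : ℝ, ∫ θ : ℝ × ℝ, ((Real.exp (-(quadForm k₁₁ k₁₂ k₂₂ θ / 2)) : ℝ) : ℂ) *
      Complex.exp ((θ.1 * b.1 + θ.2 * b.2 : ℝ) * Complex.I) = (M : ℂ) ∧
      2 * Real.pi / C * Real.exp (-(D / c)) / R ≤ M ∧ M ≤ 2 * Real.pi / c / R := by
  have hcR : 0 < c * R := by positivity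
  refine ⟨_, integral_gaussian_char hcR h b, ?_, ?_⟩
  all_goals
    have hk : c * R ≤ k₂₂ := by
      have := h (0, 1)
      simpa [quadForm] using this
    have hs : c * R * (1 + (k₁₂ / k₂₂) ^ 2) ≤ k₁₁ - k₁₂ ^ 2 / k₂₂ := by
      have := h (1, -(k₁₂ / k₂₂))
      have hk0 : k₂₂ ≠ 0 := by linarith
      have e : quadForm k₁₁ k₁₂ k₂₂ (1, -(k₁₂ / k₂₂)) = k₁₁ - k₁₂ ^ 2 / k₂₂ := by
        simp only [quadForm]; field_simp; ring
      rw [e] at this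
      simpa using this
    have hk0 : 0 < k₂₂ := by linarith
    have hs1 : k₁₁ - k₁₂ ^ 2 / k₂₂ ≤ C * R := by
      have : 0 ≤ k₁₂ ^ 2 / k₂₂ := by positivity
      linarith
    set s := k₁₁ - k₁₂ ^ 2 / k₂₂ with hsdef
    have hs0 : 0 < s := lt_of_lt_of_le (by positivity) hs
    have hcs : c * R ≤ s := le_trans (by nlinarith [sq_nonneg (k₁₂ / k₂₂)]) hs
    have hCR : 0 < C * R := by linarith
    have hC : 0 < C := pos_of_mul_pos_left hCR hR.le
    rw [← Real.sqrt_mul (by positivity)]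
    set r := k₁₂ / k₂₂
  · have h1 : 2 * Real.pi / (C * R) ≤ √(2 * Real.pi / k₂₂ * (2 * Real.pi / s)) := by
      apply Real.le_sqrt_of_sq_le
      rw [sq]; gcongr
    have h2 : b.2 ^ 2 / (2 * k₂₂) ≤ D / (2 * c) := by
      rw [div_le_div_iff₀ (by positivity) (by positivity)]
      nlinarith [sq_nonneg b.1, sq_nonneg b.2]
    have h3 : (b.1 - b.2 * r) ^ 2 / (2 * s) ≤ D / (2 * c) := by
      rw [div_le_div_iff₀ (by positivity) (by positivity)]
      -- Cauchy–Schwarz. The factor 1 + r² is matched by the same factor in the lower bound for s,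
      -- which the form takes at the vector (1, -r).
      have h4 : (b.1 - b.2 * r) ^ 2 ≤ D * R * (1 + r ^ 2) := by
        nlinarith [sq_nonneg (b.1 * r + b.2), sq_nonneg r]
      have hD : 0 ≤ D := by
        have : 0 ≤ D * R := le_trans (by positivity) hb
        exact nonneg_of_mul_nonneg_left this hR
      nlinarith
    calc 2 * Real.pi / C * Real.exp (-(D / c)) / R = 2 * Real.pi / (C * R) * Real.exp (-(D / c)) := by
          field_simp
      _ ≤ _ := by
          gcongr
          have : D / c = D / (2 * c) + D / (2 * c) := by field_simp; ring
          linarith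
  · have h1 : √(2 * Real.pi / k₂₂ * (2 * Real.pi / s)) ≤ 2 * Real.pi / (c * R) := by
      apply Real.sqrt_le_iff.mpr ⟨by positivity, ?_⟩
      rw [sq]; gcongr
    have h2 : Real.exp (-(b.2 ^ 2 / (2 * k₂₂)) - (b.1 - b.2 * r) ^ 2 / (2 * s)) ≤ 1 := by
      apply Real.exp_le_one_iff.mpr
      have : 0 ≤ b.2 ^ 2 / (2 * k₂₂) := by positivity
      have : 0 ≤ (b.1 - b.2 * r) ^ 2 / (2 * s) := by positivity
      linarith
    calc _ ≤ 2 * Real.pi / (c * R) * 1 := by gcongr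
      _ = _ := by field_simp

end LatticeLLT

namespace LatticeLLT
open ConvexLattice (CoprimePair Config endpoint)

/-! ### From bounds on a characteristic function to a local limit estimate -/

lemma cube_le_exp {c : ℝ} (hc : 0 < c) {u : ℝ} (hu : 0 ≤ u) :
    u ^ 3 ≤ (1 + 32 / c ^ 2) * Real.exp (c / 4 * u ^ 2) := by
  have h1 : (1 : ℝ) ≤ Real.exp (c / 4 * u ^ 2) := Real.one_le_exp (by positivity)
  have h2 := Real.quadratic_le_exp_of_nonneg (x := c / 4 * u ^ 2) (by positivity)
  have h3 : u ^ 4 ≤ 32 / c ^ 2 * Real.exp (c / 4 * u ^ 2) := by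
    have : (c / 4 * u ^ 2) ^ 2 / 2 ≤ Real.exp (c / 4 * u ^ 2) := by
      have : 0 ≤ c / 4 * u ^ 2 := by positivity
      linarith
    calc u ^ 4 = 32 / c ^ 2 * ((c / 4 * u ^ 2) ^ 2 / 2) := by field_simp; ring
      _ ≤ _ := by gcongr
  have h4 : u ^ 3 ≤ 1 + u ^ 4 := by nlinarith [sq_nonneg (u ^ 2 - u), sq_nonneg (u - 1), sq_nonneg u]
  linarith

lemma abs_pairing_le (θ : ℝ × ℝ) (x : ℕ × ℕ) :
    |pairing θ x| ≤ (|θ.1| + |θ.2|) * (x.1 + x.2) := by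
  rw [pairing]
  refine (abs_add_le _ _).trans ?_
  rw [abs_mul, abs_mul, Nat.abs_cast, Nat.abs_cast]
  have := abs_nonneg θ.1
  have := abs_nonneg θ.2
  have h1 : (0 : ℝ) ≤ x.1 := Nat.cast_nonneg _
  have h2 : (0 : ℝ) ≤ x.2 := Nat.cast_nonneg _
  nlinarith [mul_nonneg (abs_nonneg θ.1) h2, mul_nonneg (abs_nonneg θ.2) h1]

/-- Interpolation between a cubic error bound and a Gaussian tail bound. -/
lemma le_sqrt_mul_gaussian {C c α X : ℝ} (hC : 0 ≤ C) (hc : 0 < c) (hα : 0 < α) (hX : 0 ≤ X)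
    {θ : ℝ × ℝ} (h1 : X ≤ C / α ^ 5 * (|θ.1| + |θ.2|) ^ 3)
    (h2 : X ≤ 2 * Real.exp (-c / α ^ 4 * (θ.1 ^ 2 + θ.2 ^ 2))) :
    X ≤ √(2 * C * (1 + 32 / c ^ 2)) * √α * Real.exp (-(c / 4) / α ^ 4 * (θ.1 ^ 2 + θ.2 ^ 2)) := by
  set u := (|θ.1| + |θ.2|) / α ^ 2 with hu
  have hu0 : 0 ≤ u := by positivity
  set w := (θ.1 ^ 2 + θ.2 ^ 2) / α ^ 4 with hw
  have huw : u ^ 2 ≤ 2 * w := by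
    rw [hu, hw, div_pow, ← pow_mul, ← mul_div_assoc]
    gcongr
    nlinarith [sq_nonneg (|θ.1| - |θ.2|), sq_abs θ.1, sq_abs θ.2]
  have h1' : X ≤ C * α * u ^ 3 := by
    refine h1.trans (le_of_eq ?_)
    rw [hu]; field_simp
  have h2' : X ≤ 2 * Real.exp (-c * w) := by
    refine h2.trans (le_of_eq ?_)
    rw [hw]; congr 2; ring
  have h3 := cube_le_exp hc hu0
  have h4 : Real.exp (c / 4 * u ^ 2) ≤ Real.exp (c / 2 * w) := by
    refine Real.exp_le_exp.mpr ?_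
    nlinarith
  refine le_of_pow_le_pow_left₀ two_ne_zero (by positivity) ?_
  rw [mul_pow, mul_pow, Real.sq_sqrt (by positivity), Real.sq_sqrt hα.le, ← Real.exp_nat_mul]
  calc X ^ 2 = X * X := sq X
    _ ≤ (C * α * u ^ 3) * (2 * Real.exp (-c * w)) := by gcongr
    _ ≤ (C * α * ((1 + 32 / c ^ 2) * Real.exp (c / 2 * w))) * (2 * Real.exp (-c * w)) := by
        gcongr; exact h3.trans (by gcongr)
    _ = 2 * C * (1 + 32 / c ^ 2) * α * (Real.exp (c / 2 * w) * Real.exp (-c * w)) := by ring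
    _ = _ := by
        rw [← Real.exp_add]; congr 2; rw [hw]; push_cast; ring

/-- The fifth term of the exponential series gives α⁵ ≤ α⁴ √α; the outer part of the torus thus
contributes less than the main order α⁴ by a factor √α. -/
lemma exp_neg_div_le {c α : ℝ} (hc : 0 < c) (hα : 0 < α) (hα1 : α ≤ 1) :
    Real.exp (-c / α) ≤ 120 / c ^ 5 * (α ^ 4 * √α) := by
  have h1 : (c / α) ^ 5 / 120 ≤ Real.exp (c / α) := by
    have := Real.pow_div_factorial_le_exp (c / α) (by positivity) 5
    simpa [Nat.factorial] using this
  have h2 : α ≤ √α := Real.le_sqrt_of_sq_le (by nlinarith)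
  rw [neg_div, Real.exp_neg, inv_le_comm₀ (Real.exp_pos _) (by positivity)]
  refine le_trans ?_ h1
  calc (120 / c ^ 5 * (α ^ 4 * √α))⁻¹ ≤ (120 / c ^ 5 * (α ^ 4 * α))⁻¹ := by gcongr
    _ = _ := by field_simp

lemma exp_neg_div_sq_le {c α : ℝ} (hc : 0 < c) (hα : 0 < α) (hα1 : α ≤ 1) :
    Real.exp (-c / α ^ 2) ≤ 1 / c * √α := by
  have h1 : c / α ^ 2 ≤ Real.exp (c / α ^ 2) := by
    linarith [Real.add_one_le_exp (c / α ^ 2)]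
  have h2 : α ^ 2 ≤ √α := Real.le_sqrt_of_sq_le (by
    calc (α ^ 2) ^ 2 = α * α ^ 3 := by ring
      _ ≤ α * 1 := by gcongr; exact pow_le_one₀ hα.le hα1
      _ = α := mul_one _)
  rw [neg_div, Real.exp_neg, inv_le_comm₀ (Real.exp_pos _) (by positivity)]
  refine le_trans ?_ h1
  calc (1 / c * √α)⁻¹ ≤ (1 / c * α ^ 2)⁻¹ := by gcongr
    _ = _ := by field_simp

/-- A function on the torus that is close to a Gaussian density near the origin and small elsewhere
has almost the same integral against characters as that density. -/
lemma exists_integral_sub_le {C c c' A : ℝ} (hC : 0 ≤ C) (hc : 0 < c) (hc' : 0 < c') (hA : 0 < A) :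
    ∃ K > 0, ∀ α : ℝ, 0 < α → α ≤ 1 → A * α ≤ Real.pi → ∀ F E : ℝ × ℝ → ℂ, ∀ G : ℝ × ℝ → ℝ,
      Continuous F → Continuous E → (Integrable fun θ => (G θ : ℂ) * E θ) → (∀ θ, ‖E θ‖ = 1) →
      (∀ θ, 0 ≤ G θ ∧ G θ ≤ Real.exp (-c / α ^ 4 * (θ.1 ^ 2 + θ.2 ^ 2))) →
      (∀ θ : ℝ × ℝ, |θ.1| ≤ A * α → |θ.2| ≤ A * α →
        ‖F θ‖ ≤ Real.exp (-c / α ^ 4 * (θ.1 ^ 2 + θ.2 ^ 2)) ∧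
        ‖F θ - G θ‖ ≤ C / α ^ 5 * (|θ.1| + |θ.2|) ^ 3) →
      (∀ θ ∈ torus, ¬(|θ.1| ≤ A * α ∧ |θ.2| ≤ A * α) → ‖F θ‖ ≤ Real.exp (-c' / α)) →
      ‖(∫ θ in torus, F θ * E θ) - ∫ θ, (G θ : ℂ) * E θ‖ ≤ K * √α * α ^ 4 := by
  -- The two constants belong to the comparison inside the box |θᵢ| ≤ A α and to the mass of the
  -- Gaussian outside it. The third summand of K comes from F on the rest of the torus, of area at
  -- most (2π)².
  set K₁ := √(2 * C * (1 + 32 / c ^ 2)) with hK₁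
  set K₂ := 1 / (3 / 4 * c * A ^ 2) with hK₂
  refine ⟨(K₁ + K₂) * (4 * Real.pi / c) + 120 / c' ^ 5 * (2 * Real.pi) ^ 2, by positivity, ?_⟩
  intro α hα hα1 hAα F E G hF hE hGE hE1 hG hbox hout
  set H : ℝ × ℝ → ℝ := fun θ => Real.exp (-(c / 4) / α ^ 4 * (θ.1 ^ 2 + θ.2 ^ 2)) with hH
  have hH0 : ∀ θ, 0 ≤ H θ := fun θ => (Real.exp_pos _).le
  have hHint : Integrable H := by
    have := integrable_exp_neg_sq_add_sq (c := (c / 4) / α ^ 4) (by positivity)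
    simpa only [hH, neg_div] using this
  have hHval : ∫ θ, H θ = 4 * Real.pi / c * α ^ 4 := by
    have := integral_exp_neg_sq_add_sq (c := (c / 4) / α ^ 4) (by positivity)
    simp only [hH, neg_div]
    rw [this]; field_simp
  have htail : ∀ θ : ℝ × ℝ, ¬(|θ.1| ≤ A * α ∧ |θ.2| ≤ A * α) → G θ ≤ K₂ * √α * H θ := by
    intro θ hθ
    have hr : A ^ 2 * α ^ 2 ≤ θ.1 ^ 2 + θ.2 ^ 2 := by
      rw [← mul_pow, ← sq_abs θ.1, ← sq_abs θ.2]
      rw [not_and_or, not_le, not_le] at hθ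
      have h0 : 0 ≤ A * α := by positivity
      rcases hθ with h | h
      · nlinarith [sq_nonneg |θ.2|, pow_le_pow_left₀ h0 h.le 2]
      · nlinarith [sq_nonneg |θ.1|, pow_le_pow_left₀ h0 h.le 2]
    refine (hG θ).2.trans ?_
    calc Real.exp (-c / α ^ 4 * (θ.1 ^ 2 + θ.2 ^ 2))
        = Real.exp (-(3 / 4 * c / α ^ 4 * (θ.1 ^ 2 + θ.2 ^ 2))) * H θ := by
          rw [hH, ← Real.exp_add]; congr 1; ring
      _ ≤ Real.exp (-(3 / 4 * c / α ^ 4 * (A ^ 2 * α ^ 2))) * H θ := by gcongr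
      _ = Real.exp (-(3 / 4 * c * A ^ 2) / α ^ 2) * H θ := by
          congr 2; field_simp
      _ ≤ _ := by
          gcongr
          exact exp_neg_div_sq_le (by positivity) hα hα1
  have hbox_sub : ∀ θ : ℝ × ℝ, |θ.1| ≤ A * α → |θ.2| ≤ A * α → θ ∈ torus := fun θ h1 h2 =>
    ⟨abs_le.mp (h1.trans hAα), abs_le.mp (h2.trans hAα)⟩
  have hFE : IntegrableOn (fun θ => F θ * E θ) torus :=
    (hF.mul hE).continuousOn.integrableOn_compact isCompact_torus
  have hpt : ∀ θ, ‖torus.indicator (fun θ => F θ * E θ) θ - (G θ : ℂ) * E θ‖ ≤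
      (K₁ + K₂) * √α * H θ + torus.indicator (fun _ => Real.exp (-c' / α)) θ := by
    intro θ
    have hK₁0 : 0 ≤ K₁ * √α * H θ := mul_nonneg (by positivity) (hH0 θ)
    have hK₂0 : 0 ≤ K₂ * √α * H θ := mul_nonneg (by positivity) (hH0 θ)
    have hGn : ‖(G θ : ℂ)‖ = G θ := by rw [Complex.norm_real, Real.norm_of_nonneg (hG θ).1]
    by_cases hb : |θ.1| ≤ A * α ∧ |θ.2| ≤ A * α
    · have hm := hbox_sub θ hb.1 hb.2
      rw [Set.indicator_of_mem hm, Set.indicator_of_mem hm, ← sub_mul, norm_mul, hE1, mul_one]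
      obtain ⟨hb1, hb2⟩ := hbox θ hb.1 hb.2
      have := le_sqrt_mul_gaussian hC hc hα (norm_nonneg _) hb2 (by
        refine (norm_sub_le _ _).trans ?_
        rw [hGn]; linarith [(hG θ).2])
      have h3 := (Real.exp_pos (-c' / α)).le
      have : ‖F θ - G θ‖ ≤ K₁ * √α * H θ := this
      linarith
    · have h1 := htail θ hb
      have h2 : ‖torus.indicator (fun θ => F θ * E θ) θ‖ ≤
          torus.indicator (fun _ => Real.exp (-c' / α)) θ := by
        by_cases hm : θ ∈ torus
        · rw [Set.indicator_of_mem hm, Set.indicator_of_mem hm, norm_mul, hE1, mul_one]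
          exact hout θ hm hb
        · rw [Set.indicator_of_notMem hm, Set.indicator_of_notMem hm, norm_zero]
      refine (norm_sub_le _ _).trans ?_
      rw [norm_mul, hE1, mul_one, hGn]
      linarith
  rw [← integral_indicator measurableSet_torus,
    ← integral_sub ((integrable_indicator_iff measurableSet_torus).mpr hFE) hGE]
  have hci : Integrable (torus.indicator fun _ : ℝ × ℝ => Real.exp (-c' / α)) :=
    (integrable_indicator_iff measurableSet_torus).mpr
      (continuous_const.continuousOn.integrableOn_compact isCompact_torus)
  have hvol : (volume : Measure (ℝ × ℝ)).real torus = (2 * Real.pi) ^ 2 := by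
    rw [Measure.volume_eq_prod, torus, measureReal_prod_prod, Real.volume_real_Icc_of_le
      (by linarith [Real.pi_pos])]
    ring
  calc _ ≤ ∫ θ, ((K₁ + K₂) * √α * H θ + torus.indicator (fun _ => Real.exp (-c' / α)) θ) :=
        norm_integral_le_of_norm_le ((hHint.const_mul _).add hci) (Eventually.of_forall hpt)
    _ = (K₁ + K₂) * √α * (4 * Real.pi / c * α ^ 4) + (2 * Real.pi) ^ 2 * Real.exp (-c' / α) := by
        rw [integral_add (hHint.const_mul _) hci, integral_const_mul, hHval,
          integral_indicator measurableSet_torus, setIntegral_const, hvol, smul_eq_mul]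
    _ ≤ (K₁ + K₂) * √α * (4 * Real.pi / c * α ^ 4) +
          (2 * Real.pi) ^ 2 * (120 / c' ^ 5 * (α ^ 4 * √α)) := by
        gcongr
        exact exp_neg_div_le hc' hα hα1
    _ = _ := by ring

/-- Local limit estimate for the endpoint: a two-sided bound of the order `α ^ 4` from bounds on
the moments and on the characteristic function. -/
lemma exists_local_limit_bounds {C₂ C₃ c c' A D : ℝ} (hC₂ : 0 < C₂) (hC₃ : 0 < C₃) (hc : 0 < c)
    (hc' : 0 < c') (hA : 0 < A) :
    ∃ α₀ > 0, ∃ m > 0, ∃ M > 0, ∀ α : ℝ, 0 < α → α < α₀ → ∀ (S : Finset CoprimePair)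
      (z : CoprimePair → ℝ) (n : ℕ × ℕ), (∀ x, 0 ≤ z x) → (∀ x, z x < 1) →
      (∀ x : CoprimePair, x.1.1 ≤ n.1 → x.1.2 ≤ n.2 → x ∈ S) →
      (∑ x ∈ S, geomMean (z x) * (1 + geomMean (z x)) * (x.1.1 : ℝ) ^ 2 ≤ C₂ / α ^ 4) →
      (∑ x ∈ S, geomMean (z x) * (1 + geomMean (z x)) * (x.1.2 : ℝ) ^ 2 ≤ C₂ / α ^ 4) →
      (∑ x ∈ S, geomMean (z x) * (1 + geomMean (z x)) ^ 2 * ((x.1.1 : ℝ) + x.1.2) ^ 3 ≤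
        C₃ / α ^ 5) →
      (∀ θ : ℝ × ℝ, 2 * c / α ^ 4 * (θ.1 ^ 2 + θ.2 ^ 2) ≤
        ∑ x ∈ S, geomMean (z x) * (1 + geomMean (z x)) * pairing θ x.1 ^ 2) →
      (∀ θ : ℝ × ℝ, |θ.1| ≤ A * α → |θ.2| ≤ A * α →
        ‖∏ x ∈ S, geomChar (z x) (pairing θ x.1)‖ ≤
          Real.exp (-c / α ^ 4 * (θ.1 ^ 2 + θ.2 ^ 2))) →
      (∀ θ ∈ torus, ¬(|θ.1| ≤ A * α ∧ |θ.2| ≤ A * α) →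
        ‖∏ x ∈ S, geomChar (z x) (pairing θ x.1)‖ ≤ Real.exp (-c' / α)) →
      (∑ x ∈ S, geomMean (z x) * x.1.1 - n.1) ^ 2 + (∑ x ∈ S, geomMean (z x) * x.1.2 - n.2) ^ 2 ≤
        D / α ^ 4 →
      ∑ ν ∈ (finite_endpoint_eq n).toFinset, ∏ x ∈ S, z x ^ ν x * (1 - z x) ∈
        Icc (m * α ^ 4) (M * α ^ 4) := by
  obtain ⟨K, hK, hKb⟩ := exists_integral_sub_le (C := 34 * C₃) (by positivity) hc hc' hA
  set m₀ := 2 * Real.pi / C₂ * Real.exp (-(D / (2 * c))) with hm₀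
  set M₀ := 2 * Real.pi / (2 * c) with hM₀
  have hm₀p : 0 < m₀ := by positivity
  have hM₀p : 0 < M₀ := by positivity
  -- The bound π/A keeps the box inside the torus, and (m₀/(2K))² makes the error K √α at most half
  -- of the lower constant m₀ of the Gaussian integral.
  refine ⟨min (min 1 (Real.pi / A)) ((m₀ / (2 * K)) ^ 2), by positivity,
    m₀ / 2 / (2 * Real.pi) ^ 2, by positivity, (M₀ + m₀) / (2 * Real.pi) ^ 2, by positivity, ?_⟩
  intro α hα hα₀ S z n h0 h1 hS hv1 hv2 h3 hV hbox hout hmean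
  rw [lt_min_iff, lt_min_iff] at hα₀
  obtain ⟨⟨hα1, hαA⟩, hαK⟩ := hα₀
  have hAα : A * α ≤ Real.pi := by
    rw [lt_div_iff₀ hA] at hαA; linarith
  have hKα : K * √α ≤ m₀ / 2 := by
    have : √α ≤ m₀ / (2 * K) := Real.sqrt_le_iff.mpr ⟨by positivity, hαK.le⟩
    calc K * √α ≤ K * (m₀ / (2 * K)) := by gcongr
      _ = _ := by field_simp
  set q : CoprimePair → ℝ := fun x => geomMean (z x) with hq
  have hq0 : ∀ x, 0 ≤ q x := fun x => geomMean_nonneg (h0 x) (h1 x)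
  set k₁₁ := ∑ x ∈ S, q x * (1 + q x) * (x.1.1 : ℝ) ^ 2 with hk11
  set k₁₂ := ∑ x ∈ S, q x * (1 + q x) * ((x.1.1 : ℝ) * x.1.2) with hk12
  set k₂₂ := ∑ x ∈ S, q x * (1 + q x) * (x.1.2 : ℝ) ^ 2 with hk22
  have hquad : ∀ θ, quadForm k₁₁ k₁₂ k₂₂ θ = ∑ x ∈ S, q x * (1 + q x) * pairing θ x.1 ^ 2 := by
    intro θ
    rw [quadForm, hk11, hk12, hk22, Finset.sum_mul, Finset.mul_sum, Finset.sum_mul, Finset.sum_mul,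
      ← Finset.sum_add_distrib, ← Finset.sum_add_distrib]
    refine Finset.sum_congr rfl fun x _ => ?_
    rw [pairing]; ring
  set μ : ℝ × ℝ := (∑ x ∈ S, q x * x.1.1, ∑ x ∈ S, q x * x.1.2) with hμ
  -- F is the characteristic function centred at the mean μ, while E keeps the oscillation with
  -- frequency μ - n. The Gaussian comparison concerns F alone.
  set F : ℝ × ℝ → ℂ := fun θ => ∏ x ∈ S, (geomChar (z x) (pairing θ x.1) *
    Complex.exp (-(q x * pairing θ x.1 : ℝ) * Complex.I)) with hF
  set E : ℝ × ℝ → ℂ := fun θ =>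
    Complex.exp ((θ.1 * (μ.1 - n.1) + θ.2 * (μ.2 - n.2) : ℝ) * Complex.I) with hE
  set G : ℝ × ℝ → ℝ := fun θ => Real.exp (-(quadForm k₁₁ k₁₂ k₂₂ θ / 2)) with hG
  have hFE : ∀ θ, (∏ x ∈ S, geomChar (z x) (pairing θ x.1)) *
      Complex.exp (-(pairing θ n : ℝ) * Complex.I) = F θ * E θ := by
    intro θ
    simp only [hF, hE]
    rw [Finset.prod_mul_distrib, mul_assoc, ← Complex.exp_sum, ← Complex.exp_add]
    congr 2
    rw [← Finset.sum_mul, ← add_mul]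
    congr 1
    simp only [hμ, pairing]
    push_cast
    rw [Finset.sum_neg_distrib]
    simp only [mul_sub, Finset.mul_sum, mul_add, Finset.sum_add_distrib]
    have e1 : ∑ x ∈ S, (q x : ℂ) * (θ.1 * (x.1.1 : ℂ)) = ∑ x ∈ S, (θ.1 : ℂ) * (q x * x.1.1) :=
      Finset.sum_congr rfl fun _ _ => by ring
    have e2 : ∑ x ∈ S, (q x : ℂ) * (θ.2 * (x.1.2 : ℂ)) = ∑ x ∈ S, (θ.2 : ℂ) * (q x * x.1.2) :=
      Finset.sum_congr rfl fun _ _ => by ring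
    rw [e1, e2]
    ring
  have hFn : ∀ θ, ‖F θ‖ = ‖∏ x ∈ S, geomChar (z x) (pairing θ x.1)‖ := by
    intro θ
    have := congrArg norm (hFE θ)
    rw [norm_mul, norm_mul, ← Complex.ofReal_neg, Complex.norm_exp_ofReal_mul_I,
      Complex.norm_exp_ofReal_mul_I, mul_one, mul_one] at this
    exact this.symm
  have hgc : ∀ x, Continuous fun θ : ℝ × ℝ => geomChar (z x) (pairing θ x.1) := by
    intro x
    unfold geomChar
    have := continuous_pairing x.1
    refine Continuous.div continuous_const (by fun_prop) fun θ h => ?_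
    have h2 : (z x : ℂ) * Complex.exp ((pairing θ x.1 : ℝ) * Complex.I) = 1 := by
      linear_combination -h
    have h3 := congrArg norm h2
    rw [norm_mul, Complex.norm_exp_ofReal_mul_I, mul_one, Complex.norm_real,
      Real.norm_of_nonneg (h0 x), norm_one] at h3
    linarith [h1 x]
  have hFc : Continuous F := by
    refine continuous_finsetProd S fun x _ => (hgc x).mul ?_
    have := continuous_pairing x.1
    fun_prop
  have hEc : Continuous E := by simp only [hE]; fun_prop
  have hlow : ∀ θ : ℝ × ℝ, 2 * c * (1 / α ^ 4) * (θ.1 ^ 2 + θ.2 ^ 2) ≤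
      quadForm k₁₁ k₁₂ k₂₂ θ := by
    intro θ
    rw [hquad]
    refine le_trans (le_of_eq (by ring)) (hV θ)
  have hGE := integrable_gaussian_char (c := 2 * c * (1 / α ^ 4)) (by positivity) hlow
    (μ.1 - n.1, μ.2 - n.2)
  have herr := hKb α hα hα1.le hAα F E G hFc hEc hGE
    (fun θ => Complex.norm_exp_ofReal_mul_I _) (fun θ => ⟨(Real.exp_pos _).le, by
      simp only [hG]
      gcongr
      have := hlow θ
      have e : -c / α ^ 4 * (θ.1 ^ 2 + θ.2 ^ 2) =
        -(2 * c * (1 / α ^ 4) * (θ.1 ^ 2 + θ.2 ^ 2) / 2) := by ring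
      linarith⟩)
    (fun θ ht1 ht2 => ⟨by rw [hFn]; exact hbox θ ht1 ht2, by
      have e : ((G θ : ℝ) : ℂ) = ∏ x ∈ S, ((Real.exp (-(q x * (1 + q x) *
          pairing θ x.1 ^ 2 / 2)) : ℝ) : ℂ) := by
        rw [← Complex.ofReal_prod, ← Real.exp_sum]
        simp only [hG]
        rw [hquad, Finset.sum_neg_distrib, Finset.sum_div]
      rw [e]
      refine (norm_prod_sub_prod_le S _ _ ?_ ?_).trans ?_
      · intro x _
        rw [norm_mul, ← Complex.ofReal_neg, Complex.norm_exp_ofReal_mul_I, mul_one]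
        exact norm_geomChar_le_one (h0 x) (h1 x) _
      · intro x _
        rw [Complex.norm_real, Real.norm_of_nonneg (Real.exp_pos _).le, Real.exp_le_one_iff]
        have := mul_nonneg (hq0 x) (by linarith [hq0 x] : 0 ≤ 1 + q x)
        have : 0 ≤ q x * (1 + q x) * pairing θ x.1 ^ 2 / 2 := by positivity
        linarith
      · calc _ ≤ ∑ x ∈ S, 34 * (q x * (1 + q x) ^ 2 * (((|θ.1| + |θ.2|) ^ 3) *
                ((x.1.1 : ℝ) + x.1.2) ^ 3)) := by
              refine Finset.sum_le_sum fun x _ => ?_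
              refine (norm_geomChar_sub_gaussian_le (h0 x) (h1 x) _).trans ?_
              have hqx := hq0 x
              rw [← mul_pow]
              simp only [hq]
              have := geomMean_nonneg (h0 x) (h1 x)
              gcongr
              exact abs_pairing_le θ x.1
          _ = 34 * (|θ.1| + |θ.2|) ^ 3 *
              ∑ x ∈ S, q x * (1 + q x) ^ 2 * ((x.1.1 : ℝ) + x.1.2) ^ 3 := by
              rw [Finset.mul_sum]
              exact Finset.sum_congr rfl fun x _ => by ring
          _ ≤ 34 * (|θ.1| + |θ.2|) ^ 3 * (C₃ / α ^ 5) := by gcongr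
          _ = _ := by ring⟩)
    (fun θ ht hb => by rw [hFn]; exact hout θ ht hb)
  obtain ⟨I, hI, hI1, hI2⟩ := gaussian_char_bounds (c := 2 * c) (C := C₂) (D := D)
    (R := 1 / α ^ 4) (by positivity) (by positivity) hlow
    (hv1.trans (le_of_eq (by ring))) (hv2.trans (le_of_eq (by ring)))
    (b := (μ.1 - n.1, μ.2 - n.2)) (hmean.trans (le_of_eq (by ring)))
  have hJ := setIntegral_prod_geomChar (n := n) h0 h1 hS
  simp_rw [hFE] at hJ
  set P := ∑ ν ∈ (finite_endpoint_eq n).toFinset, ∏ x ∈ S, z x ^ ν x * (1 - z x)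
  have hI' : ∫ θ, (G θ : ℂ) * E θ = (I : ℂ) := hI
  rw [hJ, hI', ← Complex.ofReal_mul, ← Complex.ofReal_sub, Complex.norm_real, Real.norm_eq_abs,
    abs_le] at herr
  have hI1' : m₀ * α ^ 4 ≤ I := by
    refine le_trans (le_of_eq ?_) hI1
    rw [hm₀]; field_simp
  have hI2' : I ≤ M₀ * α ^ 4 := by
    refine hI2.trans (le_of_eq ?_)
    rw [hM₀]; field_simp
  have hKα4 : K * √α * α ^ 4 ≤ m₀ / 2 * α ^ 4 := by gcongr
  have hα4 : 0 < α ^ 4 := by positivity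
  have hπ : 0 < (2 * Real.pi) ^ 2 := by positivity
  rw [mem_Icc, div_mul_eq_mul_div (m₀ / 2), div_mul_eq_mul_div (M₀ + m₀), div_le_iff₀ hπ,
    le_div_iff₀ hπ]
  constructor <;> linarith [herr.1, herr.2]

end LatticeLLT

namespace LatticeLLT
open ConvexLattice (CoprimePair)

/-! ### Moment bounds for geometric variables indexed by a cone -/

/-- The cone has at most B k + 1 ≤ (B + 1) k points of abscissa k ≥ 1, and ∑ k e^{-ck} ≤ 4/c². With
c of the order α this counts about α⁻² relevant points. -/
lemma sum_exp_neg_le {c : ℝ} (hc : 0 < c) (B : ℕ) (S : Finset CoprimePair)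
    (hS : ∀ x ∈ S, 1 ≤ x.1.1 ∧ x.1.2 ≤ B * x.1.1) :
    ∑ x ∈ S, Real.exp (-(c * x.1.1)) ≤ 4 * (B + 1) / c ^ 2 := by
  classical
  set N := S.sup (fun x : CoprimePair => x.1.1) + 1
  set r := Real.exp (-c) with hr
  have hr0 : 0 < r := Real.exp_pos _
  have hr1 : r < 1 := Real.exp_lt_one_iff.mpr (by linarith)
  have hpow : ∀ k : ℕ, Real.exp (-(c * k)) = r ^ k := by
    intro k; rw [hr, ← Real.exp_nat_mul]; congr 1; ring
  have h1 : ∑ x ∈ S, Real.exp (-(c * x.1.1)) ≤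
      ∑ k ∈ Finset.Ico 1 N, ∑ _j ∈ Finset.range (B * k + 1), r ^ k := by
    rw [Finset.sum_sigma']
    set φ : CoprimePair → Σ _ : ℕ, ℕ := fun x => ⟨x.1.1, x.1.2⟩ with hφ
    have hinj : Set.InjOn φ S := by
      intro x _ y _ h
      simp only [hφ, Sigma.mk.injEq, heq_eq_eq] at h
      exact Subtype.ext (Prod.ext h.1 h.2)
    have e : ∑ x ∈ S, Real.exp (-(c * x.1.1)) = ∑ p ∈ S.image φ, r ^ p.1 := by
      rw [Finset.sum_image hinj]
      exact Finset.sum_congr rfl fun x _ => hpow _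
    rw [e]
    refine Finset.sum_le_sum_of_subset_of_nonneg ?_ fun _ _ _ => by positivity
    intro p hp
    obtain ⟨x, hx, rfl⟩ := Finset.mem_image.mp hp
    simp only [hφ, Finset.mem_sigma, Finset.mem_Ico, Finset.mem_range]
    have := hS x hx
    have h2 : x.1.1 ≤ S.sup (fun x : CoprimePair => x.1.1) :=
      Finset.le_sup (f := fun x : CoprimePair => x.1.1) hx
    omega
  have h2 : ∑ k ∈ Finset.Ico 1 N, ∑ _j ∈ Finset.range (B * k + 1), r ^ k ≤
      (B + 1) * ∑ k ∈ Finset.Ico 1 N, (k : ℝ) * r ^ k := by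
    rw [Finset.mul_sum]
    refine Finset.sum_le_sum fun k hk => ?_
    rw [Finset.sum_const, Finset.card_range, nsmul_eq_mul]
    have hk1 : (1 : ℝ) ≤ k := by exact_mod_cast (Finset.mem_Ico.mp hk).1
    push_cast
    rw [← mul_assoc]
    gcongr
    nlinarith [(Nat.cast_nonneg B : (0 : ℝ) ≤ B)]
  have hn : ‖r‖ < 1 := by rwa [Real.norm_of_nonneg hr0.le]
  have h3 : ∑ k ∈ Finset.Ico 1 N, (k : ℝ) * r ^ k ≤ r / (1 - r) ^ 2 :=
    sum_le_hasSum _ (fun k _ => by positivity) (hasSum_coe_mul_geometric_of_norm_lt_one hn)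
  have h4 : r / (1 - r) ^ 2 ≤ 4 / c ^ 2 := by
    have h5 : c / (1 + c) ≤ 1 - r := by
      have h6 : r ≤ 1 / (1 + c) := by
        rw [hr, Real.exp_neg, one_div]
        gcongr
        linarith [Real.add_one_le_exp c]
      have : c / (1 + c) = 1 - 1 / (1 + c) := by field_simp; ring
      linarith
    have h7 : 1 + c ≤ 2 * Real.exp (c / 2) := by linarith [Real.add_one_le_exp (c / 2)]
    have h8 : (1 + c) ^ 2 * r ≤ 4 := by
      calc (1 + c) ^ 2 * r ≤ (2 * Real.exp (c / 2)) ^ 2 * r := by gcongr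
        _ = 4 * (Real.exp (2 * (c / 2)) * Real.exp (-c)) := by
            rw [hr, mul_pow, ← Real.exp_nat_mul]; push_cast; ring
        _ = 4 := by rw [← Real.exp_add]; ring_nf; simp
    calc r / (1 - r) ^ 2 ≤ r / (c / (1 + c)) ^ 2 := by gcongr
      _ = (1 + c) ^ 2 * r / c ^ 2 := by field_simp
      _ ≤ _ := by gcongr
  calc _ ≤ (B + 1 : ℝ) * (4 / c ^ 2) := by
        refine h1.trans (h2.trans ?_)
        gcongr
        exact h3.trans h4
    _ = _ := by ring

lemma geomMean_le_of_le_exp {z s : ℝ} (hs : 0 < s) (h : z ≤ Real.exp (-s)) :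
    1 + geomMean z ≤ (1 + s) / s ∧ geomMean z ≤ Real.exp (-s) * ((1 + s) / s) := by
  have h1 : Real.exp (-s) ≤ 1 / (1 + s) := by
    rw [Real.exp_neg, one_div]
    gcongr
    linarith [Real.add_one_le_exp s]
  have h2 : s / (1 + s) ≤ 1 - z := by
    have : s / (1 + s) = 1 - 1 / (1 + s) := by field_simp; ring
    linarith
  have h3 : 0 < s / (1 + s) := by positivity
  have h4 : (1 - z)⁻¹ ≤ (1 + s) / s := by
    rw [← inv_div s]; gcongr
  have h5 : 1 + geomMean z = (1 - z)⁻¹ := by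
    have : 1 - z ≠ 0 := by linarith
    rw [geomMean]; field_simp; ring
  refine ⟨h5 ▸ h4, ?_⟩
  rw [geomMean, div_eq_mul_inv]
  have : 0 < 1 - z := by linarith
  gcongr

lemma cube_one_add_mul_exp_le {s : ℝ} (hs : 0 ≤ s) :
    (1 + s) ^ 3 * Real.exp (-s) ≤ 196 * Real.exp (-(s / 2)) := by
  have h1 := Real.pow_div_factorial_le_exp (s / 2) (by positivity) 3
  have h2 : (1 : ℝ) ≤ Real.exp (s / 2) := Real.one_le_exp (by positivity)
  -- Here (1 + s)³ ≤ 4 + 4 s³ and s³ ≤ 48 e^{s/2}, whence 196 = 4 + 4 · 48.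
  have h3 : (1 + s) ^ 3 ≤ 196 * Real.exp (s / 2) := by
    norm_num [Nat.factorial] at h1
    nlinarith [mul_nonneg hs (sq_nonneg (s - 1)), sq_nonneg (s - 1), sq_nonneg (s + 1),
      mul_nonneg (by linarith : 0 ≤ s + 1) (sq_nonneg (s - 1))]
  calc (1 + s) ^ 3 * Real.exp (-s) ≤ 196 * Real.exp (s / 2) * Real.exp (-s) := by gcongr
    _ = _ := by rw [mul_assoc, ← Real.exp_add]; congr 2; ring

/-- For small s the mean q is of size 1/s at most, and the powers of s compensate exactly; for large
s everything is exponentially small. Half of the exponent is kept for summation over the cone. -/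
lemma geomMean_moment_bounds {z s : ℝ} (hs : 0 < s) (h0 : 0 ≤ z) (h : z ≤ Real.exp (-s)) :
    geomMean z * (1 + geomMean z) ^ 2 * s ^ 3 ≤ 196 * Real.exp (-(s / 2)) ∧
      geomMean z * (1 + geomMean z) * s ^ 2 ≤ 196 * Real.exp (-(s / 2)) := by
  obtain ⟨h1, h2⟩ := geomMean_le_of_le_exp hs h
  have hz1 : z < 1 := h.trans_lt (Real.exp_lt_one_iff.mpr (by linarith))
  have hq := geomMean_nonneg h0 hz1
  have h3 := cube_one_add_mul_exp_le hs.le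
  constructor
  · calc _ ≤ Real.exp (-s) * ((1 + s) / s) * ((1 + s) / s) ^ 2 * s ^ 3 := by gcongr
      _ = (1 + s) ^ 3 * Real.exp (-s) := by field_simp
      _ ≤ _ := h3
  · calc _ ≤ Real.exp (-s) * ((1 + s) / s) * ((1 + s) / s) * s ^ 2 := by gcongr
      _ = (1 + s) ^ 2 * Real.exp (-s) := by field_simp
      _ ≤ (1 + s) ^ 3 * Real.exp (-s) := by
          gcongr <;> linarith
      _ ≤ _ := h3

/-- Parameters that are dominated by an exponential function on a cone and vanish off it. -/
structure ConeDominated (m : ℝ) (B : ℕ) (α : ℝ) (z : CoprimePair → ℝ) : Prop where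
  nonneg : ∀ x, 0 ≤ z x
  le_exp : ∀ x : CoprimePair, z x ≤ Real.exp (-(m * α * x.1.1))
  support : ∀ x : CoprimePair, z x ≠ 0 → 1 ≤ x.1.1 ∧ x.1.2 ≤ B * x.1.1

lemma ConeDominated.lt_one {m α : ℝ} {B : ℕ} {z : CoprimePair → ℝ} (h : ConeDominated m B α z)
    (hm : 0 < m) (hα : 0 < α) (x : CoprimePair) : z x < 1 := by
  by_cases hx : z x = 0
  · rw [hx]; exact one_pos
  · refine (h.le_exp x).trans_lt (Real.exp_lt_one_iff.mpr ?_)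
    have : (1 : ℝ) ≤ x.1.1 := by exact_mod_cast (h.support x hx).1
    have : 0 < m * α * x.1.1 := by positivity
    linarith

lemma ConeDominated.sum_le {m α : ℝ} {B : ℕ} {z : CoprimePair → ℝ} (h : ConeDominated m B α z)
    (hm : 0 < m) (hα : 0 < α) (S : Finset CoprimePair) (F : CoprimePair → ℝ) {K : ℝ}
    (hK : 0 ≤ K) (hF0 : ∀ x, z x = 0 → F x = 0)
    (hF : ∀ x, z x ≠ 0 → F x ≤ K * Real.exp (-(m * α * x.1.1 / 2))) :
    ∑ x ∈ S, F x ≤ K * (16 * (B + 1) / (m ^ 2 * α ^ 2)) := by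
  classical
  have h1 : ∑ x ∈ S, F x = ∑ x ∈ S.filter (fun x => z x ≠ 0), F x := by
    rw [Finset.sum_filter]
    refine Finset.sum_congr rfl fun x _ => ?_
    split_ifs with hx
    · rfl
    · exact hF0 x (not_not.mp hx)
  rw [h1]
  have h2 := sum_exp_neg_le (c := m * α / 2) (by positivity) B (S.filter fun x => z x ≠ 0)
    (fun x hx => h.support x (Finset.mem_filter.mp hx).2)
  calc _ ≤ ∑ x ∈ S.filter (fun x => z x ≠ 0), K * Real.exp (-(m * α / 2 * x.1.1)) := by
        refine Finset.sum_le_sum fun x hx => (hF x (Finset.mem_filter.mp hx).2).trans (le_of_eq ?_)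
        congr 3; ring
    _ ≤ K * (4 * (B + 1) / (m * α / 2) ^ 2) := by rw [← Finset.mul_sum]; gcongr
    _ = _ := by field_simp; ring

lemma ConeDominated.summable {m α : ℝ} {B : ℕ} {z : CoprimePair → ℝ} (h : ConeDominated m B α z)
    (hm : 0 < m) (hα : 0 < α) : Summable z :=
  summable_of_sum_le h.nonneg fun S => h.sum_le hm hα S z zero_le_one (fun _ => id) fun x _ => by
    refine (h.le_exp x).trans ?_
    rw [one_mul]
    gcongr
    have : 0 ≤ m * α * x.1.1 := by positivity
    linarith

lemma geomMean_zero : geomMean 0 = 0 := by simp [geomMean]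

/-- Each term is O(α⁻² exp(-m α x₁/2)), by the moment bound with s = m α x₁; summation over the cone
contributes the other α⁻². -/
lemma ConeDominated.second_moment_le {m α : ℝ} {B : ℕ} {z : CoprimePair → ℝ}
    (h : ConeDominated m B α z) (hm : 0 < m) (hα : 0 < α) (S : Finset CoprimePair) :
    ∑ x ∈ S, geomMean (z x) * (1 + geomMean (z x)) * (x.1.1 : ℝ) ^ 2 ≤
        3136 * (B + 1) / m ^ 4 / α ^ 4 ∧
      ∑ x ∈ S, geomMean (z x) * (1 + geomMean (z x)) * (x.1.2 : ℝ) ^ 2 ≤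
        3136 * (B + 1) * B ^ 2 / m ^ 4 / α ^ 4 := by
  have key : ∀ x, z x ≠ 0 → geomMean (z x) * (1 + geomMean (z x)) * (x.1.1 : ℝ) ^ 2 ≤
      196 / (m * α) ^ 2 * Real.exp (-(m * α * x.1.1 / 2)) := by
    intro x hx
    have hx1 : (1 : ℝ) ≤ x.1.1 := by exact_mod_cast (h.support x hx).1
    have := (geomMean_moment_bounds (s := m * α * x.1.1) (by positivity) (h.nonneg x)
      (h.le_exp x)).2
    rw [div_mul_eq_mul_div, le_div_iff₀ (by positivity)]
    linarith
  constructor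
  · refine (h.sum_le hm hα S _ (K := 196 / (m * α) ^ 2) (by positivity) ?_ key).trans (le_of_eq ?_)
    · intro x hx; rw [hx, geomMean_zero]; simp
    · field_simp; ring
  · refine (h.sum_le hm hα S _ (K := B ^ 2 * (196 / (m * α) ^ 2)) (by positivity) ?_ ?_).trans
      (le_of_eq ?_)
    · intro x hx; rw [hx, geomMean_zero]; simp
    · intro x hx
      have hq := geomMean_nonneg (h.nonneg x) (h.lt_one hm hα x)
      have hx2 : (x.1.2 : ℝ) ≤ B * x.1.1 := by exact_mod_cast (h.support x hx).2
      calc _ ≤ geomMean (z x) * (1 + geomMean (z x)) * (B * x.1.1 : ℝ) ^ 2 := by gcongr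
        _ = B ^ 2 * (geomMean (z x) * (1 + geomMean (z x)) * (x.1.1 : ℝ) ^ 2) := by ring
        _ ≤ B ^ 2 * (196 / (m * α) ^ 2 * Real.exp (-(m * α * x.1.1 / 2))) := by
            exact mul_le_mul_of_nonneg_left (key x hx) (by positivity)
        _ = _ := by ring
    · field_simp; ring

lemma ConeDominated.third_moment_le {m α : ℝ} {B : ℕ} {z : CoprimePair → ℝ}
    (h : ConeDominated m B α z) (hm : 0 < m) (hα : 0 < α) (S : Finset CoprimePair) :
    ∑ x ∈ S, geomMean (z x) * (1 + geomMean (z x)) ^ 2 * ((x.1.1 : ℝ) + x.1.2) ^ 3 ≤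
      3136 * (B + 1) ^ 4 / m ^ 5 / α ^ 5 := by
  refine (h.sum_le hm hα S _ (K := (B + 1) ^ 3 * (196 / (m * α) ^ 3)) (by positivity) ?_ ?_).trans
    (le_of_eq ?_)
  · intro x hx; rw [hx, geomMean_zero]; simp
  · intro x hx
    have hq := geomMean_nonneg (h.nonneg x) (h.lt_one hm hα x)
    have hx1 : (1 : ℝ) ≤ x.1.1 := by exact_mod_cast (h.support x hx).1
    have hx2 : (x.1.2 : ℝ) ≤ B * x.1.1 := by exact_mod_cast (h.support x hx).2
    have := (geomMean_moment_bounds (s := m * α * x.1.1) (by positivity) (h.nonneg x)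
      (h.le_exp x)).1
    calc _ ≤ geomMean (z x) * (1 + geomMean (z x)) ^ 2 * ((B + 1) * x.1.1 : ℝ) ^ 3 := by
          gcongr; linarith
      _ = (B + 1) ^ 3 / (m * α) ^ 3 *
          (geomMean (z x) * (1 + geomMean (z x)) ^ 2 * (m * α * x.1.1 : ℝ) ^ 3) := by
          field_simp
      _ ≤ (B + 1) ^ 3 / (m * α) ^ 3 * (196 * Real.exp (-(m * α * x.1.1 / 2))) := by gcongr
      _ = _ := by ring
  · field_simp; ring

end LatticeLLT

namespace LatticeLLT
open ConvexLattice (CoprimePair kappa)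

/-! ### Nondegeneracy of the covariance form -/

lemma div_exp_sub_one_le {k : ℕ} (hk : 1 ≤ k) {α : ℝ} (hα : 0 < α) :
    (k : ℝ) / (Real.exp (α * k) - 1) ≤ 1 / α := by
  have hk' : (1 : ℝ) ≤ k := by exact_mod_cast hk
  have h : α * k ≤ Real.exp (α * k) - 1 := by linarith [Real.add_one_le_exp (α * k)]
  calc (k : ℝ) / (Real.exp (α * k) - 1) ≤ k / (α * k) := by gcongr
    _ = 1 / α := by field_simp

lemma div_exp_sub_one_le_of_large {k : ℕ} (hk : 1 ≤ k) {α K : ℝ} (hα : 0 < α) (hK : 1 ≤ K)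
    (h : K < α * k) :
    (k : ℝ) / (Real.exp (α * k) - 1) ≤ 32 / (K * α) * Real.exp (-(α / 2 * k)) := by
  set s := α * k with hs
  have hs0 : 0 < s := by linarith
  have h1 : Real.exp s / 2 ≤ Real.exp s - 1 := by
    have : 2 ≤ Real.exp s := by linarith [Real.add_one_le_exp s]
    linarith
  have h2 : s / 4 ≤ Real.exp (s / 4) := by linarith [Real.add_one_le_exp (s / 4)]
  have h3 : Real.exp s = Real.exp (s / 4) * Real.exp (s / 4) * Real.exp (s / 2) := by
    rw [← Real.exp_add, ← Real.exp_add]; congr 1; ring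
  have hk' : (k : ℝ) = s / α := by rw [hs]; field_simp
  have he : Real.exp (-(α / 2 * k)) = (Real.exp (s / 2))⁻¹ := by
    rw [← Real.exp_neg, hs]; congr 1; ring
  calc (k : ℝ) / (Real.exp s - 1) ≤ (s / α) / (Real.exp s / 2) := by
        rw [hk']; gcongr
    _ ≤ (s / α) / ((s / 4) * (K / 4) * Real.exp (s / 2) / 2) := by
        rw [h3]
        gcongr
        linarith
    _ = _ := by
        rw [he]
        have : Real.exp (s / 2) ≠ 0 := (Real.exp_pos _).ne'
        field_simp
        norm_num

lemma finite_coprimePair_le (N₁ N₂ : ℝ) :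
    {x : CoprimePair | (x.1.1 : ℝ) ≤ N₁ ∧ (x.1.2 : ℝ) ≤ N₂}.Finite := by
  refine Set.Finite.of_finite_image (f := Subtype.val) ?_ Subtype.val_injective.injOn
  refine (Set.finite_Iic (⌊N₁⌋₊, ⌊N₂⌋₊)).subset ?_
  rintro _ ⟨x, hx, rfl⟩
  exact ⟨Nat.le_floor hx.1, Nat.le_floor hx.2⟩

/-- The density of primitive points is taken from `exists_primitive_sum_error` with Φ = ψ = 1: the
sum of f = x₁ / (e^{α x₁} - 1) is of the order α⁻³. Points with α x₁ < ε are few and those with α x₁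
> K carry little weight, so at least half of the lower bound remains on the middle range. There f ≤
1/α ≤ α x₁²/ε². -/
lemma exists_sum_sq_ge {a b : ℝ} (ha : 0 ≤ a) (hab : a < b) :
    ∃ K > 0, ∃ c > 0, ∃ α₀ > 0, ∀ α : ℝ, 0 < α → α < α₀ → ∃ T : Finset CoprimePair,
      (∀ x ∈ T, 1 ≤ x.1.1 ∧ a ≤ (x.1.2 : ℝ) / x.1.1 ∧ (x.1.2 : ℝ) / x.1.1 ≤ b ∧ α * x.1.1 ≤ K) ∧
      c / α ^ 4 ≤ ∑ x ∈ T, (x.1.1 : ℝ) ^ 2 := by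
  classical
  obtain ⟨C, hC, hS⟩ := exists_primitive_sum_error (Φ := fun _ => 1) (ψ := fun _ => 1) (a := a)
    (b := b) (m := 1) (M := 1) (L := 0) one_pos ha hab.le (fun _ => le_rfl) (fun _ => le_rfl)
    (by simp) (by simp) (by simp)
  set B := ⌈b⌉₊ with hB
  set c₁ := kappa ^ 3 * (b - a) / 2 with hc₁
  have hκ := kappa_pos
  have hc₁p : 0 < c₁ := by
    have : 0 < b - a := by linarith
    positivity
  -- Points with α x₁ < ε are counted with the majorant e · exp(-(α/ε) x₁) ≥ 1; each of the two
  -- discarded ranges is allowed a quarter of c₁.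
  obtain ⟨ε, hε, hεb⟩ : ∃ ε : ℝ, 0 < ε ∧ 4 * Real.exp 1 * (B + 1) * ε ^ 2 ≤ c₁ / 4 := by
    refine ⟨√(c₁ / 4 / (4 * Real.exp 1 * (B + 1))), by positivity, ?_⟩
    rw [Real.sq_sqrt (by positivity)]
    apply le_of_eq; field_simp
  obtain ⟨K, hK, hKb⟩ : ∃ K : ℝ, 1 ≤ K ∧ 512 * (B + 1) / K ≤ c₁ / 4 := by
    refine ⟨max 1 (512 * (B + 1) / (c₁ / 4)), le_max_left _ _, ?_⟩
    rw [div_le_comm₀ (by positivity) (by positivity)]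
    exact le_max_right _ _
  refine ⟨K, by linarith, ε ^ 2 * (c₁ / 2), by positivity, c₁ / C, by positivity,
    fun α hα hα₀ => ?_⟩
  obtain ⟨W, hW, hWb⟩ := hS 1 α (by norm_num) hα
  set f : CoprimePair → ℝ := fun x => if InCone 1 a b x.1 then
    (x.1.1 : ℝ) / (Real.exp (α * x.1.1) - 1) else 0 with hf
  have hW' : HasSum f W := by
    have e : f = fun x : CoprimePair => if InCone 1 a b x.1 then (x.1.1 : ℝ) * 1 /
        (Real.exp (α * x.1.1 * 1) - 1) else 0 := by
      funext x; simp only [hf, mul_one]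
    rw [e]
    exact hW
  have hWlow : c₁ / α ^ 3 ≤ W := by
    have h1 : C / α ^ 2 ≤ c₁ / α ^ 3 := by
      rw [lt_div_iff₀ hC] at hα₀
      rw [div_le_div_iff₀ (by positivity) (by positivity)]
      have : 0 < α ^ 2 := by positivity
      nlinarith
    have h2 : ConvexLattice.kappa ^ 3 / (1 * α ^ 3) * ∫ t in a..b, (1 : ℝ) / 1 ^ 3 =
        2 * (c₁ / α ^ 3) := by
      simp [hc₁]; field_simp
    rw [h2] at hWb
    linarith [(abs_le.mp hWb).1]
  have hcone : ∀ x : CoprimePair, InCone 1 a b x.1 →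
      1 ≤ x.1.1 ∧ a ≤ (x.1.2 : ℝ) / x.1.1 ∧ (x.1.2 : ℝ) / x.1.1 ≤ b := by
    intro x hx
    simpa only [InCone, one_mul] using hx
  have hB' : ∀ x : CoprimePair, InCone 1 a b x.1 → (x.1.2 : ℝ) ≤ b * x.1.1 := by
    intro x hx
    obtain ⟨h1, -, h3⟩ := hcone x hx
    rwa [div_le_iff₀ (by exact_mod_cast h1)] at h3
  have hBn : ∀ x : CoprimePair, InCone 1 a b x.1 → x.1.2 ≤ B * x.1.1 := by
    intro x hx
    have : (x.1.2 : ℝ) ≤ B * x.1.1 := (hB' x hx).trans (by gcongr; exact Nat.le_ceil b)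
    exact_mod_cast this
  have hfin : {x : CoprimePair | InCone 1 a b x.1 ∧ ε ≤ α * x.1.1 ∧ α * x.1.1 ≤ K}.Finite := by
    refine (finite_coprimePair_le (K / α) (b * (K / α))).subset ?_
    rintro x ⟨h1, -, h3⟩
    have h4 : (x.1.1 : ℝ) ≤ K / α := by rw [le_div_iff₀ hα]; linarith
    exact ⟨h4, (hB' x h1).trans (by gcongr; linarith)⟩
  set T := hfin.toFinset with hT
  have hTmem : ∀ x, x ∈ T ↔ InCone 1 a b x.1 ∧ ε ≤ α * x.1.1 ∧ α * x.1.1 ≤ K := by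
    intro x; rw [hT, Set.Finite.mem_toFinset]; rfl
  refine ⟨T, fun x hx => ?_, ?_⟩
  · obtain ⟨h1, -, h3⟩ := (hTmem x).mp hx
    obtain ⟨h4, h5, h6⟩ := hcone x h1
    exact ⟨h4, h5, h6, h3⟩
  have hf1 : ∀ x, InCone 1 a b x.1 → f x ≤ 1 / α := by
    intro x hx
    simp only [hf, if_pos hx]
    exact div_exp_sub_one_le (hcone x hx).1 hα
  have hfT : ∑ x ∈ T, f x ≤ α / ε ^ 2 * ∑ x ∈ T, (x.1.1 : ℝ) ^ 2 := by
    rw [Finset.mul_sum]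
    refine Finset.sum_le_sum fun x hx => ?_
    obtain ⟨h1, h2, -⟩ := (hTmem x).mp hx
    refine (hf1 x h1).trans ?_
    rw [div_mul_eq_mul_div, div_le_div_iff₀ hα (by positivity)]
    nlinarith [pow_le_pow_left₀ hε.le h2 2]
  have hall : W ≤ ∑ x ∈ T, f x + c₁ / 4 / α ^ 3 + c₁ / 4 / α ^ 3 := by
    refine hasSum_le_of_sum_le hW' fun s => ?_
    have hsplit : ∀ x, f x ≤ (if x ∈ T then f x else 0) +
        (if InCone 1 a b x.1 then Real.exp 1 / α * Real.exp (-(α / ε * x.1.1)) else 0) +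
        (if InCone 1 a b x.1 then 32 / (K * α) * Real.exp (-(α / 2 * x.1.1)) else 0) := by
      intro x
      by_cases hx : InCone 1 a b x.1
      · have hp1 : 0 < Real.exp 1 / α * Real.exp (-(α / ε * x.1.1)) := by positivity
        have hp2 : 0 < 32 / (K * α) * Real.exp (-(α / 2 * x.1.1)) := by positivity
        rw [if_pos hx, if_pos hx]
        by_cases h1 : ε ≤ α * x.1.1
        · by_cases h2 : α * x.1.1 ≤ K
          · rw [if_pos ((hTmem x).mpr ⟨hx, h1, h2⟩)]; linarith
          · have h3 : f x ≤ 32 / (K * α) * Real.exp (-(α / 2 * x.1.1)) := by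
              simp only [hf, if_pos hx]
              exact div_exp_sub_one_le_of_large (hcone x hx).1 hα hK (not_le.mp h2)
            rw [if_neg fun h => h2 ((hTmem x).mp h).2.2]
            linarith
        · rw [if_neg fun h => h1 ((hTmem x).mp h).2.1]
          have h3 : (1 : ℝ) ≤ Real.exp 1 * Real.exp (-(α / ε * x.1.1)) := by
            rw [← Real.exp_add]
            apply Real.one_le_exp
            have : α / ε * x.1.1 ≤ 1 := by
              rw [div_mul_eq_mul_div, div_le_one hε]; linarith
            linarith
          have h4 : f x ≤ Real.exp 1 / α * Real.exp (-(α / ε * x.1.1)) := by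
            refine (hf1 x hx).trans ?_
            rw [div_mul_eq_mul_div]; gcongr
          linarith
      · have : f x = 0 := by simp only [hf, if_neg hx]
        rw [if_neg hx, if_neg hx, this]
        simp
    clear_value f
    refine (Finset.sum_le_sum fun x _ => hsplit x).trans ?_
    rw [Finset.sum_add_distrib, Finset.sum_add_distrib, ← Finset.sum_filter, ← Finset.sum_filter,
      ← Finset.sum_filter, ← Finset.mul_sum, ← Finset.mul_sum]
    have hcs : ∀ x ∈ s.filter (fun x => InCone 1 a b x.1), 1 ≤ x.1.1 ∧ x.1.2 ≤ B * x.1.1 := by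
      intro x hx
      have := (Finset.mem_filter.mp hx).2
      exact ⟨(hcone x this).1, hBn x this⟩
    have hf0 : ∀ x, 0 ≤ f x := by
      intro x
      simp only [hf]
      split_ifs
      · have : 0 ≤ Real.exp (α * x.1.1) - 1 := by
          have : 0 ≤ α * x.1.1 := by positivity
          linarith [Real.add_one_le_exp (α * x.1.1)]
        positivity
      · exact le_rfl
    refine add_le_add (add_le_add ?_ ?_) ?_
    · refine Finset.sum_le_sum_of_subset_of_nonneg (fun x hx => (Finset.mem_filter.mp hx).2)
        fun x _ _ => hf0 x
    · calc _ ≤ Real.exp 1 / α * (4 * (B + 1) / (α / ε) ^ 2) := by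
            gcongr; exact sum_exp_neg_le (by positivity) B _ hcs
        _ = 4 * Real.exp 1 * (B + 1) * ε ^ 2 / α ^ 3 := by field_simp
        _ ≤ _ := by gcongr
    · calc _ ≤ 32 / (K * α) * (4 * (B + 1) / (α / 2) ^ 2) := by
            gcongr; exact sum_exp_neg_le (by positivity) B _ hcs
        _ = 512 * (B + 1) / K / α ^ 3 := by field_simp; norm_num
        _ ≤ _ := by gcongr
  have hfin2 : c₁ / 2 / α ^ 3 ≤ α / ε ^ 2 * ∑ x ∈ T, (x.1.1 : ℝ) ^ 2 := by
    have e : c₁ / 2 / α ^ 3 = c₁ / α ^ 3 - c₁ / 4 / α ^ 3 - c₁ / 4 / α ^ 3 := by field_simp; ring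
    linarith
  calc ε ^ 2 * (c₁ / 2) / α ^ 4 = ε ^ 2 / α * (c₁ / 2 / α ^ 3) := by field_simp
    _ ≤ ε ^ 2 / α * (α / ε ^ 2 * ∑ x ∈ T, (x.1.1 : ℝ) ^ 2) := by gcongr
    _ = _ := by field_simp

/-- A linear form cannot be small at two slopes that are δ apart: the difference of its values
controls θ₂, and then one value controls θ₁. -/
lemma linear_sq_ge_on_one_of_two {a b δ : ℝ} (hb : 0 < b) (hδ : 0 < δ) (θ : ℝ × ℝ)
    {t t' : ℝ} (ht : a ≤ t) (htt : t + δ ≤ t') (ht' : t' ≤ b) (ha : 0 ≤ a) :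
    (4 / δ ^ 2 + 2 + 8 * b ^ 2 / δ ^ 2)⁻¹ * (θ.1 ^ 2 + θ.2 ^ 2) ≤
      max ((θ.1 + θ.2 * t) ^ 2) ((θ.1 + θ.2 * t') ^ 2) := by
  set X := max ((θ.1 + θ.2 * t) ^ 2) ((θ.1 + θ.2 * t') ^ 2)
  have h1 : (θ.1 + θ.2 * t) ^ 2 ≤ X := le_max_left _ _
  have h2 : (θ.1 + θ.2 * t') ^ 2 ≤ X := le_max_right _ _
  have h3 : θ.2 ^ 2 ≤ 4 / δ ^ 2 * X := by
    rw [div_mul_eq_mul_div, le_div_iff₀ (by positivity)]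
    have e : θ.2 ^ 2 * (t' - t) ^ 2 ≤ 4 * X := by
      nlinarith [sq_nonneg ((θ.1 + θ.2 * t) + (θ.1 + θ.2 * t'))]
    have : δ ^ 2 ≤ (t' - t) ^ 2 := pow_le_pow_left₀ hδ.le (by linarith) 2
    nlinarith [sq_nonneg θ.2]
  have h4 : θ.1 ^ 2 ≤ (2 + 8 * b ^ 2 / δ ^ 2) * X := by
    have h5 : θ.1 ^ 2 ≤ 2 * X + 2 * b ^ 2 * θ.2 ^ 2 := by
      have h6 : t ^ 2 ≤ b ^ 2 := pow_le_pow_left₀ (by linarith) (by linarith) 2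
      nlinarith [sq_nonneg (θ.1 + 2 * (θ.2 * t)), sq_nonneg θ.2]
    calc θ.1 ^ 2 ≤ 2 * X + 2 * b ^ 2 * θ.2 ^ 2 := h5
      _ ≤ 2 * X + 2 * b ^ 2 * (4 / δ ^ 2 * X) := by gcongr
      _ = _ := by ring
  rw [inv_mul_le_iff₀ (by positivity)]
  linarith

/-- Primitive points of size `K / α` in a cone have a covariance form of the order `α⁻⁴`. -/
lemma exists_covariance_ge {a b : ℝ} (ha : 0 ≤ a) (hab : a < b) :
    ∃ K > 0, ∃ c > 0, ∃ α₀ > 0, ∀ α : ℝ, 0 < α → α < α₀ → ∃ T : Finset CoprimePair,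
      (∀ x ∈ T, 1 ≤ x.1.1 ∧ a ≤ (x.1.2 : ℝ) / x.1.1 ∧ (x.1.2 : ℝ) / x.1.1 ≤ b ∧ α * x.1.1 ≤ K) ∧
      ∀ θ : ℝ × ℝ, c / α ^ 4 * (θ.1 ^ 2 + θ.2 ^ 2) ≤ ∑ x ∈ T, pairing θ x.1 ^ 2 := by
  classical
  -- The subcones [a, a + δ] and [b - δ, b] are separated by a gap of length δ.
  set δ := (b - a) / 3 with hδ
  have hδ0 : 0 < δ := by rw [hδ]; linarith
  have hb : 0 < b := by linarith
  obtain ⟨K₁, hK₁, c₁, hc₁, α₁, hα₁, h₁⟩ := exists_sum_sq_ge ha (by linarith : a < a + δ)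
  obtain ⟨K₂, hK₂, c₂, hc₂, α₂, hα₂, h₂⟩ :=
    exists_sum_sq_ge (by linarith : 0 ≤ b - δ) (by linarith : b - δ < b)
  set η := (4 / δ ^ 2 + 2 + 8 * b ^ 2 / δ ^ 2)⁻¹ with hη
  have hη0 : 0 < η := by positivity
  refine ⟨max K₁ K₂, by positivity, min c₁ c₂ * η, by positivity, min α₁ α₂, by positivity,
    fun α hα hα₀ => ?_⟩
  obtain ⟨T₁, hT₁, hs₁⟩ := h₁ α hα (hα₀.trans_le (min_le_left _ _))
  obtain ⟨T₂, hT₂, hs₂⟩ := h₂ α hα (hα₀.trans_le (min_le_right _ _))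
  refine ⟨T₁ ∪ T₂, fun x hx => ?_, fun θ => ?_⟩
  · rcases Finset.mem_union.mp hx with h | h
    · obtain ⟨h1, h2, h3, h4⟩ := hT₁ x h
      exact ⟨h1, h2, by linarith, h4.trans (le_max_left _ _)⟩
    · obtain ⟨h1, h2, h3, h4⟩ := hT₂ x h
      exact ⟨h1, by linarith, h3, h4.trans (le_max_right _ _)⟩
  set r := θ.1 ^ 2 + θ.2 ^ 2 with hr
  have hr0 : 0 ≤ r := by positivity
  have hpair : ∀ x : CoprimePair, 1 ≤ x.1.1 →
      pairing θ x.1 ^ 2 = (x.1.1 : ℝ) ^ 2 * (θ.1 + θ.2 * ((x.1.2 : ℝ) / x.1.1)) ^ 2 := by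
    intro x hx
    have : (x.1.1 : ℝ) ≠ 0 := by exact_mod_cast (by omega : x.1.1 ≠ 0)
    rw [pairing, ← mul_pow]; congr 1; field_simp
  have hsub : ∀ (T : Finset CoprimePair) (c : ℝ), T ⊆ T₁ ∪ T₂ → min c₁ c₂ ≤ c →
      c / α ^ 4 ≤ ∑ x ∈ T, (x.1.1 : ℝ) ^ 2 → (∀ x ∈ T, 1 ≤ x.1.1) →
      (∀ x ∈ T, η * r ≤ (θ.1 + θ.2 * ((x.1.2 : ℝ) / x.1.1)) ^ 2) →
      min c₁ c₂ * η / α ^ 4 * r ≤ ∑ x ∈ T₁ ∪ T₂, pairing θ x.1 ^ 2 := by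
    intro T c hT hc hs h1 hl
    calc min c₁ c₂ * η / α ^ 4 * r ≤ c * η / α ^ 4 * r := by gcongr
      _ = c / α ^ 4 * (η * r) := by ring
      _ ≤ (∑ x ∈ T, (x.1.1 : ℝ) ^ 2) * (η * r) := by gcongr
      _ ≤ ∑ x ∈ T, pairing θ x.1 ^ 2 := by
          rw [Finset.sum_mul]
          refine Finset.sum_le_sum fun x hx => ?_
          rw [hpair x (h1 x hx)]
          exact mul_le_mul_of_nonneg_left (hl x hx) (by positivity)
      _ ≤ _ := Finset.sum_le_sum_of_subset_of_nonneg hT fun _ _ _ => sq_nonneg _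
  -- Either the form is large at all points of T₁, or a single bad point of T₁ forces it to be large
  -- at all points of T₂; one full subcone always contributes.
  by_cases hcase : ∀ x ∈ T₁, η * r ≤ (θ.1 + θ.2 * ((x.1.2 : ℝ) / x.1.1)) ^ 2
  · exact hsub T₁ c₁ Finset.subset_union_left (min_le_left _ _) hs₁ (fun x hx => (hT₁ x hx).1) hcase
  · push Not at hcase
    obtain ⟨y, hy, hyl⟩ := hcase
    refine hsub T₂ c₂ Finset.subset_union_right (min_le_right _ _) hs₂ (fun x hx => (hT₂ x hx).1)
      fun x hx => ?_
    have := linear_sq_ge_on_one_of_two (a := a) (b := b) hb hδ0 θ (hT₁ y hy).2.1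
      (t' := (x.1.2 : ℝ) / x.1.1) (by linarith [(hT₁ y hy).2.2.1, (hT₂ x hx).2.1])
      (hT₂ x hx).2.2.1 ha
    rcases le_max_iff.mp this with h | h
    · exact absurd h (not_le.mpr hyl)
    · exact h

end LatticeLLT

namespace LatticeLLT
open ConvexLattice (CoprimePair)

/-! ### Cancellation in exponential sums away from the origin -/

/-- A geometric sum is at most 2 / |w - 1|, and |w - 1| = 2 |sin(l/2)| ≥ 2|l|/π by Jordan's
inequality. The bound is independent of the length N. -/
lemma norm_geom_exp_sum_le {l : ℝ} (h0 : l ≠ 0) (hπ : |l| ≤ Real.pi) (φ : ℝ) (N : ℕ) :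
    ‖∑ k ∈ Finset.range N, Complex.exp ((φ + l * k : ℝ) * Complex.I)‖ ≤ Real.pi / |l| := by
  set w := Complex.exp (l * Complex.I) with hw
  have hl0 : 0 < |l| := abs_pos.mpr h0
  have hwn : 2 * |l| / Real.pi ≤ ‖w - 1‖ := by
    have h1 : ‖w - 1‖ = 2 * |Real.sin (l / 2)| := by
      rw [hw, mul_comm, Complex.norm_exp_I_mul_ofReal_sub_one, norm_mul]
      simp
    have h2 := Real.mul_abs_le_abs_sin (x := l / 2) (by rw [abs_div, abs_two]; linarith)
    rw [h1]
    calc 2 * |l| / Real.pi = 2 * (2 / Real.pi * |l / 2|) := by rw [abs_div, abs_two]; ring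
      _ ≤ _ := by gcongr
  have hne : w - 1 ≠ 0 := by
    rw [← norm_pos_iff]
    refine lt_of_lt_of_le ?_ hwn
    have := Real.pi_pos
    positivity
  have e : ∀ k : ℕ, Complex.exp ((φ + l * k : ℝ) * Complex.I) =
      Complex.exp (φ * Complex.I) * w ^ k := by
    intro k
    rw [hw, ← Complex.exp_nat_mul, ← Complex.exp_add]; congr 1; push_cast; ring
  simp_rw [e]
  rw [← Finset.mul_sum, norm_mul, Complex.norm_exp_ofReal_mul_I, one_mul,
    geom_sum_eq (sub_ne_zero.mp hne), norm_div]
  have h3 : ‖w ^ N - 1‖ ≤ 2 := by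
    refine (norm_sub_le _ _).trans ?_
    rw [norm_pow, hw, Complex.norm_exp_ofReal_mul_I, one_pow, norm_one]; norm_num
  have hp := Real.pi_pos
  calc ‖w ^ N - 1‖ / ‖w - 1‖ ≤ 2 / (2 * |l| / Real.pi) := by gcongr
    _ = _ := by field_simp

lemma sum_one_sub_cos_ge {l : ℝ} (h0 : l ≠ 0) (hπ : |l| ≤ Real.pi) (φ : ℝ) (N : ℕ) :
    (N : ℝ) - Real.pi / |l| ≤ ∑ k ∈ Finset.range N, (1 - Real.cos (φ + l * k)) := by
  rw [Finset.sum_sub_distrib, Finset.sum_const, Finset.card_range, nsmul_eq_mul, mul_one]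
  have h1 := (Complex.re_le_norm _).trans (norm_geom_exp_sum_le h0 hπ φ N)
  rw [Complex.re_sum] at h1
  simp_rw [Complex.exp_ofReal_mul_I_re] at h1
  linarith

lemma sum_one_sub_cos_pairing_ge {T : Finset CoprimePair} {h : CoprimePair → ℕ}
    (hinj : Set.InjOn h T) {P N : ℕ} (hsub : ∀ k < N, ∃ x ∈ T, h x = P + k) {θ : ℝ × ℝ} {φ l : ℝ}
    (hp : ∀ x ∈ T, pairing θ x.1 = φ + l * h x) (h0 : l ≠ 0) (hπ : |l| ≤ Real.pi) :
    (N : ℝ) - Real.pi / |l| ≤ ∑ x ∈ T, (1 - Real.cos (pairing θ x.1)) := by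
  classical
  have e1 : ∑ x ∈ T, (1 - Real.cos (pairing θ x.1)) =
      ∑ p ∈ T.image h, (1 - Real.cos (φ + l * p)) := by
    rw [Finset.sum_image hinj]
    exact Finset.sum_congr rfl fun x hx => by rw [hp x hx]
  have e2 : ∑ k ∈ Finset.range N, (1 - Real.cos ((φ + l * P) + l * k)) =
      ∑ p ∈ (Finset.range N).image (P + ·), (1 - Real.cos (φ + l * p)) := by
    rw [Finset.sum_image (fun a _ b _ hab => by simpa using hab)]
    refine Finset.sum_congr rfl fun k _ => ?_
    congr 2; push_cast; ring
  rw [e1]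
  refine (sum_one_sub_cos_ge h0 hπ (φ + l * P) N).trans ?_
  rw [e2]
  refine Finset.sum_le_sum_of_subset_of_nonneg ?_ fun p _ _ => by linarith [Real.cos_le_one (φ + l * p)]
  intro p hpm
  obtain ⟨k, hk, rfl⟩ := Finset.mem_image.mp hpm
  obtain ⟨x, hx, hxe⟩ := hsub k (Finset.mem_range.mp hk)
  exact Finset.mem_image.mpr ⟨x, hx, hxe⟩

lemma exists_nat_interval {u v : ℝ} (hu : 0 ≤ u) (huv : u ≤ v) :
    ∃ P N : ℕ, v - u - 1 ≤ N ∧ ∀ k < N, u ≤ ((P + k : ℕ) : ℝ) ∧ ((P + k : ℕ) : ℝ) ≤ v := by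
  refine ⟨⌈u⌉₊, ⌊v⌋₊ + 1 - ⌈u⌉₊, ?_, fun k hk => ⟨?_, ?_⟩⟩
  · have h1 := Nat.lt_floor_add_one v
    have h2 := Nat.ceil_lt_add_one hu
    have h3 : ((⌊v⌋₊ + 1 : ℕ) : ℝ) ≤ ((⌊v⌋₊ + 1 - ⌈u⌉₊ : ℕ) : ℝ) + (⌈u⌉₊ : ℕ) := by
      exact_mod_cast (by omega : ⌊v⌋₊ + 1 ≤ (⌊v⌋₊ + 1 - ⌈u⌉₊) + ⌈u⌉₊)
    push_cast at h3
    linarith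
  · push_cast
    linarith [Nat.le_ceil u, (Nat.cast_nonneg k : (0 : ℝ) ≤ k)]
  · have : ((⌈u⌉₊ + k : ℕ) : ℝ) ≤ (⌊v⌋₊ : ℕ) := by
      exact_mod_cast (by omega : ⌈u⌉₊ + k ≤ ⌊v⌋₊)
    exact this.trans (Nat.floor_le (hu.trans huv))

/-- Primitive points of a cone on a vertical line with prime abscissa. -/
lemma exists_row {a b : ℝ} (ha : 0 < a) (hab : a < b) (hint : ∀ k : ℕ, ¬(a ≤ k ∧ (k : ℝ) ≤ b))
    {q : ℕ} (hq : q.Prime) : ∃ T : Finset CoprimePair,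
      (∀ x ∈ T, x.1.1 = q ∧ a ≤ (x.1.2 : ℝ) / x.1.1 ∧ (x.1.2 : ℝ) / x.1.1 ≤ b) ∧
      ∀ θ : ℝ × ℝ, θ.2 ≠ 0 → |θ.2| ≤ Real.pi →
        (b - a) * q - 1 - Real.pi / |θ.2| ≤ ∑ x ∈ T, (1 - Real.cos (pairing θ x.1)) := by
  have hq0 : (0 : ℝ) < q := by exact_mod_cast hq.pos
  have hfin : {x : CoprimePair | x.1.1 = q ∧ a ≤ (x.1.2 : ℝ) / x.1.1 ∧
      (x.1.2 : ℝ) / x.1.1 ≤ b}.Finite := by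
    refine (finite_coprimePair_le q (b * q)).subset ?_
    rintro x ⟨h1, -, h3⟩
    rw [h1, div_le_iff₀ hq0] at h3
    exact ⟨by rw [h1], h3⟩
  have hmem : ∀ x, x ∈ hfin.toFinset ↔ x.1.1 = q ∧ a ≤ (x.1.2 : ℝ) / x.1.1 ∧
      (x.1.2 : ℝ) / x.1.1 ≤ b := fun x => by rw [Set.Finite.mem_toFinset]; rfl
  refine ⟨hfin.toFinset, fun x hx => (hmem x).mp hx, fun θ h0 hπ => ?_⟩
  obtain ⟨P, N, hN, hPN⟩ := exists_nat_interval (u := a * q) (v := b * q) (by positivity)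
    (by gcongr)
  refine le_trans (by linarith) (sum_one_sub_cos_pairing_ge (h := fun x => x.1.2)
    (T := hfin.toFinset) ?_ (P := P) (N := N) ?_ (φ := θ.1 * q) (l := θ.2) ?_ h0 hπ)
  · intro x hx y hy hxy
    exact Subtype.ext (Prod.ext (((hmem x).mp hx).1.trans ((hmem y).mp hy).1.symm) hxy)
  · intro k hk
    obtain ⟨h1, h2⟩ := hPN k hk
    -- A multiple j q would give the integral slope j in [a, b]. Hence every ordinate in the
    -- interval is coprime to q, and the row is a complete arithmetic progression.
    have hc : Nat.gcd q (P + k) = 1 := by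
      refine (Nat.Prime.coprime_iff_not_dvd hq).mpr ?_
      rintro ⟨j, hj⟩
      rw [hj] at h1 h2
      push_cast at h1 h2
      refine hint j ⟨?_, ?_⟩
      · nlinarith
      · nlinarith
    exact ⟨⟨(q, P + k), hc⟩, (hmem _).mpr ⟨rfl, by rw [le_div_iff₀ hq0]; exact h1,
      by rw [div_le_iff₀ hq0]; exact h2⟩, rfl⟩
  · intro x hx
    rw [pairing, ((hmem x).mp hx).1]

/-- Primitive points of a cone on a horizontal line with prime ordinate. -/
lemma exists_column {a b : ℝ} (ha : 0 < a) (hab : a < b)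
    (hint : ∀ k : ℕ, ¬(a * k ≤ 1 ∧ 1 ≤ b * k))
    {q : ℕ} (hq : q.Prime) : ∃ T : Finset CoprimePair,
      (∀ x ∈ T, x.1.2 = q ∧ 1 ≤ x.1.1 ∧ a ≤ (x.1.2 : ℝ) / x.1.1 ∧ (x.1.2 : ℝ) / x.1.1 ≤ b) ∧
      ∀ θ : ℝ × ℝ, θ.1 ≠ 0 → |θ.1| ≤ Real.pi →
        (1 / a - 1 / b) * q - 1 - Real.pi / |θ.1| ≤ ∑ x ∈ T, (1 - Real.cos (pairing θ x.1)) := by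
  have hq0 : (0 : ℝ) < q := by exact_mod_cast hq.pos
  have hb : 0 < b := ha.trans hab
  have hfin : {x : CoprimePair | x.1.2 = q ∧ 1 ≤ x.1.1 ∧ a ≤ (x.1.2 : ℝ) / x.1.1 ∧
      (x.1.2 : ℝ) / x.1.1 ≤ b}.Finite := by
    refine (finite_coprimePair_le (q / a) q).subset ?_
    rintro x ⟨h1, h0, h3, -⟩
    have : (0 : ℝ) < x.1.1 := by exact_mod_cast h0
    rw [h1, le_div_iff₀ this] at h3
    exact ⟨by rw [le_div_iff₀ ha]; linarith, by rw [h1]⟩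
  have hmem : ∀ x, x ∈ hfin.toFinset ↔ x.1.2 = q ∧ 1 ≤ x.1.1 ∧ a ≤ (x.1.2 : ℝ) / x.1.1 ∧
      (x.1.2 : ℝ) / x.1.1 ≤ b := fun x => by rw [Set.Finite.mem_toFinset]; rfl
  refine ⟨hfin.toFinset, fun x hx => (hmem x).mp hx, fun θ h0 hπ => ?_⟩
  obtain ⟨P, N, hN, hPN⟩ := exists_nat_interval (u := q / b) (v := q / a) (by positivity)
    (by gcongr)
  refine le_trans (le_of_eq_of_le (by ring) (sub_le_sub_right hN _))
    (sum_one_sub_cos_pairing_ge (h := fun x => x.1.1)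
    (T := hfin.toFinset) ?_ (P := P) (N := N) ?_ (φ := θ.2 * q) (l := θ.1) ?_ h0 hπ)
  · intro x hx y hy hxy
    exact Subtype.ext (Prod.ext hxy (((hmem x).mp hx).1.trans ((hmem y).mp hy).1.symm))
  · intro k hk
    obtain ⟨h1, h2⟩ := hPN k hk
    have hpos : (0 : ℝ) < ((P + k : ℕ) : ℝ) := lt_of_lt_of_le (by positivity) h1
    rw [div_le_iff₀ hb] at h1
    rw [le_div_iff₀ ha] at h2
    -- An abscissa j q would give the slope 1/j in [a, b], which is excluded.
    have hc : Nat.gcd (P + k) q = 1 := by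
      refine (Nat.coprime_comm.mp ((Nat.Prime.coprime_iff_not_dvd hq).mpr ?_))
      rintro ⟨j, hj⟩
      rw [hj] at h1 h2
      push_cast at h1 h2
      refine hint j ⟨?_, ?_⟩
      · nlinarith
      · nlinarith
    exact ⟨⟨(P + k, q), hc⟩, (hmem _).mpr ⟨rfl, by exact_mod_cast hpos,
      by rw [le_div_iff₀ hpos]; linarith, by rw [div_le_iff₀ hpos]; linarith⟩, rfl⟩
  · intro x hx
    rw [pairing, ((hmem x).mp hx).1]; ring

/-- Away from the origin of the torus the exponential sums over primitive points of a cone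
have no concentration. -/
lemma exists_sum_one_sub_cos_ge {a b A : ℝ} (ha : 0 < a) (hab : a < b) (hA : 0 < A)
    (hint : ∀ k : ℕ, ¬(a ≤ k ∧ (k : ℝ) ≤ b)) (hint' : ∀ k : ℕ, ¬(a * k ≤ 1 ∧ 1 ≤ b * k)) :
    ∃ K > 0, ∀ α : ℝ, 0 < α → α ≤ 1 → ∃ T : Finset CoprimePair,
      (∀ x ∈ T, 1 ≤ x.1.1 ∧ a ≤ (x.1.2 : ℝ) / x.1.1 ∧ (x.1.2 : ℝ) / x.1.1 ≤ b ∧ α * x.1.1 ≤ K) ∧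
      ∀ θ ∈ torus, ¬(|θ.1| ≤ A * α ∧ |θ.2| ≤ A * α) →
        1 / α ≤ ∑ x ∈ T, (1 - Real.cos (pairing θ x.1)) := by
  classical
  have hb : 0 < b := ha.trans hab
  set d := min (b - a) (1 / a - 1 / b) with hd
  have hd0 : 0 < d := by
    refine lt_min (by linarith) ?_
    have : 1 / b < 1 / a := one_div_lt_one_div_of_lt ha hab
    linarith
  -- For q ≥ R/α the progression has about d q ≥ 2/α + π/(Aα) points. The loss 1 is at most 1/α and
  -- the loss π/|l| is at most π/(Aα), so 1/α remains.
  set R := (2 + Real.pi / A) / d with hR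
  have hR0 : 0 < R := by have := Real.pi_pos; positivity
  refine ⟨2 * (R + 1) * max 1 (1 / a), by positivity, fun α hα hα1 => ?_⟩
  set N := ⌈R / α⌉₊ with hN
  have hN0 : N ≠ 0 := by
    rw [hN]; exact (Nat.ceil_pos.mpr (by positivity)).ne'
  -- Bertrand's postulate provides a prime of the order α⁻¹, so that α x₁ stays bounded on the
  -- chosen row and column.
  obtain ⟨q, hq, hq1, hq2⟩ := Nat.exists_prime_lt_and_le_two_mul N hN0
  have hqR : R / α ≤ q := (Nat.le_ceil _).trans (by exact_mod_cast hq1.le)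
  have hqα : α * q ≤ 2 * (R + 1) := by
    have h1 : (q : ℝ) ≤ 2 * N := by exact_mod_cast hq2
    have h2 : (N : ℝ) ≤ R / α + 1 := (Nat.ceil_lt_add_one (by positivity)).le
    calc α * q ≤ α * (2 * (R / α + 1)) := by gcongr; linarith
      _ = 2 * (R + α) := by field_simp
      _ ≤ _ := by gcongr
  have hlow : ∀ e l : ℝ, d ≤ e → A * α < |l| → 1 / α ≤ e * q - 1 - Real.pi / |l| := by
    intro e l he hl
    have he0 : 0 ≤ e := hd0.le.trans he
    have h1 : Real.pi / |l| ≤ Real.pi / (A * α) := by gcongr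
    have h2 : (2 + Real.pi / A) / α ≤ e * q := by
      calc (2 + Real.pi / A) / α = d * (R / α) := by rw [hR]; field_simp
        _ ≤ e * q := by gcongr
    have h3 : (2 + Real.pi / A) / α = 2 / α + Real.pi / (A * α) := by field_simp
    have h4 : 1 ≤ 1 / α := by rw [le_div_iff₀ hα]; linarith
    have h5 : 2 / α = 1 / α + 1 / α := by ring
    linarith
  obtain ⟨T₁, hT₁, hs₁⟩ := exists_row ha hab hint hq
  obtain ⟨T₂, hT₂, hs₂⟩ := exists_column ha hab hint' hq
  refine ⟨T₁ ∪ T₂, fun x hx => ?_, fun θ hθ hout => ?_⟩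
  · rcases Finset.mem_union.mp hx with h | h
    · obtain ⟨h1, h2, h3⟩ := hT₁ x h
      refine ⟨h1 ▸ hq.one_le, h2, h3, ?_⟩
      rw [h1]
      calc α * q ≤ 2 * (R + 1) * 1 := by linarith
        _ ≤ _ := by gcongr; exact le_max_left _ _
    · obtain ⟨h1, h2, h3, h4⟩ := hT₂ x h
      refine ⟨h2, h3, h4, ?_⟩
      have hx0 : (0 : ℝ) < x.1.1 := by exact_mod_cast h2
      rw [h1, le_div_iff₀ hx0] at h3
      have h5 : (x.1.1 : ℝ) ≤ q * (1 / a) := by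
        rw [mul_one_div, le_div_iff₀ ha]; linarith
      calc α * x.1.1 ≤ α * (q * (1 / a)) := by gcongr
        _ = α * q * (1 / a) := by ring
        _ ≤ 2 * (R + 1) * max 1 (1 / a) := by gcongr; exact le_max_right _ _
  · have hmono : ∀ T : Finset CoprimePair, T ⊆ T₁ ∪ T₂ →
        ∑ x ∈ T, (1 - Real.cos (pairing θ x.1)) ≤
          ∑ x ∈ T₁ ∪ T₂, (1 - Real.cos (pairing θ x.1)) := fun T hT =>
      Finset.sum_le_sum_of_subset_of_nonneg hT fun x _ _ => by
        linarith [Real.cos_le_one (pairing θ x.1)]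
    have hAα : 0 < A * α := by positivity
    rw [not_and_or, not_le, not_le] at hout
    rcases hout with h | h
    · refine (hlow _ _ (min_le_right _ _) h).trans ((hs₂ θ ?_ (abs_le.mpr hθ.1)).trans
        (hmono T₂ Finset.subset_union_right))
      exact abs_pos.mp (hAα.trans h)
    · refine (hlow _ _ (min_le_left _ _) h).trans ((hs₁ θ ?_ (abs_le.mpr hθ.2)).trans
        (hmono T₁ Finset.subset_union_left))
      exact abs_pos.mp (hAα.trans h)

/-- Every open interval of slopes contains a closed one without integers and without inverses of
integers. -/
lemma exists_good_slopes {u v : ℝ} (hu : 0 ≤ u) (huv : u < v) : ∃ a b : ℝ, u < a ∧ a < b ∧ b < v ∧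
    (∀ k : ℕ, ¬(a ≤ k ∧ (k : ℝ) ≤ b)) ∧ (∀ k : ℕ, ¬(a * k ≤ 1 ∧ 1 ≤ b * k)) := by
  obtain ⟨y, hy, huy, hyv⟩ := exists_irrational_btwn huv
  have hy0 : 0 < y := hu.trans_lt huy
  have hcl : IsClosed (Set.range ((↑) : ℤ → ℝ)) := Int.isClosedEmbedding_coe_real.isClosed_range
  have h1 : ∀ᶠ t in 𝓝 y, t ∉ Set.range ((↑) : ℤ → ℝ) :=
    hcl.isOpen_compl.mem_nhds fun ⟨k, hk⟩ => hy ⟨k, by exact_mod_cast hk⟩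
  have h2 : ∀ᶠ t in 𝓝 y, t⁻¹ ∉ Set.range ((↑) : ℤ → ℝ) := by
    refine (continuousAt_inv₀ hy0.ne').eventually (hcl.isOpen_compl.mem_nhds ?_)
    rintro ⟨k, hk⟩
    exact hy.inv ⟨k, by exact_mod_cast hk⟩
  obtain ⟨ε, hε, hball⟩ := Metric.eventually_nhds_iff.mp (h1.and h2)
  set δ := min (ε / 2) (min ((y - u) / 2) ((v - y) / 2)) with hδ
  have hδ0 : 0 < δ := by
    refine lt_min (by linarith) (lt_min (by linarith) (by linarith))
  have hδ1 : δ ≤ ε / 2 := min_le_left _ _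
  have hδ2 : δ ≤ (y - u) / 2 := (min_le_right _ _).trans (min_le_left _ _)
  have hδ3 : δ ≤ (v - y) / 2 := (min_le_right _ _).trans (min_le_right _ _)
  have hin : ∀ t, y - δ ≤ t → t ≤ y + δ → t ∉ Set.range ((↑) : ℤ → ℝ) ∧
      t⁻¹ ∉ Set.range ((↑) : ℤ → ℝ) := by
    intro t ht1 ht2
    refine hball ?_
    rw [Real.dist_eq, abs_lt]
    constructor <;> linarith
  refine ⟨y - δ, y + δ, by linarith, by linarith, by linarith, fun k hk => ?_, fun k hk => ?_⟩
  · exact (hin k hk.1 hk.2).1 ⟨k, by simp⟩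
  · have hk0 : (0 : ℝ) < k := by
      rcases Nat.eq_zero_or_pos k with h | h
      · subst h; norm_num at hk
      · exact_mod_cast h
    refine (hin ((k : ℝ)⁻¹) ?_ ?_).2 ⟨k, by simp⟩
    · rw [← one_div, le_div_iff₀ hk0]; exact hk.1
    · rw [← one_div, div_le_iff₀ hk0]; exact hk.2

end LatticeLLT

namespace LatticeLLT
open ConvexLattice (CoprimePair Config endpoint)

/-! ### The local limit estimate for parameters supported by a cone -/

lemma norm_prod_geomChar_le {z : CoprimePair → ℝ} (h0 : ∀ x, 0 ≤ z x) (h1 : ∀ x, z x < 1)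
    {S T : Finset CoprimePair} (hTS : T ⊆ S) {ε X : ℝ} {θ : ℝ × ℝ} (hε : 0 ≤ ε)
    (hz : ∀ x ∈ T, ε ≤ z x) (hX : X ≤ ∑ x ∈ T, (1 - Real.cos (pairing θ x.1))) :
    ‖∏ x ∈ S, geomChar (z x) (pairing θ x.1)‖ ≤ Real.exp (-(ε / 5 * X)) := by
  have hc : ∀ x : CoprimePair, 0 ≤ 1 - Real.cos (pairing θ x.1) := fun x => by
    linarith [Real.cos_le_one (pairing θ x.1)]
  rw [norm_prod]
  calc _ ≤ ∏ x ∈ S, Real.exp (-(z x * (1 - Real.cos (pairing θ x.1)) / 5)) :=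
        Finset.prod_le_prod (fun _ _ => norm_nonneg _)
          fun x _ => norm_geomChar_le (h0 x) (h1 x) _
    _ = Real.exp (-((∑ x ∈ S, z x * (1 - Real.cos (pairing θ x.1))) / 5)) := by
        rw [← Real.exp_sum, Finset.sum_neg_distrib, Finset.sum_div]
    _ ≤ _ := by
        have h2 : ε * X ≤ ∑ x ∈ S, z x * (1 - Real.cos (pairing θ x.1)) := by
          calc ε * X ≤ ε * ∑ x ∈ T, (1 - Real.cos (pairing θ x.1)) := by gcongr
            _ ≤ ∑ x ∈ T, z x * (1 - Real.cos (pairing θ x.1)) := by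
                rw [Finset.mul_sum]
                exact Finset.sum_le_sum fun x hx =>
                  mul_le_mul_of_nonneg_right (hz x hx) (hc x)
            _ ≤ _ := Finset.sum_le_sum_of_subset_of_nonneg hTS fun x _ _ =>
                mul_nonneg (h0 x) (hc x)
        apply Real.exp_le_exp.mpr
        linarith

lemma sq_div_five_le_one_sub_cos {t : ℝ} (ht : |t| ≤ 1) : t ^ 2 / 5 ≤ 1 - Real.cos t := by
  have h1 := Real.cos_le_one_sub_mul_cos_sq (x := t) (ht.trans (by linarith [Real.pi_gt_three]))
  have h2 : 1 / 5 ≤ 2 / Real.pi ^ 2 := by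
    rw [div_le_div_iff₀ (by norm_num) (by have := Real.pi_pos; positivity)]
    nlinarith [Real.pi_lt_d2, Real.pi_pos]
  nlinarith [sq_nonneg t]

theorem exists_cone_local_limit {m M D u v : ℝ} (B : ℕ) (hm : 0 < m) (hu : 0 ≤ u) (huv : u < v) :
    ∃ α₀ > 0, ∃ c > 0, ∃ C > 0, ∀ α : ℝ, 0 < α → α < α₀ → ∀ z : CoprimePair → ℝ,
      ConeDominated m B α z →
      (∀ x : CoprimePair, 1 ≤ x.1.1 → u ≤ (x.1.2 : ℝ) / x.1.1 → (x.1.2 : ℝ) / x.1.1 ≤ v →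
        Real.exp (-(M * α * x.1.1)) ≤ z x) →
      ∀ (n : ℕ × ℕ) (E : ℝ × ℝ), HasSum (fun x : CoprimePair => geomMean (z x) * x.1.1) E.1 →
      HasSum (fun x : CoprimePair => geomMean (z x) * x.1.2) E.2 →
      (E.1 - n.1) ^ 2 + (E.2 - n.2) ^ 2 ≤ D / α ^ 4 →
      ∀ᶠ S : Finset CoprimePair in atTop, ∑ ν ∈ (finite_endpoint_eq n).toFinset,
        ∏ x ∈ S, z x ^ ν x * (1 - z x) ∈ Icc (c * α ^ 4) (C * α ^ 4) := by
  classical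
  obtain ⟨a, b, hua, hab, hbv, hint, hint'⟩ := exists_good_slopes hu huv
  have ha : 0 < a := hu.trans_lt hua
  have hb : 0 < b := ha.trans hab
  obtain ⟨K₁, hK₁, c₁, hc₁, α₁, hα₁, hcov⟩ := exists_covariance_ge ha.le hab
  set A := 1 / (2 * (1 + b) * K₁) with hA
  have hA0 : 0 < A := by positivity
  obtain ⟨K₂, hK₂, hexp⟩ := exists_sum_one_sub_cos_ge ha hab hA0 hint hint'
  set M' := max M 0 with hM'
  set ε₁ := Real.exp (-(M' * K₁)) with hε₁
  set ε₂ := Real.exp (-(M' * K₂)) with hε₂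
  obtain ⟨α₂, hα₂, c, hc, C, hC, hllt⟩ := exists_local_limit_bounds
    (C₂ := 3136 * (B + 1) * (1 + B ^ 2) / m ^ 4) (C₃ := 3136 * (B + 1) ^ 4 / m ^ 5)
    (c := ε₁ / 5 * (c₁ / 5)) (c' := ε₂ / 5) (A := A) (D := D + 1) (by positivity) (by positivity)
    (by positivity) (by positivity) hA0
  refine ⟨min (min 1 α₁) α₂, by positivity, c, hc, C, hC, ?_⟩
  intro α hα hα₀ z hz hzl n E hE1 hE2 hD
  rw [lt_min_iff, lt_min_iff] at hα₀
  obtain ⟨⟨hα1, hαα₁⟩, hαα₂⟩ := hα₀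
  obtain ⟨T₁, hT₁, hs₁⟩ := hcov α hα hαα₁
  obtain ⟨T₂, hT₂, hs₂⟩ := hexp α hα hα1.le
  have hlow : ∀ (T : Finset CoprimePair) (K : ℝ), (∀ x ∈ T, 1 ≤ x.1.1 ∧ a ≤ (x.1.2 : ℝ) / x.1.1 ∧
      (x.1.2 : ℝ) / x.1.1 ≤ b ∧ α * x.1.1 ≤ K) → ∀ x ∈ T, Real.exp (-(M' * K)) ≤ z x := by
    intro T K hT x hx
    obtain ⟨h1, h2, h3, h4⟩ := hT x hx
    refine le_trans ?_ (hzl x h1 (by linarith) (by linarith))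
    apply Real.exp_le_exp.mpr
    have h5 : M * (α * x.1.1) ≤ M' * (α * x.1.1) :=
      mul_le_mul_of_nonneg_right (le_max_left _ _) (by positivity)
    have h6 : M' * (α * x.1.1) ≤ M' * K := mul_le_mul_of_nonneg_left h4 (le_max_right _ _)
    linarith
  have hz₁ := hlow T₁ K₁ hT₁
  have hz₂ := hlow T₂ K₂ hT₂
  have h0 := hz.nonneg
  have h1 := hz.lt_one hm hα
  have hboxfin : {x : CoprimePair | (x.1.1 : ℝ) ≤ n.1 ∧ (x.1.2 : ℝ) ≤ n.2}.Finite :=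
    finite_coprimePair_le _ _
  have hmean : ∀ᶠ S : Finset CoprimePair in atTop,
      (∑ x ∈ S, geomMean (z x) * x.1.1 - n.1) ^ 2 + (∑ x ∈ S, geomMean (z x) * x.1.2 - n.2) ^ 2 <
        (D + 1) / α ^ 4 := by
    have ht1 : Tendsto (fun S : Finset CoprimePair => ∑ x ∈ S, geomMean (z x) * x.1.1) atTop
        (𝓝 E.1) := by simpa [HasSum] using hE1
    have ht2 : Tendsto (fun S : Finset CoprimePair => ∑ x ∈ S, geomMean (z x) * x.1.2) atTop
        (𝓝 E.2) := by simpa [HasSum] using hE2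
    have ht := ((ht1.sub_const (n.1 : ℝ)).pow 2).add ((ht2.sub_const (n.2 : ℝ)).pow 2)
    refine ht.eventually_lt_const (hD.trans_lt ?_)
    gcongr; linarith
  filter_upwards [eventually_ge_atTop (T₁ ∪ T₂ ∪ hboxfin.toFinset), hmean] with S hS hSm
  have hTS₁ : T₁ ⊆ S := (Finset.subset_union_left.trans Finset.subset_union_left).trans hS
  have hTS₂ : T₂ ⊆ S := (Finset.subset_union_right.trans Finset.subset_union_left).trans hS
  refine hllt α hα hαα₂ S z n h0 h1 ?_ ?_ ?_ (hz.third_moment_le hm hα S) ?_ ?_ ?_ hSm.le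
  · intro x hx1 hx2
    refine hS (Finset.mem_union_right _ ?_)
    rw [Set.Finite.mem_toFinset]
    exact ⟨by exact_mod_cast hx1, by exact_mod_cast hx2⟩
  · refine (hz.second_moment_le hm hα S).1.trans ?_
    refine div_le_div_of_nonneg_right (div_le_div_of_nonneg_right ?_ (by positivity))
      (by positivity)
    nlinarith [(by positivity : (0 : ℝ) ≤ 3136 * (B + 1) * B ^ 2)]
  · refine (hz.second_moment_le hm hα S).2.trans ?_
    refine div_le_div_of_nonneg_right (div_le_div_of_nonneg_right ?_ (by positivity))
      (by positivity)
    nlinarith [(by positivity : (0 : ℝ) ≤ 3136 * ((B : ℝ) + 1))]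
  · intro θ
    calc 2 * (ε₁ / 5 * (c₁ / 5)) / α ^ 4 * (θ.1 ^ 2 + θ.2 ^ 2)
        ≤ ε₁ * (c₁ / α ^ 4 * (θ.1 ^ 2 + θ.2 ^ 2)) := by
          have : 0 ≤ ε₁ * (c₁ / α ^ 4 * (θ.1 ^ 2 + θ.2 ^ 2)) := by positivity
          have e : 2 * (ε₁ / 5 * (c₁ / 5)) / α ^ 4 * (θ.1 ^ 2 + θ.2 ^ 2) =
            2 / 25 * (ε₁ * (c₁ / α ^ 4 * (θ.1 ^ 2 + θ.2 ^ 2))) := by ring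
          linarith
      _ ≤ ε₁ * ∑ x ∈ T₁, pairing θ x.1 ^ 2 := by gcongr; exact hs₁ θ
      _ ≤ ∑ x ∈ T₁, geomMean (z x) * (1 + geomMean (z x)) * pairing θ x.1 ^ 2 := by
          rw [Finset.mul_sum]
          refine Finset.sum_le_sum fun x hx => ?_
          have hq := le_geomMean (h0 x) (h1 x)
          have hq0 := geomMean_nonneg (h0 x) (h1 x)
          have : ε₁ ≤ geomMean (z x) * (1 + geomMean (z x)) := by nlinarith [hz₁ x hx]
          gcongr
      _ ≤ _ := Finset.sum_le_sum_of_subset_of_nonneg hTS₁ fun x _ _ => by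
          have hq0 := geomMean_nonneg (h0 x) (h1 x)
          positivity
  · intro θ hθ1 hθ2
    refine (norm_prod_geomChar_le h0 h1 hTS₁ (Real.exp_pos _).le hz₁
      (X := 1 / 5 * (c₁ / α ^ 4 * (θ.1 ^ 2 + θ.2 ^ 2))) ?_).trans (le_of_eq ?_)
    · calc _ ≤ 1 / 5 * ∑ x ∈ T₁, pairing θ x.1 ^ 2 := by gcongr; exact hs₁ θ
        _ ≤ _ := by
          rw [Finset.mul_sum]
          refine Finset.sum_le_sum fun x hx => ?_
          obtain ⟨g1, -, g3, g4⟩ := hT₁ x hx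
          refine le_trans (le_of_eq (by ring)) (sq_div_five_le_one_sub_cos ?_)
          have g5 : (x.1.2 : ℝ) ≤ b * x.1.1 := by
            rwa [div_le_iff₀ (by exact_mod_cast g1)] at g3
          calc |pairing θ x.1| ≤ (|θ.1| + |θ.2|) * (x.1.1 + x.1.2) := abs_pairing_le θ x.1
            _ ≤ (A * α + A * α) * (x.1.1 + b * x.1.1) := by gcongr
            _ = A * (2 * (1 + b)) * (α * x.1.1) := by ring
            _ ≤ A * (2 * (1 + b)) * K₁ := by gcongr
            _ = 1 := by rw [hA]; field_simp
    · congr 1; ring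
  · intro θ hθ hout
    refine (norm_prod_geomChar_le h0 h1 hTS₂ (Real.exp_pos _).le hz₂ (hs₂ θ hθ hout)).trans
      (le_of_eq ?_)
    congr 1; ring

end LatticeLLT

namespace LatticeLLT
open ConvexLattice (gDeriv gDeriv2 curvature slopeMin slopeMax uInv kappa)

/-! ### The curve parametrized by its slope -/

section Curve

variable {g : ℝ → ℝ} {K₀ : ℝ}

lemma contDiffOn_gDeriv (hg : ContDiffOn ℝ 3 g (Icc 0 1)) : ContDiffOn ℝ 2 (gDeriv g) (Icc 0 1) :=
  hg.derivWithin (uniqueDiffOn_Icc zero_lt_one) (by norm_num)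

lemma gDeriv2_eq (u : ℝ) : gDeriv2 g u = derivWithin (gDeriv g) (Icc 0 1) u := by
  rw [gDeriv2, iteratedDerivWithin_succ]
  congr 1
  funext v
  rw [iteratedDerivWithin_one]
  rfl

lemma contDiffOn_gDeriv2 (hg : ContDiffOn ℝ 3 g (Icc 0 1)) :
    ContDiffOn ℝ 1 (gDeriv2 g) (Icc 0 1) := by
  have h := (contDiffOn_gDeriv hg).derivWithin (m := 1) (uniqueDiffOn_Icc zero_lt_one)
    (by norm_num)
  exact h.congr fun u _ => gDeriv2_eq u

lemma exists_abs_sub_le_of_contDiffOn {h : ℝ → ℝ} (hh : ContDiffOn ℝ 1 h (Icc 0 1)) :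
    ∃ L : ℝ, 0 ≤ L ∧ ∀ u ∈ Icc (0 : ℝ) 1, ∀ v ∈ Icc (0 : ℝ) 1, |h u - h v| ≤ L * |u - v| := by
  have hc : ContinuousOn (derivWithin h (Icc 0 1)) (Icc 0 1) :=
    hh.continuousOn_derivWithin (uniqueDiffOn_Icc zero_lt_one) le_rfl
  obtain ⟨L, hL⟩ := isCompact_Icc.exists_bound_of_continuousOn hc
  refine ⟨max L 0, le_max_right _ _, fun u hu v hv => ?_⟩
  have := (convex_Icc (0 : ℝ) 1).norm_image_sub_le_of_norm_derivWithin_le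
    (hh.differentiableOn one_ne_zero) (fun x hx => (hL x hx).trans (le_max_left L 0)) hv hu
  simpa only [Real.norm_eq_abs] using this

lemma le_gDeriv2 (hK : 0 < K₀) (hcurv : ∀ u ∈ Icc (0 : ℝ) 1, K₀ ≤ curvature g u) {u : ℝ}
    (hu : u ∈ Icc (0 : ℝ) 1) : K₀ ≤ gDeriv2 g u := by
  have h := hcurv u hu
  have h1 : (1 : ℝ) ≤ (1 + gDeriv g u ^ 2) ^ (3 / 2 : ℝ) :=
    Real.one_le_rpow (by nlinarith [sq_nonneg (gDeriv g u)]) (by norm_num)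
  rw [curvature, le_div_iff₀ (by linarith)] at h
  nlinarith

lemma hasDerivWithinAt_gDeriv (hg : ContDiffOn ℝ 3 g (Icc 0 1)) {u : ℝ}
    (hu : u ∈ Icc (0 : ℝ) 1) : HasDerivWithinAt (gDeriv g) (gDeriv2 g u) (Icc 0 1) u := by
  rw [gDeriv2_eq]
  exact (((contDiffOn_gDeriv hg).differentiableOn two_ne_zero) u hu).hasDerivWithinAt

lemma mul_sub_le_gDeriv_sub (hg : ContDiffOn ℝ 3 g (Icc 0 1)) (hK : 0 < K₀)
    (hcurv : ∀ u ∈ Icc (0 : ℝ) 1, K₀ ≤ curvature g u) {u v : ℝ} (hu : u ∈ Icc (0 : ℝ) 1)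
    (hv : v ∈ Icc (0 : ℝ) 1) (huv : u ≤ v) : K₀ * (v - u) ≤ gDeriv g v - gDeriv g u := by
  refine (convex_Icc (0 : ℝ) 1).mul_sub_le_image_sub_of_le_deriv
    (contDiffOn_gDeriv hg).continuousOn
    (((contDiffOn_gDeriv hg).differentiableOn two_ne_zero).mono interior_subset) ?_ u hu v hv huv
  intro x hx
  have hx' := interior_subset hx
  rw [((hasDerivWithinAt_gDeriv hg hx').hasDerivAt (mem_interior_iff_mem_nhds.mp hx)).deriv]
  exact le_gDeriv2 hK hcurv hx'

lemma strictMonoOn_gDeriv (hg : ContDiffOn ℝ 3 g (Icc 0 1)) (hK : 0 < K₀)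
    (hcurv : ∀ u ∈ Icc (0 : ℝ) 1, K₀ ≤ curvature g u) : StrictMonoOn (gDeriv g) (Icc 0 1) := by
  intro u hu v hv huv
  have := mul_sub_le_gDeriv_sub hg hK hcurv hu hv huv.le
  nlinarith

lemma slopeMin_eq (hmono : MonotoneOn (gDeriv g) (Icc 0 1)) : slopeMin g = gDeriv g 0 := by
  refine IsLeast.csInf_eq ⟨⟨0, by simp, rfl⟩, ?_⟩
  rintro _ ⟨u, hu, rfl⟩
  exact hmono (by simp) hu hu.1

lemma slopeMax_eq (hmono : MonotoneOn (gDeriv g) (Icc 0 1)) : slopeMax g = gDeriv g 1 := by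
  refine IsGreatest.csSup_eq ⟨⟨1, by simp, rfl⟩, ?_⟩
  rintro _ ⟨u, hu, rfl⟩
  exact hmono hu (by simp) hu.2

lemma uInv_gDeriv (hmono : StrictMonoOn (gDeriv g) (Icc 0 1)) {u : ℝ} (hu : u ∈ Icc (0 : ℝ) 1) :
    uInv g (gDeriv g u) = u :=
  IsGreatest.csSup_eq ⟨⟨hu, le_rfl⟩, fun _ hv => (hmono.le_iff_le hv.1 hu).mp hv.2⟩

lemma uInv_spec (hmono : StrictMonoOn (gDeriv g) (Icc 0 1))
    (hc : ContinuousOn (gDeriv g) (Icc 0 1)) {t : ℝ} (ht : t ∈ Icc (slopeMin g) (slopeMax g)) :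
    uInv g t ∈ Icc (0 : ℝ) 1 ∧ gDeriv g (uInv g t) = t := by
  rw [slopeMin_eq hmono.monotoneOn, slopeMax_eq hmono.monotoneOn] at ht
  obtain ⟨u, hu, rfl⟩ := intermediate_value_Icc zero_le_one hc ht
  rw [uInv_gDeriv hmono hu]
  exact ⟨hu, rfl⟩

/-- The truncation of the real line to an interval. -/
def clamp (a b t : ℝ) : ℝ := max a (min t b)

lemma clamp_mem {a b : ℝ} (hab : a ≤ b) (t : ℝ) : clamp a b t ∈ Icc a b :=
  ⟨le_max_left _ _, max_le hab (min_le_right _ _)⟩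

lemma clamp_of_mem {a b t : ℝ} (ht : t ∈ Icc a b) : clamp a b t = t := by
  rw [clamp, min_eq_left ht.2, max_eq_right ht.1]

lemma abs_clamp_sub_le (a b s t : ℝ) : |clamp a b s - clamp a b t| ≤ |s - t| := by
  have h1 := abs_max_sub_max_le_max a (min s b) a (min t b)
  have h2 := abs_min_sub_min_le_max s b t b
  simp only [sub_self, abs_zero] at h1 h2
  rw [max_eq_right (abs_nonneg (min s b - min t b))] at h1
  rw [max_eq_left (abs_nonneg (s - t))] at h2
  exact h1.trans h2

lemma abs_rpow_third_sub_le {k x y : ℝ} (hk : 0 < k) (hx : k ≤ x) (hy : k ≤ y) :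
    |x ^ (1 / 3 : ℝ) - y ^ (1 / 3 : ℝ)| ≤ (3 * (k ^ (1 / 3 : ℝ)) ^ 2)⁻¹ * |x - y| := by
  have hcube : ∀ w : ℝ, 0 ≤ w → (w ^ (1 / 3 : ℝ)) ^ 3 = w := by
    intro w hw
    rw [← Real.rpow_natCast, ← Real.rpow_mul hw]; norm_num
  set p := x ^ (1 / 3 : ℝ)
  set q := y ^ (1 / 3 : ℝ)
  set r := k ^ (1 / 3 : ℝ)
  have hr : 0 < r := Real.rpow_pos_of_pos hk _
  have hp : r ≤ p := Real.rpow_le_rpow hk.le hx (by norm_num)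
  have hq : r ≤ q := Real.rpow_le_rpow hk.le hy (by norm_num)
  have e : x - y = (p - q) * (p ^ 2 + p * q + q ^ 2) := by
    rw [← hcube x (by linarith), ← hcube y (by linarith)]; ring
  have hs : 3 * r ^ 2 ≤ p ^ 2 + p * q + q ^ 2 := by nlinarith
  rw [e, abs_mul, abs_of_nonneg (by nlinarith : 0 ≤ p ^ 2 + p * q + q ^ 2),
    le_inv_mul_iff₀ (by positivity), mul_comm]
  gcongr

/-- The function `x₁ δ₁ + ρ x₂ δ₂ = x₁ Φ(t)` of the slope, extended to the real line, together with
its integrals. -/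
lemma exists_slope_function (hmono : StrictMonoOn g (Icc 0 1)) (hg : ContDiffOn ℝ 3 g (Icc 0 1))
    (h_zero : g 0 = 0) (hK : 0 < K₀) (hcurv : ∀ u ∈ Icc (0 : ℝ) 1, K₀ ≤ curvature g u) :
    0 ≤ slopeMin g ∧ slopeMin g < slopeMax g ∧ ∃ (Φ : ℝ → ℝ) (m M L : ℝ), 0 < m ∧
      (∀ t, m ≤ Φ t) ∧ (∀ t, Φ t ≤ M) ∧ (∀ s t, |Φ s - Φ t| ≤ L * |s - t|) ∧
      (∀ t ∈ Icc (slopeMin g) (slopeMax g), 0 < gDeriv2 g (uInv g t) ∧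
        Φ t = kappa * gDeriv2 g (uInv g t) ^ (1 / 3 : ℝ)) ∧
      ∫ t in slopeMin g..slopeMax g, 1 / Φ t ^ 3 = 1 / kappa ^ 3 ∧
      ∫ t in slopeMin g..slopeMax g, t / Φ t ^ 3 = g 1 / kappa ^ 3 := by
  have hsm := strictMonoOn_gDeriv hg hK hcurv
  have hcont := (contDiffOn_gDeriv hg).continuousOn
  have hmin := slopeMin_eq hsm.monotoneOn
  have hmax := slopeMax_eq hsm.monotoneOn
  have h0 : 0 ≤ slopeMin g := by
    rw [hmin]; exact hmono.monotoneOn.derivWithin_nonneg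
  have h01 : slopeMin g < slopeMax g := by
    rw [hmin, hmax]; exact hsm (by simp) (by simp) zero_lt_one
  refine ⟨h0, h01, ?_⟩
  set a := slopeMin g with ha
  set b := slopeMax g with hb
  obtain ⟨L₂, hL₂, hLip⟩ := exists_abs_sub_le_of_contDiffOn (contDiffOn_gDeriv2 hg)
  obtain ⟨M₂, hM₂⟩ := isCompact_Icc.exists_bound_of_continuousOn (contDiffOn_gDeriv2 hg).continuousOn
  set U : ℝ → ℝ := fun t => uInv g (clamp a b t) with hU
  have hUmem : ∀ t, U t ∈ Icc (0 : ℝ) 1 := fun t => (uInv_spec hsm hcont (clamp_mem h01.le t)).1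
  have hUg : ∀ t, gDeriv g (U t) = clamp a b t :=
    fun t => (uInv_spec hsm hcont (clamp_mem h01.le t)).2
  have hUL : ∀ s t, |U s - U t| ≤ K₀⁻¹ * |s - t| := by
    have key : ∀ u ∈ Icc (0 : ℝ) 1, ∀ v ∈ Icc (0 : ℝ) 1,
        K₀ * |u - v| ≤ |gDeriv g u - gDeriv g v| := by
      intro u hu v hv
      rcases le_total u v with h | h
      · have := mul_sub_le_gDeriv_sub hg hK hcurv hu hv h
        rw [abs_sub_comm u v, abs_sub_comm (gDeriv g u), abs_of_nonneg (by linarith : 0 ≤ v - u)]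
        exact this.trans (le_abs_self _)
      · have := mul_sub_le_gDeriv_sub hg hK hcurv hv hu h
        rw [abs_of_nonneg (by linarith : 0 ≤ u - v)]
        exact this.trans (le_abs_self _)
    intro s t
    have := key _ (hUmem s) _ (hUmem t)
    rw [hUg, hUg] at this
    rw [le_inv_mul_iff₀ hK]
    exact this.trans (abs_clamp_sub_le a b s t)
  have hG : ∀ t, K₀ ≤ gDeriv2 g (U t) := fun t => le_gDeriv2 hK hcurv (hUmem t)
  have hκ := kappa_pos
  set Φ : ℝ → ℝ := fun t => kappa * gDeriv2 g (U t) ^ (1 / 3 : ℝ) with hΦ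
  have hΦm : ∀ t, kappa * K₀ ^ (1 / 3 : ℝ) ≤ Φ t := fun t => by
    simp only [hΦ]
    gcongr
    exact hG t
  have hm : 0 < kappa * K₀ ^ (1 / 3 : ℝ) := by positivity
  have hΦL : ∀ s t, |Φ s - Φ t| ≤
      kappa * ((3 * (K₀ ^ (1 / 3 : ℝ)) ^ 2)⁻¹ * (L₂ * K₀⁻¹)) * |s - t| := by
    intro s t
    simp only [hΦ]
    rw [← mul_sub, abs_mul, abs_of_pos hκ, mul_assoc]
    gcongr
    calc _ ≤ (3 * (K₀ ^ (1 / 3 : ℝ)) ^ 2)⁻¹ * |gDeriv2 g (U s) - gDeriv2 g (U t)| :=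
          abs_rpow_third_sub_le hK (hG s) (hG t)
      _ ≤ (3 * (K₀ ^ (1 / 3 : ℝ)) ^ 2)⁻¹ * (L₂ * (K₀⁻¹ * |s - t|)) := by
          gcongr
          exact (hLip _ (hUmem s) _ (hUmem t)).trans (by gcongr; exact hUL s t)
      _ = _ := by ring
  have hΦc : Continuous Φ := continuous_of_abs_sub_le hΦL
  have hcube : ∀ t, Φ t ^ 3 = kappa ^ 3 * gDeriv2 g (U t) := by
    intro t
    simp only [hΦ]
    rw [mul_pow, ← Real.rpow_natCast (gDeriv2 g (U t) ^ (1 / 3 : ℝ)),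
      ← Real.rpow_mul (hK.le.trans (hG t))]
    norm_num
  have hUinv : ∀ u ∈ Icc (0 : ℝ) 1, U (gDeriv g u) = u := by
    intro u hu
    have : gDeriv g u ∈ Icc a b := by
      rw [hmin, hmax]
      exact ⟨hsm.monotoneOn (by simp) hu hu.1, hsm.monotoneOn hu (by simp) hu.2⟩
    simp only [hU]
    rw [clamp_of_mem this, uInv_gDeriv hsm hu]
  have hsub : ∀ ψ : ℝ → ℝ, Continuous ψ →
      ∫ t in a..b, ψ t / Φ t ^ 3 = (∫ u in (0 : ℝ)..1, ψ (gDeriv g u)) / kappa ^ 3 := by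
    intro ψ hψ
    have hI : uIcc (0 : ℝ) 1 = Icc 0 1 := uIcc_of_le zero_le_one
    have hFc : Continuous fun t => ψ t / Φ t ^ 3 :=
      hψ.div (hΦc.pow 3) fun t => (pow_pos (hm.trans_le (hΦm t)) 3).ne'
    have h := intervalIntegral.integral_comp_mul_deriv'' (a := 0) (b := 1) (f := gDeriv g)
      (f' := gDeriv2 g) (g := fun t => ψ t / Φ t ^ 3) (by rw [hI]; exact hcont)
      (fun x hx => by
        rw [min_eq_left zero_le_one, max_eq_right zero_le_one] at hx
        exact ((hasDerivWithinAt_gDeriv hg ⟨hx.1.le, hx.2.le⟩).hasDerivAt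
          (Icc_mem_nhds hx.1 hx.2)).hasDerivWithinAt)
      (by rw [hI]; exact (contDiffOn_gDeriv2 hg).continuousOn) hFc.continuousOn
    rw [hmin, hmax, ← h, ← intervalIntegral.integral_div]
    refine intervalIntegral.integral_congr fun u hu => ?_
    rw [hI] at hu
    have h2 : gDeriv2 g u ≠ 0 := (hK.trans_le (le_gDeriv2 hK hcurv hu)).ne'
    simp only [Function.comp]
    rw [hcube, hUinv u hu]
    field_simp
  have hgd : ∫ u in (0 : ℝ)..1, gDeriv g u = g 1 := by
    have hdiff := hg.differentiableOn (by norm_num : (3 : WithTop ℕ∞) ≠ 0)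
    rw [intervalIntegral.integral_eq_sub_of_hasDerivAt_of_le (f' := gDeriv g) zero_le_one
      hg.continuousOn (fun x hx => ((hdiff x ⟨hx.1.le, hx.2.le⟩).hasDerivWithinAt.hasDerivAt
        (Icc_mem_nhds hx.1 hx.2)))
      (ContinuousOn.intervalIntegrable (by rwa [uIcc_of_le zero_le_one])), h_zero, sub_zero]
  refine ⟨Φ, _, kappa * M₂ ^ (1 / 3 : ℝ), _, hm, hΦm, fun t => ?_, hΦL, fun t ht => ?_, ?_, ?_⟩
  · simp only [hΦ]
    have h1 := hG t
    have h2 := (le_abs_self _).trans (hM₂ _ (hUmem t))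
    have h3 : 0 ≤ gDeriv2 g (U t) := hK.le.trans h1
    gcongr
  · have e : U t = uInv g t := by simp only [hU]; rw [clamp_of_mem ht]
    rw [← e]
    exact ⟨hK.trans_le (hG t), rfl⟩
  · have := hsub (fun _ => 1) continuous_const
    simpa using this
  · have := hsub (fun t => t) continuous_id
    rw [this, hgd]

end Curve

end LatticeLLT

namespace LatticeLLT
open ConvexLattice (CoprimePair multiPow paramZ rho alpha delta1 delta2 scaledSlope kappa gDeriv2
  uInv slopeMin slopeMax curvatureOfSlope measureQ endpoint endpointFilter SameOrder)

/-! ### The parameters attached to a curve -/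

lemma delta_identity {c t G : ℝ} (hc : 0 < c) (ht : 0 ≤ t) (hG : 0 ≤ G) :
    kappa * (G / (1 + t ^ 2) ^ (3 / 2 : ℝ)) ^ (1 / 3 : ℝ) * (c * √(1 + t ^ 2) / (c + t)) *
      (1 + t / c) = kappa * G ^ (1 / 3 : ℝ) := by
  have h1 : (0 : ℝ) < 1 + t ^ 2 := by positivity
  have h2 : ((1 + t ^ 2) ^ (3 / 2 : ℝ)) ^ (1 / 3 : ℝ) = √(1 + t ^ 2) := by
    rw [← Real.rpow_mul h1.le, Real.sqrt_eq_rpow]; norm_num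
  have h3 : √(1 + t ^ 2) ≠ 0 := (Real.sqrt_pos.mpr h1).ne'
  rw [Real.div_rpow hG (by positivity), h2]
  have : c + t ≠ 0 := by positivity
  field_simp

lemma toReal_exp_neg_coe (x : ℝ) : (EReal.exp (-(x : EReal))).toReal = Real.exp (-x) := by
  rw [← EReal.coe_neg, EReal.exp_coe, ENNReal.toReal_ofReal (Real.exp_pos _).le]

open Classical in
lemma multiPow_paramZ {g : ℝ → ℝ} {n : ℕ × ℕ} {Φ : ℝ → ℝ} (hg : 0 < g 1) (hα : 0 < alpha g n)
    (hρ : 0 < rho g n) (h0 : 0 ≤ slopeMin g) (h01 : slopeMin g ≤ slopeMax g)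
    (hΦ : ∀ t ∈ Icc (slopeMin g) (slopeMax g), 0 < gDeriv2 g (uInv g t) ∧
      Φ t = kappa * gDeriv2 g (uInv g t) ^ (1 / 3 : ℝ)) (x : CoprimePair) :
    multiPow (paramZ g n) x = if InCone (rho g n) (slopeMin g) (slopeMax g) x.1 then
      Real.exp (-(alpha g n * x.1.1 * Φ (rho g n * x.1.2 / x.1.1))) else 0 := by
  set ρ := rho g n with hρdef
  set α := alpha g n with hαdef
  have htop : delta1 g (scaledSlope g n x) = ⊤ → multiPow (paramZ g n) x = 0 := by
    intro h
    have h2 : delta2 g (scaledSlope g n x) = ⊤ := by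
      rw [delta2, h, EReal.top_div_of_pos_ne_top (by exact_mod_cast hg) (EReal.coe_ne_top _)]
    rw [multiPow, paramZ, h, h2, EReal.coe_mul_top_of_pos hα,
      EReal.coe_mul_top_of_pos (mul_pos hα hρ), EReal.neg_top, EReal.exp_bot, ENNReal.toReal_zero]
    rcases coprimePair_pos x with h | h
    · rw [zero_pow (by omega), zero_mul]
    · simp only
      rw [zero_pow (by omega : x.1.2 ≠ 0), mul_zero]
  rcases Nat.eq_zero_or_pos x.1.1 with hx | hx
  · have hx2 : 1 ≤ x.1.2 := by
      rcases coprimePair_pos x with h | h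
      · omega
      · exact h
    have hs : scaledSlope g n x = ⊤ := by
      rw [scaledSlope, hx, Nat.cast_zero, ENNReal.div_zero]
      have : (1 : ℝ) ≤ x.1.2 := by exact_mod_cast hx2
      have : 0 < ENNReal.ofReal (rho g n * x.1.2) := ENNReal.ofReal_pos.mpr (by positivity)
      exact this.ne'
    rw [if_neg (fun h => by have := h.1; omega)]
    apply htop
    rw [delta1, if_neg]
    rw [hs, top_le_iff]
    exact fun h => ENNReal.ofReal_ne_top h.2
  · have hx' : (0 : ℝ) < x.1.1 := by exact_mod_cast hx
    set t := ρ * x.1.2 / x.1.1 with ht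
    have ht0 : 0 ≤ t := by positivity
    have hs : scaledSlope g n x = ENNReal.ofReal t := by
      rw [scaledSlope, ht, ENNReal.ofReal_div_of_pos hx', ENNReal.ofReal_natCast]
    have hcond : (ENNReal.ofReal (slopeMin g) ≤ scaledSlope g n x ∧
        scaledSlope g n x ≤ ENNReal.ofReal (slopeMax g)) ↔
        InCone ρ (slopeMin g) (slopeMax g) x.1 := by
      rw [hs, ENNReal.ofReal_le_ofReal_iff ht0, ENNReal.ofReal_le_ofReal_iff (h0.trans h01), InCone]
      exact ⟨fun h => ⟨hx, h⟩, fun h => h.2⟩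
    by_cases hcone : InCone ρ (slopeMin g) (slopeMax g) x.1
    · rw [if_pos hcone]
      obtain ⟨hG, hΦt⟩ := hΦ t ⟨hcone.2.1, hcone.2.2⟩
      have hd1 : delta1 g (scaledSlope g n x) = ((kappa * curvatureOfSlope g t ^ (1 / 3 : ℝ) *
          (g 1 * √(1 + t ^ 2) / (g 1 + t)) : ℝ) : EReal) := by
        rw [delta1, if_pos (hcond.mpr hcone), hs, ENNReal.toReal_ofReal ht0]
      set d := kappa * curvatureOfSlope g t ^ (1 / 3 : ℝ) *
          (g 1 * √(1 + t ^ 2) / (g 1 + t)) with hd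
      have hd2 : delta2 g (scaledSlope g n x) = ((d / g 1 : ℝ) : EReal) := by
        rw [delta2, hd1, EReal.coe_div]
      rw [multiPow, paramZ, hd1, hd2, ← EReal.coe_mul, ← EReal.coe_mul]
      simp only
      rw [toReal_exp_neg_coe, toReal_exp_neg_coe, ← Real.exp_nat_mul, ← Real.exp_nat_mul,
        ← Real.exp_add]
      congr 1
      have hid := delta_identity hg ht0 hG.le
      rw [← hΦt] at hid
      have hid' : d * (1 + t / g 1) = Φ t := hid
      rw [← hid', ht]
      field_simp
      ring
    · rw [if_neg hcone]
      apply htop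
      rw [delta1, if_neg (fun h => hcone (hcond.mp h))]

lemma tendsto_rho {g : ℝ → ℝ} (hg : 0 < g 1) :
    Tendsto (rho g) (endpointFilter (g 1)) (𝓝 1) := by
  have h : Tendsto (fun n : ℕ × ℕ => (n.2 : ℝ) / (n.1 : ℝ)) (endpointFilter (g 1)) (𝓝 (g 1)) :=
    tendsto_comap.mono_left inf_le_right
  have h2 := (tendsto_const_nhds (x := g 1)).div h hg.ne'
  rw [div_self hg.ne'] at h2
  exact h2

lemma tendsto_fst_endpointFilter (c : ℝ) :
    Tendsto (fun n : ℕ × ℕ => (n.1 : ℝ)) (endpointFilter c) atTop :=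
  tendsto_natCast_atTop_atTop.comp (tendsto_fst.mono_left inf_le_left)

lemma eventually_snd_pos (c : ℝ) : ∀ᶠ n : ℕ × ℕ in endpointFilter c, 1 ≤ n.2 :=
  (tendsto_snd.mono_left (inf_le_left : endpointFilter c ≤ atTop ×ˢ atTop)).eventually
    (eventually_ge_atTop 1)

lemma tendsto_alpha {g : ℝ → ℝ} (hg : 0 < g 1) :
    Tendsto (alpha g) (endpointFilter (g 1)) (𝓝 0) := by
  have h : Tendsto (fun n : ℕ × ℕ => rho g n * (n.1 : ℝ)) (endpointFilter (g 1)) atTop :=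
    (tendsto_rho hg).pos_mul_atTop one_pos (tendsto_fst_endpointFilter _)
  exact (tendsto_rpow_neg_atTop (by norm_num : (0 : ℝ) < 1 / 3)).comp h

lemma geomMean_exp_neg (s : ℝ) : geomMean (Real.exp (-s)) = 1 / (Real.exp s - 1) := by
  have h := (Real.exp_pos s).ne'
  rw [geomMean, Real.exp_neg]
  by_cases h1 : Real.exp s - 1 = 0
  · have : Real.exp s = 1 := by linarith
    rw [this]; norm_num
  · have : 1 - (Real.exp s)⁻¹ ≠ 0 := by
      rw [show 1 - (Real.exp s)⁻¹ = (Real.exp s - 1) / Real.exp s by field_simp]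
      exact div_ne_zero h1 h
    field_simp

/-- Parameters of exponential form on a cone of slopes. -/
structure IsConeExp (Φ : ℝ → ℝ) (ρ α a b : ℝ) (z : CoprimePair → ℝ) : Prop where
  of_mem : ∀ x : CoprimePair, InCone ρ a b x.1 →
    z x = Real.exp (-(α * x.1.1 * Φ (ρ * x.1.2 / x.1.1)))
  of_notMem : ∀ x : CoprimePair, ¬InCone ρ a b x.1 → z x = 0

lemma IsConeExp.coneDominated {Φ : ℝ → ℝ} {ρ α a b m : ℝ} {z : CoprimePair → ℝ}
    (h : IsConeExp Φ ρ α a b z) (hα : 0 < α) (hρ : 1 / 2 ≤ ρ) (hΦ : ∀ t, m ≤ Φ t) :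
    ConeDominated m ⌈2 * b⌉₊ α z := by
  refine ⟨fun x => ?_, fun x => ?_, fun x hx => ?_⟩
  · by_cases hx : InCone ρ a b x.1
    · rw [h.of_mem x hx]; positivity
    · rw [h.of_notMem x hx]
  · by_cases hx : InCone ρ a b x.1
    · rw [h.of_mem x hx]
      apply Real.exp_le_exp.mpr
      have : α * x.1.1 * m ≤ α * x.1.1 * Φ (ρ * x.1.2 / x.1.1) := by
        gcongr; exact hΦ _
      linarith
    · rw [h.of_notMem x hx]; positivity
  · have hc : InCone ρ a b x.1 := by
      by_contra hc; exact hx (h.of_notMem x hc)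
    refine ⟨hc.1, ?_⟩
    have h1 : (0 : ℝ) < x.1.1 := by exact_mod_cast hc.1
    have h2 := hc.2.2
    rw [div_le_iff₀ h1] at h2
    have h3 : (x.1.2 : ℝ) ≤ ⌈2 * b⌉₊ * x.1.1 := by
      calc (x.1.2 : ℝ) ≤ 2 * (ρ * x.1.2) := by
            nlinarith [(Nat.cast_nonneg x.1.2 : (0 : ℝ) ≤ x.1.2)]
        _ ≤ 2 * (b * x.1.1) := by gcongr
        _ = 2 * b * x.1.1 := by ring
        _ ≤ _ := by gcongr; exact Nat.le_ceil _
    exact_mod_cast h3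

/-- The means of both coordinates, up to errors of the order `α⁻²`. -/
lemma exists_mean_error {Φ : ℝ → ℝ} {a b m M L : ℝ} (hm : 0 < m) (ha : 0 ≤ a) (hab : a < b)
    (hΦm : ∀ t, m ≤ Φ t) (hΦM : ∀ t, Φ t ≤ M) (hΦL : ∀ s t, |Φ s - Φ t| ≤ L * |s - t|) :
    ∃ C > 0, ∀ (ρ α : ℝ) (z : CoprimePair → ℝ), 1 / 2 ≤ ρ → 0 < α → IsConeExp Φ ρ α a b z →
      ∃ E : ℝ × ℝ, HasSum (fun x : CoprimePair => geomMean (z x) * x.1.1) E.1 ∧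
        HasSum (fun x : CoprimePair => geomMean (z x) * x.1.2) E.2 ∧
        |E.1 - kappa ^ 3 / (ρ * α ^ 3) * ∫ t in a..b, 1 / Φ t ^ 3| ≤ C / α ^ 2 ∧
        |E.2 - kappa ^ 3 / (ρ ^ 2 * α ^ 3) * ∫ t in a..b, t / Φ t ^ 3| ≤ C / α ^ 2 := by
  set M' := max M (max 1 b) with hM'
  set L' := max L 1 with hL'
  have hΦM' : ∀ t, Φ t ≤ M' := fun t => (hΦM t).trans (le_max_left _ _)
  have hΦL' : ∀ s t, |Φ s - Φ t| ≤ L' * |s - t| := fun s t =>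
    (hΦL s t).trans (mul_le_mul_of_nonneg_right (le_max_left _ _) (abs_nonneg _))
  obtain ⟨C₁, hC₁, h₁⟩ := exists_primitive_sum_error (ψ := fun _ => 1) (M := M') (L := L') hm ha
    hab.le hΦm hΦM' hΦL'
    (fun _ => by rw [abs_one]; exact (le_max_left _ _).trans (le_max_right _ _))
    (fun s t => by rw [sub_self, abs_zero]; positivity)
  obtain ⟨C₂, hC₂, h₂⟩ := exists_primitive_sum_error (ψ := clamp a b) (M := M') (L := L') hm ha
    hab.le hΦm hΦM' hΦL'
    (fun t => by
      obtain ⟨h1, h2⟩ := clamp_mem hab.le t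
      rw [abs_of_nonneg (ha.trans h1)]
      exact h2.trans ((le_max_right _ _).trans (le_max_right _ _)))
    (fun s t => (abs_clamp_sub_le a b s t).trans (by
      nlinarith [abs_nonneg (s - t), le_max_right L 1]))
  refine ⟨max C₁ (2 * C₂), by positivity, fun ρ α z hρ hα hz => ?_⟩
  have hρ0 : 0 < ρ := by linarith
  obtain ⟨S₁, hS₁, hE₁⟩ := h₁ ρ α hρ hα
  obtain ⟨S₂, hS₂, hE₂⟩ := h₂ ρ α hρ hα
  have hint : ∫ t in a..b, clamp a b t / Φ t ^ 3 = ∫ t in a..b, t / Φ t ^ 3 := by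
    refine intervalIntegral.integral_congr fun t ht => ?_
    rw [uIcc_of_le hab.le] at ht
    simp only [clamp_of_mem ht]
  rw [hint] at hE₂
  refine ⟨(S₁, ρ⁻¹ * S₂), ?_, ?_, ?_, ?_⟩
  · refine (congrArg (fun f => HasSum f S₁) (funext fun x => ?_)).mpr hS₁
    by_cases hx : InCone ρ a b x.1
    · rw [if_pos hx, hz.of_mem x hx, geomMean_exp_neg]; ring
    · rw [if_neg hx, hz.of_notMem x hx, geomMean_zero, zero_mul]
  · refine (congrArg (fun f => HasSum f (ρ⁻¹ * S₂)) (funext fun x => ?_)).mpr (hS₂.mul_left ρ⁻¹)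
    by_cases hx : InCone ρ a b x.1
    · have : (x.1.1 : ℝ) ≠ 0 := by exact_mod_cast (by have := hx.1; omega : x.1.1 ≠ 0)
      rw [if_pos hx, hz.of_mem x hx, geomMean_exp_neg, clamp_of_mem hx.2]
      field_simp
    · rw [if_neg hx, hz.of_notMem x hx, geomMean_zero, zero_mul, mul_zero]
  · exact hE₁.trans (by gcongr; exact le_max_left _ _)
  · have e : ρ⁻¹ * S₂ - kappa ^ 3 / (ρ ^ 2 * α ^ 3) * ∫ t in a..b, t / Φ t ^ 3 =
        ρ⁻¹ * (S₂ - kappa ^ 3 / (ρ * α ^ 3) * ∫ t in a..b, t / Φ t ^ 3) := by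
      field_simp
    have hρi : ρ⁻¹ ≤ 2 := by rw [inv_le_comm₀ hρ0 two_pos]; linarith
    simp only
    rw [e, abs_mul, abs_of_pos (inv_pos.mpr hρ0)]
    calc _ ≤ 2 * (C₂ / α ^ 2) := by gcongr
      _ = 2 * C₂ / α ^ 2 := by ring
      _ ≤ _ := by gcongr; exact le_max_right _ _

lemma sameOrder_of_bounds {ι : Type*} {l : Filter ι} {a b : ι → ℝ} {c C : ℝ} (hc : 0 < c)
    (h : ∀ᶠ i in l, c ≤ a i / b i ∧ a i / b i ≤ C) : SameOrder l a b := by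
  constructor
  · refine lt_of_lt_of_le (b := ((c : ℝ) : EReal)) (by exact_mod_cast hc) (le_liminf_of_le ?_ ?_)
    · isBoundedDefault
    · filter_upwards [h] with i hi
      exact_mod_cast hi.1
  · refine lt_of_le_of_lt (b := ((C : ℝ) : EReal)) (limsup_le_of_le ?_ ?_) (EReal.coe_lt_top C)
    · isBoundedDefault
    · filter_upwards [h] with i hi
      exact_mod_cast hi.2

/-- The probability of hitting the prescribed endpoint is of the order `α ^ 4`. -/
lemma eventually_measureQ_mem_Icc {g : ℝ → ℝ} {K₀ : ℝ} (h_zero : g 0 = 0)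
    (h_mono : StrictMonoOn g (Icc 0 1)) (h_smooth : ContDiffOn ℝ 3 g (Icc 0 1)) (hK : 0 < K₀)
    (hcurv : ∀ u ∈ Icc (0 : ℝ) 1, K₀ ≤ ConvexLattice.curvature g u) :
    ∃ c > 0, ∃ C > 0, ∀ᶠ n in endpointFilter (g 1),
      (measureQ (paramZ g n)).real {ν | endpoint ν = n} ∈
        Icc (c * alpha g n ^ 4) (C * alpha g n ^ 4) := by
  have hg : 0 < g 1 := by
    have := h_mono (a := 0) (b := 1) (by simp) (by simp) one_pos
    rwa [h_zero] at this
  obtain ⟨h0, h01, Φ, m, M, L, hm, hΦm, hΦM, hΦL, hΦ, hI₁, hI₂⟩ :=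
    exists_slope_function h_mono h_smooth h_zero hK hcurv
  set a := slopeMin g
  set b := slopeMax g
  obtain ⟨C₀, hC₀, hmean⟩ := exists_mean_error hm h0 h01 hΦm hΦM hΦL
  set δ := (b - a) / 3 with hδ
  have hδ0 : 0 < δ := by rw [hδ]; linarith
  obtain ⟨α₀, hα₀, c, hc, C, hC, hllt⟩ := exists_cone_local_limit (m := m) (M := M)
    (D := 2 * C₀ ^ 2) (u := a + δ) (v := b - δ) ⌈2 * b⌉₊ hm (by linarith)
    (by rw [hδ]; linarith)
  refine ⟨c, hc, C, hC, ?_⟩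
  have hρt := tendsto_rho hg
  have hρ1 : ∀ᶠ n in endpointFilter (g 1), 1 / 2 < rho g n := hρt.eventually_const_lt (by norm_num)
  have hρ2 : ∀ᶠ n in endpointFilter (g 1), a < rho g n * (a + δ) :=
    (hρt.mul_const (a + δ)).eventually_const_lt (by linarith)
  have hρ3 : ∀ᶠ n in endpointFilter (g 1), rho g n * (b - δ) < b :=
    (hρt.mul_const (b - δ)).eventually_lt_const (by linarith)
  filter_upwards [hρ1, hρ2, hρ3, (tendsto_alpha hg).eventually_lt_const hα₀,
    (tendsto_fst_endpointFilter (g 1)).eventually_ge_atTop 1, eventually_snd_pos (g 1)]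
    with n h1 h2 h3 h4 hn1 hn2
  set ρ := rho g n with hρ
  set α := alpha g n with hαdef
  have hρ0 : 0 < ρ := by linarith
  have hn1' : (0 : ℝ) < n.1 := by linarith
  have hn2' : (0 : ℝ) < n.2 := by exact_mod_cast hn2
  have hα : 0 < α := Real.rpow_pos_of_pos (mul_pos hρ0 hn1') _
  have hα3 : α ^ 3 = (ρ * n.1)⁻¹ := by
    rw [hαdef, alpha, ← Real.rpow_natCast, ← Real.rpow_mul (mul_pos hρ0 hn1').le,
      ← Real.rpow_neg_one]
    norm_num [hρ]
  have hz : IsConeExp Φ ρ α a b (multiPow (paramZ g n)) :=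
    ⟨fun x hx => by rw [multiPow_paramZ hg hα hρ0 h0 h01.le hΦ, if_pos hx],
      fun x hx => by rw [multiPow_paramZ hg hα hρ0 h0 h01.le hΦ, if_neg hx]⟩
  have hdom := hz.coneDominated hα h1.le hΦm
  obtain ⟨E, hE1, hE2, hb1, hb2⟩ := hmean ρ α _ h1.le hα hz
  refine measureQ_real_endpoint_mem_Icc hdom.nonneg (hdom.lt_one hm hα) (hdom.summable hm hα)
    (hllt α hα h4 _ hdom ?_ n E hE1 hE2 ?_)
  · intro x hx1 hx2 hx3
    have hcone : InCone ρ a b x.1 := by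
      refine ⟨hx1, ?_, ?_⟩
      · rw [mul_div_assoc]
        exact h2.le.trans (mul_le_mul_of_nonneg_left hx2 hρ0.le)
      · rw [mul_div_assoc]
        exact (mul_le_mul_of_nonneg_left hx3 hρ0.le).trans h3.le
    rw [hz.of_mem x hcone]
    apply Real.exp_le_exp.mpr
    have : α * x.1.1 * Φ (ρ * x.1.2 / x.1.1) ≤ α * x.1.1 * M := by
      gcongr; exact hΦM _
    linarith
  · have hκ := kappa_pos
    have e1 : kappa ^ 3 / (ρ * α ^ 3) * (1 / kappa ^ 3) = n.1 := by
      rw [hα3]; field_simp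
    have e2 : kappa ^ 3 / (ρ ^ 2 * α ^ 3) * (g 1 / kappa ^ 3) = n.2 := by
      have e3 : ρ * n.2 = g 1 * n.1 := by
        rw [hρ, rho]; field_simp
      rw [hα3]; field_simp
      linarith
    rw [hI₁, e1] at hb1
    rw [hI₂, e2] at hb2
    have q1 := sq_le_sq' (abs_le.mp hb1).1 (abs_le.mp hb1).2
    have q2 := sq_le_sq' (abs_le.mp hb2).1 (abs_le.mp hb2).2
    have e4 : 2 * C₀ ^ 2 / α ^ 4 = (C₀ / α ^ 2) ^ 2 + (C₀ / α ^ 2) ^ 2 := by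
      field_simp; ring
    rw [e4]
    linarith

end LatticeLLT

theorem corollary7p2 (g : ℝ → ℝ) (h_zero : g 0 = 0)
    (h_mono : StrictMonoOn g (Icc 0 1))
    (h_convex : StrictConvexOn ℝ (Icc 0 1) g)
    (h_smooth : ContDiffOn ℝ 3 g (Icc 0 1))
    (h_curv : ∃ K₀ : ℝ, 0 < K₀ ∧ ∀ u ∈ Icc (0 : ℝ) 1, K₀ ≤ ConvexLattice.curvature g u) :
    ConvexLattice.SameOrder (ConvexLattice.endpointFilter (g 1))
      (fun n => (ConvexLattice.measureQ (ConvexLattice.paramZ g n)).real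
        {ν | ConvexLattice.endpoint ν = n})
      (fun n => (n.1 : ℝ) ^ (-(4 / 3) : ℝ)) := by
  obtain ⟨K₀, hK, hcurv⟩ := h_curv
  have hg : 0 < g 1 := by
    have := h_mono (a := 0) (b := 1) (by simp) (by simp) one_pos
    rwa [h_zero] at this
  obtain ⟨c, hc, C, hC, h⟩ :=
    LatticeLLT.eventually_measureQ_mem_Icc h_zero h_mono h_smooth hK hcurv
  have hρt := LatticeLLT.tendsto_rho hg
  refine LatticeLLT.sameOrder_of_bounds (c := c * (2 : ℝ) ^ (-(4 / 3) : ℝ))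
    (C := C * (1 / 2 : ℝ) ^ (-(4 / 3) : ℝ)) (by positivity) ?_
  filter_upwards [h, hρt.eventually_const_lt (by norm_num : (1 / 2 : ℝ) < 1),
    hρt.eventually_lt_const (by norm_num : (1 : ℝ) < 2),
    (LatticeLLT.tendsto_fst_endpointFilter (g 1)).eventually_gt_atTop 0] with n hn h1 h2 hn1
  set ρ := ConvexLattice.rho g n with hρ
  have hρ0 : 0 < ρ := by linarith
  have hα : ConvexLattice.alpha g n ^ 4 = ρ ^ (-(4 / 3) : ℝ) * (n.1 : ℝ) ^ (-(4 / 3) : ℝ) := by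
    rw [ConvexLattice.alpha, ← Real.rpow_natCast, ← Real.rpow_mul (mul_pos hρ0 hn1).le,
      ← Real.mul_rpow hρ0.le hn1.le]
    norm_num [hρ]
  have hp : 0 < (n.1 : ℝ) ^ (-(4 / 3) : ℝ) := Real.rpow_pos_of_pos hn1 _
  rw [hα, ← mul_assoc, ← mul_assoc] at hn
  rw [le_div_iff₀ hp, div_le_iff₀ hp]
  constructor
  · refine le_trans ?_ hn.1
    gcongr ?_ * _
    gcongr c * ?_
    exact Real.rpow_le_rpow_of_nonpos hρ0 h2.le (by norm_num)
  · refine hn.2.trans ?_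
    gcongr ?_ * _
    gcongr C * ?_
    exact Real.rpow_le_rpow_of_nonpos (by norm_num) h1.le (by norm_num)
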